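/- Let $L,\rho,\mu,\alpha_1,\beta,c>0$, $\gamma,\delta\in\mathbb R$, $m\in[0,1]$, and put $\alpha=\alpha_1+\gamma^2\beta$. Let $\sigma:(0,\infty)\to[0,\infty)$ satisfy (H) $\sigma\in L^1(0,\infty)\cap C^1(0,\infty)$, $\int_0^\infty\sigma(s)\,ds>0$, the limit $\sigma(0)=\lim_{s\to0^+}\sigma(s)$ exists and is finite, and $\sigma'(s)\le-d_\sigma\sigma(s)$ for all $s>0$, with some constant $d_\sigma>0$. All spaces are complex. Let $H^1_L(0,L)=\{u\in H^1(0,L):u(0)=0\}$, and let $H^1_L(0,L)$ and $H^1_0(0,L)$ carry the inner product $\int_0^L u_x\overline{\tilde u_x}\,dx$. Let $W=L^2_\sigma(\mathbb R^+;H^1_0(0,L))$ be the space of $H^1_0(0,L)$-valued functions that are square integrable with respect to $\sigma(s)\,ds$, with $(\eta,\tilde\eta)_W=cm\int_0^\infty\sigma(s)\int_0^L\eta_x\overline{\tilde\eta_x}\,dx\,ds$ (elements of norm $0$ are identified with $0$; so $W=\{0\}$ if $m=0$). Let $\mathcal H=(H^1_L(0,L)\times L^2(0,L))^2\times L^2(0,L)\times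 W$, with the inner product of $U=(u,v,y,z,w,\eta)$ and $\tilde U=(\tilde u,\tilde v,\tilde y,\tilde z,\tilde w,\tilde\eta)$ given by $$\langle U,\tilde U\rangle_{\mathcal H}=\int_0^L\Big[\rho v\overline{\tilde v}+\alpha_1u_x\overline{\tilde u_x}+\mu z\overline{\tilde z}+\beta(\gamma u_x-y_x)\overline{(\gamma\tilde u_x-\tilde y_x)}+w\overline{\tilde w}\Big]dx+(\eta,\tilde\eta)_W .$$ For $U=(u,v,y,z,w,\eta)$ put $\Lambda^m=(1-m)w+m\int_0^\infty\sigma(s)\eta(s)\,ds$, and define the unbounded operator $\mathcal A_m$ on $\mathcal H$ by $$\mathcal A_mU=\Big(v,\ \tfrac1\rho(\alpha u_{xx}-\gamma\beta y_{xx}-\delta w_x),\ z,\ \tfrac1\mu(\beta y_{xx}-\gamma\beta u_{xx}),\ c\Lambda^m_{xx}-\delta v_x,\ -\eta_s+w\Big),$$ $$D(\mathcal A_m)=\Big\{U\in\mathcal H:\ v,z\in H^1_L(0,L),\ u,y\in H^2(0,L),\ w\in H^1_0(0,L),\ \Lambda^m_x\in H^1(0,L),\ \eta_s\in W,\ \eta(\cdot,0)=0,\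 u_x(L)=y_x(L)=0\Big\}.$$ Then $\mathcal H$ is a Hilbert space, and the following hold. 1. $\mathcal A_m$ is m-dissipative in $\mathcal H$, that is, $\operatorname{Re}\langle\mathcal A_mU,U\rangle_{\mathcal H}\le0$ for all $U\in D(\mathcal A_m)$, and $\lambda I-\mathcal A_m:D(\mathcal A_m)\to\mathcal H$ is onto for every $\lambda>0$. Moreover $D(\mathcal A_m)$ is dense in $\mathcal H$, and for every $F\in\mathcal H$ the equation $-\mathcal A_mU=F$ has exactly one solution $U\in D(\mathcal A_m)$. 2. $\mathcal A_m$ is the infinitesimal generator of a $C_0$-semigroup of contractions $(e^{t\mathcal A_m})_{t\ge0}$ on $\mathcal H$. 3. For every $U_0\in\mathcal H$, $U(t)=e^{t\mathcal A_m}U_0\in C^0(\mathbb R^+,\mathcal H)$ is the unique weak solution of $U_t=\mathcal A_mU$, $U(0)=U_0$. Here a weak solution is a $U\in C^0(\mathbb R^+,\mathcal H)$ with $U(0)=U_0$ such that, for all $V\in D(\mathcal A_m^*)$, the function $t\mapsto\langle U(t),V\rangle_{\mathcal H}$ is differentiable on $[0,\infty)$ with derivative $\langle U(t),\mathcal A_m^*V\rangle_{\mathcal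 H}$. 4. For every $U_0\in D(\mathcal A_m)$, $U(t)=e^{t\mathcal A_m}U_0$ is the unique strong solution, that is, the unique $U\in C^0(\mathbb R^+,D(\mathcal A_m))\cap C^1(\mathbb R^+,\mathcal H)$ with $U_t=\mathcal A_mU$ on $[0,\infty)$ and $U(0)=U_0$, where $D(\mathcal A_m)$ carries the graph norm. -/

import Mathlib

open MeasureTheory Filter Topology Set
open scoped ContDiff ENNReal ComplexConjugate

noncomputable section

namespace Piezo

/-! ### Weak derivatives on open subsets of the line -/

/-- `g` is the weak derivative of `f` on the open set `Ω ⊆ ℝ`: both are locally integrable on `Ω`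
and `∫ φ' f = - ∫ φ g` for every smooth `φ` with compact support in `Ω`. -/
structure HasWeakDerivOn {E : Type*} [NormedAddCommGroup E] [NormedSpace ℝ E]
    (Ω : Set ℝ) (f g : ℝ → E) : Prop where
  locInt : LocallyIntegrableOn f Ω
  locInt_deriv : LocallyIntegrableOn g Ω
  integral_eq : ∀ φ : ℝ → ℝ, ContDiff ℝ ∞ φ → HasCompactSupport φ → tsupport φ ⊆ Ω →
    ∫ x in Ω, deriv φ x • f x = - ∫ x in Ω, φ x • g x

section WeakDeriv

variable {E : Type*} [NormedAddCommGroup E] [NormedSpace ℝ E] {Ω : Set ℝ} {f g f₁ g₁ f₂ g₂ : ℝ → E}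

theorem integrableOn_smul_of_tsupport {φ : ℝ → ℝ} (hφ : Continuous φ)
    (hc : HasCompactSupport φ) (hs : tsupport φ ⊆ Ω) (hf : LocallyIntegrableOn f Ω) :
    IntegrableOn (fun x => φ x • f x) Ω := by
  have h1 : IntegrableOn (fun x => φ x • f x) (tsupport φ) :=
    (hf.integrableOn_compact_subset hs hc).continuousOn_smul hφ.continuousOn hc
  refine IntegrableOn.of_forall_sdiff_eq_zero (s := tsupport φ) h1 ?_ ?_ |>.mono_set (subset_univ Ω)
  · exact MeasurableSet.univ
  · intro x hx
    have : φ x = 0 := image_eq_zero_of_notMem_tsupport hx.2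
    simp [this]

theorem tsupport_deriv_subset' {φ : ℝ → ℝ} : tsupport (deriv φ) ⊆ tsupport φ :=
  closure_minimal (support_deriv_subset) (isClosed_tsupport φ)

theorem HasWeakDerivOn.add (h₁ : HasWeakDerivOn Ω f₁ g₁) (h₂ : HasWeakDerivOn Ω f₂ g₂) :
    HasWeakDerivOn Ω (f₁ + f₂) (g₁ + g₂) := by
  refine ⟨h₁.1.add h₂.1, h₁.2.add h₂.2, fun φ hφ hc hs => ?_⟩
  have hφ' : Continuous (deriv φ) := hφ.continuous_deriv (by simp)
  have hs' := tsupport_deriv_subset'.trans hs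
  simp only [Pi.add_apply, smul_add]
  rw [integral_add (integrableOn_smul_of_tsupport hφ' hc.deriv hs' h₁.1)
      (integrableOn_smul_of_tsupport hφ' hc.deriv hs' h₂.1),
    integral_add (integrableOn_smul_of_tsupport hφ.continuous hc hs h₁.2)
      (integrableOn_smul_of_tsupport hφ.continuous hc hs h₂.2),
    h₁.3 φ hφ hc hs, h₂.3 φ hφ hc hs, neg_add]

theorem HasWeakDerivOn.smul [NormedSpace ℂ E] (a : ℂ) (h : HasWeakDerivOn Ω f g) :
    HasWeakDerivOn Ω (a • f) (a • g) := by
  refine ⟨h.1.smul a, h.2.smul a, fun φ hφ hc hs => ?_⟩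
  have := h.3 φ hφ hc hs
  simp only [Pi.smul_apply, smul_comm _ a]
  rw [integral_smul, integral_smul, this, smul_neg]

theorem HasWeakDerivOn.zero : HasWeakDerivOn Ω (0 : ℝ → E) 0 :=
  ⟨locallyIntegrableOn_zero, locallyIntegrableOn_zero, by simp⟩

theorem HasWeakDerivOn.congr (hf : f₁ =ᵐ[volume.restrict Ω] f₂)
    (hg : g₁ =ᵐ[volume.restrict Ω] g₂) (h : HasWeakDerivOn Ω f₁ g₁) :
    HasWeakDerivOn Ω f₂ g₂ := by
  refine ⟨h.1.congr hf, h.2.congr hg, fun φ hφ hc hs => ?_⟩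
  have e₁ : ∫ x in Ω, deriv φ x • f₁ x = ∫ x in Ω, deriv φ x • f₂ x :=
    integral_congr_ae (hf.mono fun x hx => by simp only [hx])
  have e₂ : ∫ x in Ω, φ x • g₁ x = ∫ x in Ω, φ x • g₂ x :=
    integral_congr_ae (hg.mono fun x hx => by simp only [hx])
  rw [← e₁, ← e₂, h.3 φ hφ hc hs]

/-- A weak derivative is determined almost everywhere. -/
theorem HasWeakDerivOn.unique [CompleteSpace E] (hΩ : IsOpen Ω) (h₁ : HasWeakDerivOn Ω f g₁)
    (h₂ : HasWeakDerivOn Ω f g₂) : g₁ =ᵐ[volume.restrict Ω] g₂ := by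
  have key := hΩ.ae_eq_zero_of_integral_contDiff_smul_eq_zero (μ := volume)
    (f := fun x => g₁ x - g₂ x) (h₁.2.sub h₂.2) (fun φ hφ hc hs => by
      have e : ∫ x, φ x • (g₁ x - g₂ x) = ∫ x in Ω, φ x • (g₁ x - g₂ x) := by
        rw [setIntegral_eq_integral_of_forall_compl_eq_zero]
        intro x hx
        have : φ x = 0 := image_eq_zero_of_notMem_tsupport fun h => hx (hs h)
        simp [this]
      rw [e]
      simp only [smul_sub]
      rw [integral_sub (integrableOn_smul_of_tsupport hφ.continuous hc hs h₁.2)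
        (integrableOn_smul_of_tsupport hφ.continuous hc hs h₂.2), ← neg_eq_iff_eq_neg.2
          (h₁.3 φ hφ hc hs), ← neg_eq_iff_eq_neg.2 (h₂.3 φ hφ hc hs), sub_self])
  rw [EventuallyEq, ae_restrict_iff' hΩ.measurableSet]
  filter_upwards [key] with x hx hxΩ
  exact sub_eq_zero.1 (hx hxΩ)

end WeakDeriv

/-- A function on an interval whose weak derivative vanishes is almost everywhere constant. -/
theorem ae_const_of_hasWeakDerivOn_zero {a b : ℝ} (hab : a < b) {f : ℝ → ℂ}
    (hf : HasWeakDerivOn (Ioo a b) f 0) : ∃ k : ℂ, f =ᵐ[volume.restrict (Ioo a b)] fun _ => k := by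
  obtain ⟨θ₀, hθs, hθc, hθd, hθr, hθ1⟩ := exists_contDiff_tsupport_subset (n := ⊤)
    (Ioo_mem_nhds (show a < (a + b) / 2 by linarith) (show (a + b) / 2 < b by linarith))
  have hI : 0 < ∫ x, θ₀ x := by
    refine (hθd.continuous.integral_pos_of_hasCompactSupport_nonneg_nonzero hθc
      (fun x => (hθr ⟨x, rfl⟩).1) (x := (a + b) / 2) ?_)
    rw [hθ1]; exact one_ne_zero
  set J : ℝ := ∫ x, θ₀ x with hJ
  set θ : ℝ → ℝ := fun x => J⁻¹ * θ₀ x with hθ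
  have hθint : ∫ x, θ x = 1 := by
    rw [hθ, integral_const_mul, ← hJ, inv_mul_cancel₀ hI.ne']
  have hθd' : ContDiff ℝ ∞ θ := contDiff_const.mul hθd
  have hsub : tsupport θ ⊆ tsupport θ₀ := tsupport_mul_subset_right
  have hθc' : HasCompactSupport θ := hθc.mul_left
  have hθs' : tsupport θ ⊆ Ioo a b := hsub.trans hθs
  set k : ℂ := ∫ x in Ioo a b, θ x • f x with hk
  refine ⟨k, ?_⟩
  have hconst : LocallyIntegrableOn (fun _ : ℝ => k) (Ioo a b) := locallyIntegrableOn_const k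
  have full : ∀ {F : Type} [NormedAddCommGroup F] [NormedSpace ℝ F] (φ : ℝ → ℝ) (h : ℝ → F),
      tsupport φ ⊆ Ioo a b → ∫ x, φ x • h x = ∫ x in Ioo a b, φ x • h x := by
    intro F _ _ φ h hs
    rw [setIntegral_eq_integral_of_forall_compl_eq_zero]
    intro x hx
    have : φ x = 0 := image_eq_zero_of_notMem_tsupport fun h => hx (hs h)
    simp [this]
  have key := isOpen_Ioo.ae_eq_zero_of_integral_contDiff_smul_eq_zero (μ := volume)
    (f := fun x => f x - k) (hf.1.sub hconst) (fun φ hφ hc hs => by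
      set I : ℝ := ∫ x, φ x with hIφ
      -- the mean-free function `χ` and its compactly supported primitive `ψ`
      set χ : ℝ → ℝ := fun x => φ x - I * θ x with hχ
      have hχd : ContDiff ℝ ∞ χ := hφ.sub (contDiff_const.mul hθd')
      have hφint : Integrable φ := hφ.continuous.integrable_of_hasCompactSupport hc
      have hθi : Integrable θ := hθd'.continuous.integrable_of_hasCompactSupport hθc'
      have hχi : Integrable χ := hφint.sub (hθi.const_mul I)
      have hχint : ∫ x, χ x = 0 := by
        rw [hχ, integral_sub hφint (hθi.const_mul I), integral_const_mul, hθint]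
        simp [hIφ]
      obtain ⟨p, q, hap, hpq, hqb, hsupp⟩ : ∃ p q, a < p ∧ p ≤ q ∧ q < b ∧
          ∀ x, x ∉ Icc p q → χ x = 0 := by
        have hKc : IsCompact (tsupport φ ∪ tsupport θ₀) := hc.isCompact.union hθc.isCompact
        have hKne : (tsupport φ ∪ tsupport θ₀).Nonempty :=
          ⟨(a + b) / 2, Or.inr (subset_tsupport _ (by simp [hθ1]))⟩
        have hKs : tsupport φ ∪ tsupport θ₀ ⊆ Ioo a b := union_subset hs hθs
        refine ⟨sInf (tsupport φ ∪ tsupport θ₀), sSup (tsupport φ ∪ tsupport θ₀),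
          (hKs (hKc.sInf_mem hKne)).1, ?_, (hKs (hKc.sSup_mem hKne)).2, ?_⟩
        · exact csInf_le_csSup hKne hKc.bddBelow hKc.bddAbove
        · intro x hx
          have hx' : x ∉ tsupport φ ∪ tsupport θ₀ := fun h =>
            hx ⟨csInf_le hKc.bddBelow h, le_csSup hKc.bddAbove h⟩
          have h1 : φ x = 0 := image_eq_zero_of_notMem_tsupport fun h => hx' (Or.inl h)
          have h2 : θ₀ x = 0 := image_eq_zero_of_notMem_tsupport fun h => hx' (Or.inr h)
          simp [hχ, hθ, h1, h2]
      set ψ : ℝ → ℝ := fun x => ∫ t in a..x, χ t with hψ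
      have hψ' : ∀ x, HasDerivAt ψ (χ x) x := fun x =>
        intervalIntegral.integral_hasDerivAt_right (hχi.intervalIntegrable)
          (hχd.continuous.stronglyMeasurableAtFilter _ _) hχd.continuous.continuousAt
      have hψd' : deriv ψ = χ := funext fun x => (hψ' x).deriv
      have hψd : ContDiff ℝ ∞ ψ := by
        rw [contDiff_infty_iff_deriv, hψd']
        exact ⟨fun x => (hψ' x).differentiableAt, hχd⟩
      have hψz : ∀ x, x ∉ Icc p q → ψ x = 0 := by
        intro x hx
        rcases lt_or_ge x p with hxp | hxp
        · apply intervalIntegral.integral_zero_ae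
          refine Eventually.of_forall fun t ht => hsupp t fun h => ?_
          have : t ≤ max a x := ht.2
          rcases le_max_iff.1 this with h' | h' <;> linarith [h.1]
        · have hqx : q < x := by
            by_contra h
            exact hx ⟨hxp, not_lt.1 h⟩
          have hax : a ≤ x := by linarith
          have : ψ x = ∫ t, χ t := by
            rw [hψ]
            simp only
            rw [intervalIntegral.integral_of_le hax]
            apply setIntegral_eq_integral_of_forall_compl_eq_zero
            intro t ht
            refine hsupp t fun h => ht ⟨by linarith [h.1], by linarith [h.2]⟩
          rw [this, hχint]
      have hψts : tsupport ψ ⊆ Icc p q := by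
        refine closure_minimal (fun x hx => ?_) isClosed_Icc
        by_contra h
        exact hx (hψz x h)
      have hψc : HasCompactSupport ψ := isCompact_Icc.of_isClosed_subset (isClosed_tsupport _) hψts
      have hψΩ : tsupport ψ ⊆ Ioo a b := fun x hx =>
        ⟨by linarith [(hψts hx).1], by linarith [(hψts hx).2]⟩
      have e := hf.3 ψ hψd hψc hψΩ
      rw [hψd'] at e
      simp only [Pi.zero_apply, smul_zero, integral_zero, neg_zero] at e
      have i1 := integrableOn_smul_of_tsupport hφ.continuous hc hs hf.1
      have i2 := integrableOn_smul_of_tsupport hθd'.continuous hθc' hθs' hf.1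
      have i3 := integrableOn_smul_of_tsupport hφ.continuous hc hs hconst
      have e2 : ∫ x in Ioo a b, χ x • f x = (∫ x in Ioo a b, φ x • f x) - I • k := by
        have i2' : IntegrableOn (fun x => I • θ x • f x) (Ioo a b) := i2.smul I
        rw [hk, ← integral_smul, ← integral_sub i1 i2']
        congr 1
        ext x
        simp only [hχ, sub_smul, mul_smul]
      have e3 : ∫ x in Ioo a b, φ x • k = I • k := by
        rw [← full φ (fun _ => k) hs, integral_smul_const]
      rw [full φ _ hs]
      simp only [smul_sub]
      rw [integral_sub i1 i3, e3, ← e2, e])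
  rw [EventuallyEq, ae_restrict_iff' measurableSet_Ioo]
  filter_upwards [key] with x hx hxΩ
  exact sub_eq_zero.1 (hx hxΩ)

theorem integral_deriv_mul_primitive {a b : ℝ} {g : ℝ → ℝ} (hg : IntervalIntegrable g volume a b)
    {φ : ℝ → ℝ} (hφ : ContDiff ℝ ∞ φ) (ha : φ a = 0) (hb : φ b = 0) :
    ∫ x in a..b, deriv φ x * (∫ t in a..x, g t) = - ∫ x in a..b, φ x * g x := by
  have hφa : AbsolutelyContinuousOnInterval φ a b :=
    (hφ.of_le (by simp)).contDiffOn.absolutelyContinuousOnInterval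
  have hFa := hg.absolutelyContinuousOnInterval_intervalIntegral (left_mem_uIcc)
  have h := hφa.integral_mul_deriv_eq_deriv_mul hFa
  have e : ∫ x in a..b, φ x * deriv (fun x => ∫ t in a..x, g t) x = ∫ x in a..b, φ x * g x := by
    apply intervalIntegral.integral_congr_ae
    filter_upwards [hg.ae_hasDerivAt_integral] with x hx hx'
    rw [(hx (uIoc_subset_uIcc hx') a left_mem_uIcc).deriv]
  rw [e, ha, hb] at h
  linarith

/-- The primitive of an integrable function has that function as its weak derivative. -/
theorem hasWeakDerivOn_primitive {a b : ℝ} (hab : a ≤ b) {g : ℝ → ℂ}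
    (hg : IntegrableOn g (Ioo a b)) :
    HasWeakDerivOn (Ioo a b) (fun x => ∫ t in a..x, g t) g := by
  have hgi : IntervalIntegrable g volume a b :=
    (intervalIntegrable_iff_integrableOn_Ioo_of_le hab).2 hg
  have hcont : ContinuousOn (fun x => ∫ t in a..x, g t) (Icc a b) := by
    have := intervalIntegral.continuousOn_primitive_interval' hgi left_mem_uIcc
    rwa [uIcc_of_le hab] at this
  refine ⟨(hcont.mono Ioo_subset_Icc_self).locallyIntegrableOn measurableSet_Ioo,
    hg.locallyIntegrableOn, fun φ hφ hc hs => ?_⟩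
  have ha : φ a = 0 := image_eq_zero_of_notMem_tsupport fun h => lt_irrefl _ (hs h).1
  have hb : φ b = 0 := image_eq_zero_of_notMem_tsupport fun h => lt_irrefl _ (hs h).2
  have hφ' : Continuous (deriv φ) := hφ.continuous_deriv (by simp)
  have i1 : IntegrableOn (fun x => deriv φ x • ∫ t in a..x, g t) (Ioo a b) :=
    ((hφ'.continuousOn.smul hcont).integrableOn_Icc).mono_set Ioo_subset_Icc_self
  have i2 : IntegrableOn (fun x => φ x • g x) (Ioo a b) :=
    integrableOn_smul_of_tsupport hφ.continuous hc hs hg.locallyIntegrableOn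
  have conv : ∀ h : ℝ → ℝ, ∫ x in Ioo a b, h x = ∫ x in a..b, h x := fun h => by
    rw [intervalIntegral.integral_of_le hab, integral_Ioc_eq_integral_Ioo]
  have sub : ∀ x ∈ Ioo a b, IntervalIntegrable g volume a x := fun x hx =>
    hgi.mono_set (by rw [uIcc_of_le hx.1.le, uIcc_of_le hab]; exact Icc_subset_Icc_right hx.2.le)
  have hre : IntervalIntegrable (fun t => (g t).re) volume a b :=
    (intervalIntegrable_iff_integrableOn_Ioo_of_le hab).2 hg.re
  have him : IntervalIntegrable (fun t => (g t).im) volume a b :=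
    (intervalIntegrable_iff_integrableOn_Ioo_of_le hab).2 hg.im
  apply Complex.ext
  · have e1 := Complex.reCLM.integral_comp_comm i1
    have e2 := Complex.reCLM.integral_comp_comm i2
    simp only [Complex.reCLM_apply, Complex.real_smul, Complex.re_ofReal_mul] at e1 e2
    simp only [Complex.real_smul, Complex.neg_re, ← e1, ← e2]
    rw [conv (fun x => φ x * (g x).re), ← integral_deriv_mul_primitive hre hφ ha hb, ← conv]
    refine setIntegral_congr_fun measurableSet_Ioo fun x hx => ?_
    congr 1
    exact (Complex.reCLM.intervalIntegral_comp_comm (sub x hx)).symm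
  · have e1 := Complex.imCLM.integral_comp_comm i1
    have e2 := Complex.imCLM.integral_comp_comm i2
    simp only [Complex.imCLM_apply, Complex.real_smul, Complex.im_ofReal_mul] at e1 e2
    simp only [Complex.real_smul, Complex.neg_im, ← e1, ← e2]
    rw [conv (fun x => φ x * (g x).im), ← integral_deriv_mul_primitive him hφ ha hb, ← conv]
    refine setIntegral_congr_fun measurableSet_Ioo fun x hx => ?_
    congr 1
    exact (Complex.imCLM.intervalIntegral_comp_comm (sub x hx)).symm

/-! ### Sobolev spaces on the interval `(0, L)` -/

/-- The complex Lebesgue space `L²(0, L)`. -/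
abbrev L2 (L : ℝ) : Type := Lp ℂ 2 (volume.restrict (Ioo 0 L))

/-- `g ∈ L²(0, L)` is the weak derivative of `f ∈ L²(0, L)`. -/
def IsWeakDeriv {L : ℝ} (f g : L2 L) : Prop := HasWeakDerivOn (Ioo 0 L) f g

theorem IsWeakDeriv.unique {L : ℝ} {f g₁ g₂ : L2 L} (h₁ : IsWeakDeriv f g₁)
    (h₂ : IsWeakDeriv f g₂) : g₁ = g₂ :=
  Lp.ext (HasWeakDerivOn.unique isOpen_Ioo h₁ h₂)

theorem IsWeakDeriv.add {L : ℝ} {f₁ g₁ f₂ g₂ : L2 L} (h₁ : IsWeakDeriv f₁ g₁)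
    (h₂ : IsWeakDeriv f₂ g₂) : IsWeakDeriv (f₁ + f₂) (g₁ + g₂) :=
  (HasWeakDerivOn.add h₁ h₂).congr (Lp.coeFn_add f₁ f₂).symm (Lp.coeFn_add g₁ g₂).symm

theorem IsWeakDeriv.smul {L : ℝ} {f g : L2 L} (a : ℂ) (h : IsWeakDeriv f g) :
    IsWeakDeriv (a • f) (a • g) :=
  (HasWeakDerivOn.smul a h).congr (Lp.coeFn_smul a f).symm (Lp.coeFn_smul a g).symm

theorem IsWeakDeriv.zero {L : ℝ} : IsWeakDeriv (0 : L2 L) 0 := by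
  have h := Lp.coeFn_zero ℂ 2 (volume.restrict (Ioo 0 L))
  exact HasWeakDerivOn.zero.congr h.symm h.symm

/-- The Sobolev space `H¹(0, L)`. -/
def H1 (L : ℝ) : Submodule ℂ (L2 L) where
  carrier := {f | ∃ g, IsWeakDeriv f g}
  add_mem' := fun ⟨g₁, h₁⟩ ⟨g₂, h₂⟩ => ⟨g₁ + g₂, h₁.add h₂⟩
  zero_mem' := ⟨0, IsWeakDeriv.zero⟩
  smul_mem' := fun a _ ⟨g, h⟩ => ⟨a • g, h.smul a⟩

open Classical in
/-- The weak derivative `f_x` of `f ∈ H¹(0, L)` (and `0` if `f ∉ H¹(0, L)`). -/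
def weakDeriv {L : ℝ} (f : L2 L) : L2 L := if h : ∃ g, IsWeakDeriv f g then h.choose else 0

theorem isWeakDeriv_weakDeriv {L : ℝ} {f : L2 L} (hf : f ∈ H1 L) : IsWeakDeriv f (weakDeriv f) := by
  have h : ∃ g, IsWeakDeriv f g := hf
  rw [weakDeriv, dif_pos h]
  exact h.choose_spec

theorem IsWeakDeriv.weakDeriv_eq {L : ℝ} {f g : L2 L} (h : IsWeakDeriv f g) : weakDeriv f = g :=
  (isWeakDeriv_weakDeriv (show f ∈ H1 L from ⟨g, h⟩)).unique h

theorem weakDeriv_add {L : ℝ} {f g : L2 L} (hf : f ∈ H1 L) (hg : g ∈ H1 L) :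
    weakDeriv (f + g) = weakDeriv f + weakDeriv g :=
  ((isWeakDeriv_weakDeriv hf).add (isWeakDeriv_weakDeriv hg)).weakDeriv_eq

theorem weakDeriv_smul {L : ℝ} (a : ℂ) {f : L2 L} (hf : f ∈ H1 L) :
    weakDeriv (a • f) = a • weakDeriv f :=
  ((isWeakDeriv_weakDeriv hf).smul a).weakDeriv_eq

/-- `f(x₀) = a`, where `f` is identified with its representative that is continuous on `[0, L]`. -/
def HasTrace {L : ℝ} (f : L2 L) (x₀ : ℝ) (a : ℂ) : Prop :=
  ∃ f' : ℝ → ℂ, ContinuousOn f' (Icc 0 L) ∧ f =ᵐ[volume.restrict (Ioo 0 L)] f' ∧ f' x₀ = a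

theorem HasTrace.add {L x₀ : ℝ} {f g : L2 L} {a b : ℂ} (hf : HasTrace f x₀ a)
    (hg : HasTrace g x₀ b) : HasTrace (f + g) x₀ (a + b) := by
  obtain ⟨f', hc, he, h0⟩ := hf
  obtain ⟨g', hc', he', h0'⟩ := hg
  exact ⟨f' + g', hc.add hc', (Lp.coeFn_add f g).trans (he.add he'), by simp [h0, h0']⟩

theorem HasTrace.smul {L x₀ : ℝ} {f : L2 L} {b : ℂ} (a : ℂ) (hf : HasTrace f x₀ b) :
    HasTrace (a • f) x₀ (a * b) := by
  obtain ⟨f', hc, he, h0⟩ := hf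
  exact ⟨a • f', hc.const_smul a, (Lp.coeFn_smul a f).trans (he.const_smul a), by simp [h0]⟩

theorem HasTrace.zero {L x₀ : ℝ} : HasTrace (0 : L2 L) x₀ 0 :=
  ⟨0, continuousOn_const, Lp.coeFn_zero ℂ 2 _, rfl⟩

/-- `H¹_L(0, L) = {u ∈ H¹(0, L) : u(0) = 0}` as a subspace of `L²(0, L)`. -/
def H1LSub (L : ℝ) : Submodule ℂ (L2 L) where
  carrier := {f | f ∈ H1 L ∧ HasTrace f 0 0}
  add_mem' := fun ⟨h₁, t₁⟩ ⟨h₂, t₂⟩ => ⟨add_mem h₁ h₂, by simpa using t₁.add t₂⟩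
  zero_mem' := ⟨zero_mem _, HasTrace.zero⟩
  smul_mem' := fun a _ ⟨h, t⟩ => ⟨(H1 L).smul_mem a h, by simpa using t.smul a⟩

/-- `H¹₀(0, L) = {u ∈ H¹(0, L) : u(0) = u(L) = 0}` as a subspace of `L²(0, L)`. -/
def H10Sub (L : ℝ) : Submodule ℂ (L2 L) where
  carrier := {f | f ∈ H1 L ∧ HasTrace f 0 0 ∧ HasTrace f L 0}
  add_mem' := fun ⟨h₁, t₁, s₁⟩ ⟨h₂, t₂, s₂⟩ =>
    ⟨add_mem h₁ h₂, by simpa using t₁.add t₂, by simpa using s₁.add s₂⟩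
  zero_mem' := ⟨zero_mem _, HasTrace.zero, HasTrace.zero⟩
  smul_mem' := fun a _ ⟨h, t, s⟩ =>
    ⟨(H1 L).smul_mem a h, by simpa using t.smul a, by simpa using s.smul a⟩

theorem H10Sub_le (L : ℝ) : H10Sub L ≤ H1LSub L := fun _ h => ⟨h.1, h.2.1⟩

theorem L2.integrableOn {L : ℝ} (g : L2 L) : IntegrableOn g (Ioo 0 L) :=
  (Lp.memLp g).integrable (by norm_num)

theorem continuousOn_primitive_L2 {L : ℝ} (hL : 0 ≤ L) (g : L2 L) :
    ContinuousOn (fun x => ∫ t in (0 : ℝ)..x, g t) (Icc 0 L) := by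
  have := intervalIntegral.continuousOn_primitive_interval'
    ((intervalIntegrable_iff_integrableOn_Ioo_of_le hL).2 (L2.integrableOn g)) left_mem_uIcc
  rwa [uIcc_of_le hL] at this

theorem ae_Icc_of_ae_Ioo {L : ℝ} {f g : ℝ → ℂ} (h : f =ᵐ[volume.restrict (Ioo 0 L)] g) :
    f =ᵐ[volume.restrict (Icc 0 L)] g := by
  rwa [Measure.restrict_congr_set (Ioo_ae_eq_Icc (μ := volume) (a := (0 : ℝ)) (b := L))] at h

/-- An element of `H¹_L(0, L)` is the primitive of its weak derivative. -/
theorem ae_eq_primitive {L : ℝ} (hL : 0 < L) {u g : L2 L} (hu : u ∈ H1LSub L)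
    (h : IsWeakDeriv u g) :
    u =ᵐ[volume.restrict (Ioo 0 L)] fun x => ∫ t in (0 : ℝ)..x, g t := by
  have hp := hasWeakDerivOn_primitive hL.le (L2.integrableOn g)
  have hd : HasWeakDerivOn (Ioo 0 L) (fun x => u x - ∫ t in (0 : ℝ)..x, g t) 0 := by
    have := HasWeakDerivOn.add h (HasWeakDerivOn.smul (-1 : ℂ) hp)
    refine this.congr (Eventually.of_forall fun x => ?_) (Eventually.of_forall fun x => ?_)
    · simp [sub_eq_add_neg]
    · simp
  obtain ⟨k, hk⟩ := ae_const_of_hasWeakDerivOn_zero hL hd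
  obtain ⟨u', hc, he, h0⟩ := hu.2
  have e1 : u' =ᵐ[volume.restrict (Ioo 0 L)] fun x => (∫ t in (0 : ℝ)..x, g t) + k := by
    filter_upwards [he, hk] with x hx hx'
    rw [← hx, ← hx']; ring
  have e2 := Measure.eqOn_Icc_of_ae_eq volume hL.ne (ae_Icc_of_ae_Ioo e1) hc
    ((continuousOn_primitive_L2 hL.le g).add continuousOn_const) (left_mem_Icc.2 hL.le)
  have hk0 : k = 0 := by simpa [h0] using e2.symm
  filter_upwards [hk] with x hx
  rw [hk0] at hx
  exact sub_eq_zero.1 hx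

theorem L2.eq_of_nonpos {L : ℝ} (hL : L ≤ 0) (u v : L2 L) : u = v := by
  apply Lp.ext
  filter_upwards [ae_restrict_mem measurableSet_Ioo] with x hx
  exact absurd (hx.1.trans hx.2) (not_lt.2 hL)

theorem eq_zero_of_weakDeriv_eq_zero {L : ℝ} {u : L2 L} (hu : u ∈ H1LSub L)
    (h : weakDeriv u = 0) : u = 0 := by
  rcases le_or_gt L 0 with hL | hL
  · exact L2.eq_of_nonpos hL _ _
  · have h1 := ae_eq_primitive hL hu (h ▸ isWeakDeriv_weakDeriv hu.1)
    have h0 := Lp.coeFn_zero ℂ 2 (volume.restrict (Ioo 0 L))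
    apply Lp.ext
    filter_upwards [h1, h0, ae_restrict_mem measurableSet_Ioo] with x hx hx0 hxm
    rw [hx, hx0, Pi.zero_apply]
    apply intervalIntegral.integral_zero_ae
    have h0' := (ae_restrict_iff' measurableSet_Ioo).1 h0
    filter_upwards [h0', (measure_singleton x : volume {x} = 0) |> compl_mem_ae_iff.2]
      with t ht htx htm
    rw [uIoc_of_le hxm.1.le] at htm
    exact ht ⟨htm.1, lt_of_le_of_lt htm.2 hxm.2⟩

/-- The primitive vanishing at `0`, as an element of `L²(0, L)`. -/
theorem exists_primitive {L : ℝ} (hL : 0 < L) (g : L2 L) :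
    ∃ u ∈ H1LSub L, weakDeriv u = g ∧ HasTrace u L (∫ t in (0 : ℝ)..L, g t) := by
  have hc := continuousOn_primitive_L2 hL.le g
  have hm : MemLp (fun x => ∫ t in (0 : ℝ)..x, g t) 2 (volume.restrict (Ioo 0 L)) := by
    obtain ⟨C, hC⟩ := isCompact_Icc.exists_bound_of_continuousOn hc
    refine MemLp.of_bound ((hc.mono Ioo_subset_Icc_self).aestronglyMeasurable measurableSet_Ioo) C ?_
    filter_upwards [ae_restrict_mem measurableSet_Ioo] with x hx
    exact hC x (Ioo_subset_Icc_self hx)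
  have hw : IsWeakDeriv (hm.toLp _) g :=
    (hasWeakDerivOn_primitive hL.le (L2.integrableOn g)).congr hm.coeFn_toLp.symm
      (EventuallyEq.refl _ _)
  exact ⟨hm.toLp _, ⟨⟨g, hw⟩, _, hc, hm.coeFn_toLp, by simp⟩, hw.weakDeriv_eq,
    _, hc, hm.coeFn_toLp, rfl⟩

/-- On a subspace of `H¹_L(0, L)`, the inner product `⟨u, v⟩ = ∫₀ᴸ u_x conj(v_x) dx`, written
with Mathlib's convention (conjugate linear in the first argument). -/
@[reducible] def gradCore {L : ℝ} (S : Submodule ℂ (L2 L)) (hS : S ≤ H1LSub L) :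
    InnerProductSpace.Core ℂ S where
  inner u v := inner ℂ (weakDeriv (u : L2 L)) (weakDeriv (v : L2 L))
  conj_inner_symm u v := inner_conj_symm _ _
  re_inner_nonneg u := inner_self_nonneg
  add_left u v w := by
    simp only [Submodule.coe_add]
    rw [weakDeriv_add (hS u.2).1 (hS v.2).1, inner_add_left]
  smul_left u v a := by
    simp only [Submodule.coe_smul]
    rw [weakDeriv_smul a (hS u.2).1, inner_smul_left]
  definite u h := Subtype.ext (eq_zero_of_weakDeriv_eq_zero (hS u.2) (inner_self_eq_zero.1 h))

/-- The space `H¹_L(0, L)` with the inner product of the gradients. -/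
def H1L (L : ℝ) : Type := H1LSub L

instance (L : ℝ) : NormedAddCommGroup (H1L L) :=
  @InnerProductSpace.Core.toNormedAddCommGroup ℂ (H1LSub L) _ _ _ (gradCore _ le_rfl)

instance (L : ℝ) : InnerProductSpace ℂ (H1L L) :=
  @InnerProductSpace.ofCore ℂ (H1LSub L) _ _ _ (gradCore _ le_rfl).toCore

/-- The space `H¹₀(0, L)` with the inner product of the gradients. -/
def H10 (L : ℝ) : Type := H10Sub L

instance (L : ℝ) : NormedAddCommGroup (H10 L) :=
  @InnerProductSpace.Core.toNormedAddCommGroup ℂ (H10Sub L) _ _ _ (gradCore _ (H10Sub_le L))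

instance (L : ℝ) : InnerProductSpace ℂ (H10 L) :=
  @InnerProductSpace.ofCore ℂ (H10Sub L) _ _ _ (gradCore _ (H10Sub_le L)).toCore

/-- A function in `H¹_L(0, L)` as an element of the space `H¹_L(0, L)`. -/
def H1L.mk {L : ℝ} (f : L2 L) (hf : f ∈ H1LSub L) : H1L L := ⟨f, hf⟩

/-- A function in `H¹₀(0, L)` as an element of the space `H¹₀(0, L)`. -/
def H10.mk {L : ℝ} (f : L2 L) (hf : f ∈ H10Sub L) : H10 L := ⟨f, hf⟩

theorem H1L.mk_add {L : ℝ} {f g : L2 L} (hf : f ∈ H1LSub L) (hg : g ∈ H1LSub L) :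
    H1L.mk (f + g) (add_mem hf hg) = H1L.mk f hf + H1L.mk g hg := rfl

theorem H1L.mk_smul {L : ℝ} (a : ℂ) {f : L2 L} (hf : f ∈ H1LSub L) :
    H1L.mk (a • f) (Submodule.smul_mem _ a hf) = a • H1L.mk f hf := rfl

theorem H10.mk_add {L : ℝ} {f g : L2 L} (hf : f ∈ H10Sub L) (hg : g ∈ H10Sub L) :
    H10.mk (f + g) (add_mem hf hg) = H10.mk f hf + H10.mk g hg := rfl

theorem H10.mk_smul {L : ℝ} (a : ℂ) {f : L2 L} (hf : f ∈ H10Sub L) :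
    H10.mk (a • f) (Submodule.smul_mem _ a hf) = a • H10.mk f hf := rfl

/-- The underlying function of an element of `H¹_L(0, L)`. -/
def H1L.fn {L : ℝ} : H1L L →ₗ[ℂ] L2 L := (H1LSub L).subtype

/-- The underlying function of an element of `H¹₀(0, L)`. -/
def H10.fn {L : ℝ} : H10 L →ₗ[ℂ] L2 L := (H10Sub L).subtype

/-- The derivative `u ↦ u_x` on `H¹_L(0, L)`. -/
def H1L.dx {L : ℝ} : H1L L →ₗᵢ[ℂ] L2 L where
  toFun u := weakDeriv u.fn
  map_add' u v := by rw [map_add]; exact weakDeriv_add u.2.1 v.2.1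
  map_smul' a u := by rw [map_smul]; exact weakDeriv_smul a u.2.1
  norm_map' u := by
    change ‖weakDeriv u.fn‖ = ‖u‖
    rw [← sq_eq_sq₀ (norm_nonneg _) (norm_nonneg _), InnerProductSpace.norm_sq_eq_re_inner (𝕜 := ℂ),
      InnerProductSpace.norm_sq_eq_re_inner (𝕜 := ℂ)]
    rfl

/-- The derivative `u ↦ u_x` on `H¹₀(0, L)`. -/
def H10.dx {L : ℝ} : H10 L →ₗᵢ[ℂ] L2 L where
  toFun u := weakDeriv u.fn
  map_add' u v := by rw [map_add]; exact weakDeriv_add u.2.1 v.2.1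
  map_smul' a u := by rw [map_smul]; exact weakDeriv_smul a u.2.1
  norm_map' u := by
    change ‖weakDeriv u.fn‖ = ‖u‖
    rw [← sq_eq_sq₀ (norm_nonneg _) (norm_nonneg _), InnerProductSpace.norm_sq_eq_re_inner (𝕜 := ℂ),
      InnerProductSpace.norm_sq_eq_re_inner (𝕜 := ℂ)]
    rfl

instance (L : ℝ) : CompleteSpace (H1L L) := by
  rw [completeSpace_iff_isComplete_range H1L.dx.isometry.isUniformInducing]
  rcases le_or_gt L 0 with hL | hL
  · have : range (H1L.dx (L := L)) = univ :=
      eq_univ_of_forall fun g => ⟨0, L2.eq_of_nonpos hL _ _⟩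
    rw [this]; exact isClosed_univ.isComplete
  · have : range (H1L.dx (L := L)) = univ := eq_univ_of_forall fun g => by
      obtain ⟨u, hu, hg, -⟩ := exists_primitive hL g
      exact ⟨⟨u, hu⟩, hg⟩
    rw [this]; exact isClosed_univ.isComplete

instance (L : ℝ) : CompleteSpace (H10 L) := by
  rw [completeSpace_iff_isComplete_range H10.dx.isometry.isUniformInducing]
  rcases le_or_gt L 0 with hL | hL
  · have : range (H10.dx (L := L)) = univ :=
      eq_univ_of_forall fun g => ⟨0, L2.eq_of_nonpos hL _ _⟩
    rw [this]; exact isClosed_univ.isComplete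
  · have hconv : ∀ g : L2 L, ∫ t in (0 : ℝ)..L, g t = ∫ t in Ioo 0 L, g t := fun g => by
      rw [intervalIntegral.integral_of_le hL.le, integral_Ioc_eq_integral_Ioo]
    have : range (H10.dx (L := L)) = {g : L2 L | ∫ t in Ioo 0 L, g t = 0} := by
      ext g
      constructor
      · rintro ⟨u, rfl⟩
        obtain ⟨u', hc, he, h0⟩ := u.2.2.2
        have hw := isWeakDeriv_weakDeriv (show u.fn ∈ H1 L from u.2.1)
        have e1 := ae_eq_primitive hL (H10Sub_le L u.2) hw
        have e2 := Measure.eqOn_Icc_of_ae_eq volume hL.ne (ae_Icc_of_ae_Ioo (he.symm.trans e1)) hc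
          (continuousOn_primitive_L2 hL.le _) (right_mem_Icc.2 hL.le)
        simp only [h0, hconv] at e2
        exact e2.symm
      · intro hg
        obtain ⟨u, hu, hug, ht⟩ := exists_primitive hL g
        have hg' : ∫ t in Ioo 0 L, g t = 0 := hg
        rw [hconv, hg'] at ht
        exact ⟨⟨u, hu.1, hu.2, ht⟩, hug⟩
    rw [this]
    refine IsClosed.isComplete (isClosed_eq ?_ continuous_const)
    have key : ∀ g : L2 L, ∫ t in Ioo 0 L, g t =
        inner ℂ (Lp.const 2 (volume.restrict (Ioo (0 : ℝ) L)) (1 : ℂ)) g := fun g => by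
      rw [L2.inner_def]
      refine integral_congr_ae ?_
      filter_upwards [Lp.coeFn_const (p := 2) (μ := volume.restrict (Ioo (0 : ℝ) L)) (1 : ℂ)]
        with x hx
      rw [hx]
      simp
    simp only [key]
    fun_prop

/-! ### The parameters, the memory kernel and the energy space -/

/-- The physical parameters of the beam. -/
structure Params where
  /-- length of the beam -/
  L : ℝ
  /-- mass density -/
  ρ : ℝ
  /-- magnetic permeability -/
  μ : ℝ
  /-- the elastic stiffness is `α = α₁ + γ² β` -/
  α₁ : ℝ
  /-- water resistance coefficient of the beam -/
  β : ℝ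
  /-- piezoelectric coefficient -/
  γ : ℝ
  /-- thermal coupling coefficient -/
  δ : ℝ
  /-- heat conductivity -/
  c : ℝ
  /-- `m = 0`: Fourier law, `0 < m < 1`: Coleman--Gurtin law, `m = 1`: Gurtin--Pipkin law -/
  m : ℝ
  L_pos : 0 < L
  ρ_pos : 0 < ρ
  μ_pos : 0 < μ
  α₁_pos : 0 < α₁
  β_pos : 0 < β
  c_pos : 0 < c
  m_mem : m ∈ Icc (0 : ℝ) 1

/-- The elastic stiffness `α = α₁ + γ² β`. -/
def Params.α (P : Params) : ℝ := P.α₁ + P.γ ^ 2 * P.β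

/-- The hypothesis (H) on the memory kernel `σ : (0, ∞) → [0, ∞)`; only the values of `σ` on
`(0, ∞)` matter. -/
structure MemoryKernel (σ : ℝ → ℝ) : Prop where
  nonneg : ∀ s, 0 < s → 0 ≤ σ s
  integrable : IntegrableOn σ (Ioi 0)
  contDiffOn : ContDiffOn ℝ 1 σ (Ioi 0)
  integral_pos : 0 < ∫ s in Ioi 0, σ s
  limit_zero : ∃ σ₀ : ℝ, Tendsto σ (𝓝[>] 0) (𝓝 σ₀)
  dafermos : ∃ d : ℝ, 0 < d ∧ ∀ s, 0 < s → deriv σ s ≤ -d * σ s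

/-- The measure `c m σ(s) ds` on `(0, ∞)`. -/
def memMeasure (P : Params) (σ : ℝ → ℝ) : Measure ℝ :=
  (volume.restrict (Ioi 0)).withDensity fun s => ENNReal.ofReal (P.c * P.m * σ s)

/-- The memory space `W = L²_σ(ℝ⁺; H¹₀(0, L))`. The factor `c m` of its inner product
`(η₁, η₂)_W = c m ∫ σ(s) ⟨η₁(s), η₂(s)⟩ ds` is put into the measure. For `m > 0` this does not
change the space; for `m = 0` the inner product of `W` vanishes, and `W` becomes `{0}`. -/
abbrev W (P : Params) (σ : ℝ → ℝ) : Type := Lp (H10 P.L) 2 (memMeasure P σ)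

/-- The set of all `s > 0` at which the weight `c m σ(s)` is positive. -/
def memSupport (P : Params) (σ : ℝ → ℝ) : Set ℝ := {s | 0 < s ∧ 0 < P.c * P.m * σ s}

/-- `ξ = η_s` in `W`, as a weak derivative of `H¹₀(0, L)`-valued functions. -/
def IsMemDeriv {P : Params} {σ : ℝ → ℝ} (η ξ : W P σ) : Prop :=
  HasWeakDerivOn (memSupport P σ) η ξ

/-- `η(·, 0) = 0`: some representative of `η` tends to `0` in `H¹₀(0, L)` as `s → 0+`. -/
def VanishesAtZero {P : Params} {σ : ℝ → ℝ} (η : W P σ) : Prop :=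
  ∃ η' : ℝ → H10 P.L, η =ᵐ[memMeasure P σ] η' ∧ Tendsto η' (𝓝[>] 0) (𝓝 0)

open Classical in
/-- The weak derivative `η_s` (and `0` if it does not exist in `W`). -/
def memDeriv {P : Params} {σ : ℝ → ℝ} (η : W P σ) : W P σ :=
  if h : ∃ ξ, IsMemDeriv η ξ then h.choose else 0

section Memory

variable {P : Params} {σ : ℝ → ℝ}

theorem MemoryKernel.aemeasurable (hσ : MemoryKernel σ) (P : Params) :
    AEMeasurable (fun s => ENNReal.ofReal (P.c * P.m * σ s)) (volume.restrict (Ioi 0)) :=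
  ((hσ.contDiffOn.continuousOn.aemeasurable measurableSet_Ioi).const_mul _).ennreal_ofReal

theorem memMeasure_finite (P : Params) (hσ : MemoryKernel σ) :
    IsFiniteMeasure (memMeasure P σ) :=
  isFiniteMeasure_withDensity_ofReal (hσ.integrable.const_mul (P.c * P.m)).2

theorem isOpen_memSupport (P : Params) (hσ : MemoryKernel σ) : IsOpen (memSupport P σ) :=
  (continuousOn_const.mul hσ.contDiffOn.continuousOn).isOpen_inter_preimage isOpen_Ioi isOpen_Ioi

theorem ae_memMeasure_iff (P : Params) (hσ : MemoryKernel σ) {p : ℝ → Prop} :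
    (∀ᵐ s ∂memMeasure P σ, p s) ↔ ∀ᵐ s ∂volume.restrict (memSupport P σ), p s := by
  rw [memMeasure, ae_withDensity_iff' (hσ.aemeasurable P), ae_restrict_iff' measurableSet_Ioi,
    ae_restrict_iff' (isOpen_memSupport P hσ).measurableSet]
  refine eventually_congr (Eventually.of_forall fun s => ?_)
  simp only [memSupport, mem_ofPred_eq, mem_Ioi, ne_eq, ENNReal.ofReal_eq_zero, not_le, and_imp]

theorem IsMemDeriv.unique (hσ : MemoryKernel σ) {η ξ₁ ξ₂ : W P σ} (h₁ : IsMemDeriv η ξ₁)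
    (h₂ : IsMemDeriv η ξ₂) : ξ₁ = ξ₂ :=
  Lp.ext ((ae_memMeasure_iff P hσ).2 (HasWeakDerivOn.unique (isOpen_memSupport P hσ) h₁ h₂))

theorem IsMemDeriv.add (hσ : MemoryKernel σ) {η₁ η₂ ξ₁ ξ₂ : W P σ} (h₁ : IsMemDeriv η₁ ξ₁)
    (h₂ : IsMemDeriv η₂ ξ₂) : IsMemDeriv (η₁ + η₂) (ξ₁ + ξ₂) :=
  (HasWeakDerivOn.add h₁ h₂).congr ((ae_memMeasure_iff P hσ).1 (Lp.coeFn_add η₁ η₂).symm)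
    ((ae_memMeasure_iff P hσ).1 (Lp.coeFn_add ξ₁ ξ₂).symm)

theorem IsMemDeriv.smul (hσ : MemoryKernel σ) (a : ℂ) {η ξ : W P σ} (h : IsMemDeriv η ξ) :
    IsMemDeriv (a • η) (a • ξ) :=
  (HasWeakDerivOn.smul a h).congr ((ae_memMeasure_iff P hσ).1 (Lp.coeFn_smul a η).symm)
    ((ae_memMeasure_iff P hσ).1 (Lp.coeFn_smul a ξ).symm)

theorem IsMemDeriv.zero (hσ : MemoryKernel σ) : IsMemDeriv (0 : W P σ) 0 := by
  have h := (ae_memMeasure_iff P hσ).1 (Lp.coeFn_zero (H10 P.L) 2 (memMeasure P σ)).symm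
  exact HasWeakDerivOn.zero.congr h h

theorem IsMemDeriv.memDeriv_eq (hσ : MemoryKernel σ) {η ξ : W P σ} (h : IsMemDeriv η ξ) :
    memDeriv η = ξ := by
  have h' : ∃ ξ, IsMemDeriv η ξ := ⟨ξ, h⟩
  rw [memDeriv, dif_pos h']
  exact h'.choose_spec.unique hσ h

theorem VanishesAtZero.add {η₁ η₂ : W P σ} (h₁ : VanishesAtZero η₁) (h₂ : VanishesAtZero η₂) :
    VanishesAtZero (η₁ + η₂) := by
  obtain ⟨f, hf, hf0⟩ := h₁
  obtain ⟨g, hg, hg0⟩ := h₂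
  exact ⟨f + g, (Lp.coeFn_add _ _).trans (hf.add hg), by
    have := hf0.add hg0
    rwa [add_zero] at this⟩

theorem VanishesAtZero.smul (a : ℂ) {η : W P σ} (h : VanishesAtZero η) :
    VanishesAtZero (a • η) := by
  obtain ⟨f, hf, hf0⟩ := h
  exact ⟨a • f, (Lp.coeFn_smul _ _).trans (hf.const_smul a), by
    have := hf0.const_smul a
    rwa [smul_zero] at this⟩

theorem VanishesAtZero.zero : VanishesAtZero (0 : W P σ) :=
  ⟨0, Lp.coeFn_zero _ _ _, tendsto_const_nhds⟩

/-- The temperature `w ∈ H¹₀(0, L)`, as an element of `W` that does not depend on `s`. -/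
def constMem (P : Params) {σ : ℝ → ℝ} (hσ : MemoryKernel σ) : H10 P.L →ₗ[ℂ] W P σ :=
  haveI := memMeasure_finite P hσ
  Lp.constₗ 2 (memMeasure P σ) ℂ

/-- `Λ^m = (1 - m) w + m ∫₀^∞ σ(s) η(s) ds`, where the integral is a Bochner integral in
`H¹₀(0, L)`. -/
def potential (w : L2 P.L) (η : W P σ) : L2 P.L :=
  (1 - P.m) • w + P.m • H10.fn (∫ s in Ioi (0 : ℝ), σ s • η s)

theorem integrableOn_smul_mem (hσ : MemoryKernel σ) (hm : 0 < P.m) (η : W P σ) :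
    IntegrableOn (fun s => σ s • η s) (Ioi 0) := by
  have := memMeasure_finite P hσ
  have h0 : Integrable η (memMeasure P σ) := (Lp.memLp η).integrable (by norm_num)
  have h1 := (integrable_withDensity_iff_integrable_smul₀' (hσ.aemeasurable P)
    (Eventually.of_forall fun _ => ENNReal.ofReal_lt_top)).1 h0
  have hcm : 0 < P.c * P.m := mul_pos P.c_pos hm
  refine (h1.smul (P.c * P.m)⁻¹).congr ?_
  filter_upwards [ae_restrict_mem measurableSet_Ioi] with s hs
  simp only [Pi.smul_apply]
  rw [ENNReal.toReal_ofReal (mul_nonneg hcm.le (hσ.nonneg s hs)), smul_smul,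
    inv_mul_cancel_left₀ hcm.ne']

theorem ae_smul_congr (hσ : MemoryKernel σ) (hm : 0 < P.m) {f g : ℝ → H10 P.L}
    (h : f =ᵐ[memMeasure P σ] g) :
    (fun s => σ s • f s) =ᵐ[volume.restrict (Ioi 0)] fun s => σ s • g s := by
  have h' := (ae_memMeasure_iff P hσ).1 h
  rw [ae_restrict_iff' (isOpen_memSupport P hσ).measurableSet] at h'
  rw [EventuallyEq, ae_restrict_iff' measurableSet_Ioi]
  filter_upwards [h'] with s hs hs0
  rcases (hσ.nonneg s hs0).eq_or_lt with h0 | h0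
  · simp [← h0]
  · rw [hs ⟨hs0, mul_pos (mul_pos P.c_pos hm) h0⟩]

theorem potential_add (hσ : MemoryKernel σ) (w₁ w₂ : L2 P.L) (η₁ η₂ : W P σ) :
    potential (w₁ + w₂) (η₁ + η₂) = potential w₁ η₁ + potential w₂ η₂ := by
  rcases P.m_mem.1.eq_or_lt with hm | hm
  · simp [potential, ← hm]
  · have e : ∫ s in Ioi (0 : ℝ), σ s • (η₁ + η₂ : W P σ) s =
        (∫ s in Ioi (0 : ℝ), σ s • η₁ s) + ∫ s in Ioi (0 : ℝ), σ s • η₂ s := by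
      rw [integral_congr_ae (ae_smul_congr hσ hm (Lp.coeFn_add η₁ η₂)),
        ← integral_add (integrableOn_smul_mem hσ hm η₁) (integrableOn_smul_mem hσ hm η₂)]
      simp only [Pi.add_apply, smul_add]
    simp only [potential, e, map_add, smul_add]
    abel

theorem potential_smul (hσ : MemoryKernel σ) (a : ℂ) (w : L2 P.L) (η : W P σ) :
    potential (a • w) (a • η) = a • potential w η := by
  rcases P.m_mem.1.eq_or_lt with hm | hm
  · simp [potential, ← hm]
  · have e : ∫ s in Ioi (0 : ℝ), σ s • (a • η : W P σ) s =
        a • ∫ s in Ioi (0 : ℝ), σ s • η s := by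
      rw [integral_congr_ae (ae_smul_congr hσ hm (Lp.coeFn_smul a η)), ← integral_smul]
      simp only [Pi.smul_apply, smul_comm _ a]
    simp only [potential, e, map_smul, smul_add, smul_comm _ a]

theorem potential_zero (hσ : MemoryKernel σ) : potential (0 : L2 P.L) (0 : W P σ) = 0 := by
  simpa using potential_smul hσ 0 (0 : L2 P.L) (0 : W P σ)

end Memory

/-- The energy space `ℋ = (H¹_L × L²)² × L² × W` of the states `U = (u, v, y, z, w, η)`. -/
def EnergySpace (P : Params) (σ : ℝ → ℝ) : Type :=
  H1L P.L × L2 P.L × H1L P.L × L2 P.L × L2 P.L × W P σ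

namespace EnergySpace

variable {P : Params} {σ : ℝ → ℝ}

instance : AddCommGroup (EnergySpace P σ) :=
  inferInstanceAs (AddCommGroup (H1L P.L × L2 P.L × H1L P.L × L2 P.L × L2 P.L × W P σ))

instance : Module ℂ (EnergySpace P σ) :=
  inferInstanceAs (Module ℂ (H1L P.L × L2 P.L × H1L P.L × L2 P.L × L2 P.L × W P σ))

/-- The state with the given components. -/
def mk (u : H1L P.L) (v : L2 P.L) (y : H1L P.L) (z w : L2 P.L) (η : W P σ) : EnergySpace P σ :=
  (u, v, y, z, w, η)

/-- The component `u`. -/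
def u (U : EnergySpace P σ) : H1L P.L := U.1
/-- The component `v`. -/
def v (U : EnergySpace P σ) : L2 P.L := U.2.1
/-- The component `y`. -/
def y (U : EnergySpace P σ) : H1L P.L := U.2.2.1
/-- The component `z`. -/
def z (U : EnergySpace P σ) : L2 P.L := U.2.2.2.1
/-- The component `w`. -/
def w (U : EnergySpace P σ) : L2 P.L := U.2.2.2.2.1
/-- The component `η`. -/
def η (U : EnergySpace P σ) : W P σ := U.2.2.2.2.2

theorem ext' {U V : EnergySpace P σ} (h₁ : U.u = V.u) (h₂ : U.v = V.v) (h₃ : U.y = V.y)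
    (h₄ : U.z = V.z) (h₅ : U.w = V.w) (h₆ : U.η = V.η) : U = V :=
  Prod.ext h₁ (Prod.ext h₂ (Prod.ext h₃ (Prod.ext h₄ (Prod.ext h₅ h₆))))

section simps

variable (U V : EnergySpace P σ) (a : ℂ) (u' y' : H1L P.L) (v' z' w' : L2 P.L) (η' : W P σ)

@[simp] theorem u_mk : (mk u' v' y' z' w' η').u = u' := rfl
@[simp] theorem v_mk : (mk u' v' y' z' w' η').v = v' := rfl
@[simp] theorem y_mk : (mk u' v' y' z' w' η').y = y' := rfl
@[simp] theorem z_mk : (mk u' v' y' z' w' η').z = z' := rfl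
@[simp] theorem w_mk : (mk u' v' y' z' w' η').w = w' := rfl
@[simp] theorem η_mk : (mk u' v' y' z' w' η').η = η' := rfl

@[simp] theorem u_add : (U + V).u = U.u + V.u := rfl
@[simp] theorem v_add : (U + V).v = U.v + V.v := rfl
@[simp] theorem y_add : (U + V).y = U.y + V.y := rfl
@[simp] theorem z_add : (U + V).z = U.z + V.z := rfl
@[simp] theorem w_add : (U + V).w = U.w + V.w := rfl
@[simp] theorem η_add : (U + V).η = U.η + V.η := rfl
@[simp] theorem u_smul : (a • U).u = a • U.u := rfl
@[simp] theorem v_smul : (a • U).v = a • U.v := rfl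
@[simp] theorem y_smul : (a • U).y = a • U.y := rfl
@[simp] theorem z_smul : (a • U).z = a • U.z := rfl
@[simp] theorem w_smul : (a • U).w = a • U.w := rfl
@[simp] theorem η_smul : (a • U).η = a • U.η := rfl
@[simp] theorem u_zero : (0 : EnergySpace P σ).u = 0 := rfl
@[simp] theorem v_zero : (0 : EnergySpace P σ).v = 0 := rfl
@[simp] theorem y_zero : (0 : EnergySpace P σ).y = 0 := rfl
@[simp] theorem z_zero : (0 : EnergySpace P σ).z = 0 := rfl
@[simp] theorem w_zero : (0 : EnergySpace P σ).w = 0 := rfl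
@[simp] theorem η_zero : (0 : EnergySpace P σ).η = 0 := rfl

end simps

/-- The inner product of the energy space,
`∫₀ᴸ ρ v₁ v̄₂ + α₁ u₁ₓ ū₂ₓ + μ z₁ z̄₂ + β (γ u₁ₓ - y₁ₓ) conj(γ u₂ₓ - y₂ₓ) + w₁ w̄₂ dx + (η₁, η₂)_W`,
written with Mathlib's convention (conjugate linear in the first argument). -/
def innerE (U₁ U₂ : EnergySpace P σ) : ℂ :=
  P.ρ * inner ℂ U₁.v U₂.v + P.α₁ * inner ℂ U₁.u.dx U₂.u.dx + P.μ * inner ℂ U₁.z U₂.z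
    + P.β * inner ℂ ((P.γ : ℂ) • U₁.u.dx - U₁.y.dx) ((P.γ : ℂ) • U₂.u.dx - U₂.y.dx)
    + inner ℂ U₁.w U₂.w + inner ℂ U₁.η U₂.η

theorem re_innerE_self (U : EnergySpace P σ) :
    (innerE U U).re = P.ρ * ‖U.v‖ ^ 2 + P.α₁ * ‖U.u.dx‖ ^ 2 + P.μ * ‖U.z‖ ^ 2
      + P.β * ‖(P.γ : ℂ) • U.u.dx - U.y.dx‖ ^ 2 + ‖U.w‖ ^ 2 + ‖U.η‖ ^ 2 := by
  have h : ∀ {E : Type} [NormedAddCommGroup E] [InnerProductSpace ℂ E] (x : E),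
      (inner ℂ x x : ℂ) = ((‖x‖ ^ 2 : ℝ) : ℂ) := fun x => by
    rw [inner_self_eq_norm_sq_to_K]; norm_cast
  simp only [innerE, h, Complex.add_re, Complex.re_ofReal_mul, Complex.ofReal_re]

@[reducible] def core (P : Params) (σ : ℝ → ℝ) : InnerProductSpace.Core ℂ (EnergySpace P σ) where
  inner := innerE
  conj_inner_symm U V := by simp [innerE, inner_conj_symm]
  re_inner_nonneg U := by
    have := P.ρ_pos; have := P.α₁_pos; have := P.μ_pos; have := P.β_pos
    change 0 ≤ (innerE U U).re
    rw [re_innerE_self]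
    positivity
  add_left U V X := by
    simp only [innerE, u_add, v_add, y_add, z_add, w_add, η_add, map_add, smul_add,
      inner_add_left, inner_sub_left]
    ring
  smul_left U V a := by
    simp only [innerE, u_smul, v_smul, y_smul, z_smul, w_smul, η_smul, map_smul,
      smul_comm (P.γ : ℂ) a, ← smul_sub, inner_smul_left]
    ring
  definite U h := by
    have hρ := P.ρ_pos; have hα := P.α₁_pos; have hμ := P.μ_pos; have hβ := P.β_pos
    have h' : (innerE U U).re = 0 := by
      have h0 : innerE U U = 0 := h
      rw [h0]; rfl
    rw [re_innerE_self] at h'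
    have n1 : 0 ≤ P.ρ * ‖U.v‖ ^ 2 := by positivity
    have n2 : 0 ≤ P.α₁ * ‖U.u.dx‖ ^ 2 := by positivity
    have n3 : 0 ≤ P.μ * ‖U.z‖ ^ 2 := by positivity
    have n4 : 0 ≤ P.β * ‖(P.γ : ℂ) • U.u.dx - U.y.dx‖ ^ 2 := by positivity
    have n5 : 0 ≤ ‖U.w‖ ^ 2 := by positivity
    have n6 : 0 ≤ ‖U.η‖ ^ 2 := by positivity
    have m1 : P.ρ * ‖U.v‖ ^ 2 = 0 := by linarith
    have m2 : P.α₁ * ‖U.u.dx‖ ^ 2 = 0 := by linarith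
    have m3 : P.μ * ‖U.z‖ ^ 2 = 0 := by linarith
    have m4 : P.β * ‖(P.γ : ℂ) • U.u.dx - U.y.dx‖ ^ 2 = 0 := by linarith
    have m5 : ‖U.w‖ ^ 2 = 0 := by linarith
    have m6 : ‖U.η‖ ^ 2 = 0 := by linarith
    have hu : U.u.dx = 0 := norm_eq_zero.1 (by simpa only [mul_eq_zero, hα.ne', false_or,
      pow_eq_zero_iff, ne_eq, OfNat.ofNat_ne_zero, not_false_eq_true] using m2)
    have hy : U.y.dx = 0 := by
      rw [hu, smul_zero, zero_sub, norm_neg] at m4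
      exact norm_eq_zero.1 (by simpa only [mul_eq_zero, hβ.ne', false_or,
        pow_eq_zero_iff, ne_eq, OfNat.ofNat_ne_zero, not_false_eq_true] using m4)
    refine ext' ?_ ?_ ?_ ?_ ?_ ?_
    · exact H1L.dx.injective (by rw [hu]; exact (map_zero _).symm)
    · simpa [hρ.ne'] using m1
    · exact H1L.dx.injective (by rw [hy]; exact (map_zero _).symm)
    · simpa [hμ.ne'] using m3
    · simpa using m5
    · simpa using m6

instance : NormedAddCommGroup (EnergySpace P σ) := (core P σ).toNormedAddCommGroup

instance : InnerProductSpace ℂ (EnergySpace P σ) := InnerProductSpace.ofCore (core P σ).toCore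

end EnergySpace

/-! ### The operator `𝒜_m` -/

/-- Membership in the domain `D(𝒜_m)`. -/
structure InDomain {P : Params} {σ : ℝ → ℝ} (U : EnergySpace P σ) : Prop where
  /-- `v ∈ H¹_L` -/
  v_mem : U.v ∈ H1LSub P.L
  /-- `z ∈ H¹_L` -/
  z_mem : U.z ∈ H1LSub P.L
  /-- `u ∈ H²` -/
  ux_mem : U.u.dx ∈ H1 P.L
  /-- `y ∈ H²` -/
  yx_mem : U.y.dx ∈ H1 P.L
  /-- `w ∈ H¹₀` -/
  w_mem : U.w ∈ H10Sub P.L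
  /-- `Λ^m_x ∈ H¹` -/
  potential_mem : potential U.w U.η ∈ H1 P.L ∧ weakDeriv (potential U.w U.η) ∈ H1 P.L
  /-- `η_s ∈ W` -/
  ηs_mem : ∃ ξ, IsMemDeriv U.η ξ
  /-- `η(·, 0) = 0` -/
  η_zero : VanishesAtZero U.η
  /-- `u_x(L) = 0` -/
  ux_L : HasTrace U.u.dx P.L 0
  /-- `y_x(L) = 0` -/
  yx_L : HasTrace U.y.dx P.L 0

/-- The domain `D(𝒜_m)`. -/
def domainA (P : Params) {σ : ℝ → ℝ} (hσ : MemoryKernel σ) : Submodule ℂ (EnergySpace P σ) where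
  carrier := {U | InDomain U}
  add_mem' {U V} hU hV :=
    { v_mem := add_mem hU.v_mem hV.v_mem
      z_mem := add_mem hU.z_mem hV.z_mem
      ux_mem := by simpa using add_mem hU.ux_mem hV.ux_mem
      yx_mem := by simpa using add_mem hU.yx_mem hV.yx_mem
      w_mem := add_mem hU.w_mem hV.w_mem
      potential_mem := by
        simp only [EnergySpace.w_add, EnergySpace.η_add, potential_add hσ]
        rw [weakDeriv_add hU.potential_mem.1 hV.potential_mem.1]
        exact ⟨add_mem hU.potential_mem.1 hV.potential_mem.1,
          add_mem hU.potential_mem.2 hV.potential_mem.2⟩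
      ηs_mem := by
        obtain ⟨ξ, h⟩ := hU.ηs_mem
        obtain ⟨ξ', h'⟩ := hV.ηs_mem
        exact ⟨ξ + ξ', h.add hσ h'⟩
      η_zero := hU.η_zero.add hV.η_zero
      ux_L := by simpa using hU.ux_L.add hV.ux_L
      yx_L := by simpa using hU.yx_L.add hV.yx_L }
  zero_mem' :=
    { v_mem := zero_mem _
      z_mem := zero_mem _
      ux_mem := by simp
      yx_mem := by simp
      w_mem := zero_mem _
      potential_mem := by
        simp only [EnergySpace.w_zero, EnergySpace.η_zero, potential_zero hσ]
        rw [IsWeakDeriv.zero.weakDeriv_eq]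
        exact ⟨zero_mem _, zero_mem _⟩
      ηs_mem := ⟨0, IsMemDeriv.zero hσ⟩
      η_zero := VanishesAtZero.zero
      ux_L := by simpa using HasTrace.zero
      yx_L := by simpa using HasTrace.zero }
  smul_mem' a U hU :=
    { v_mem := Submodule.smul_mem _ a hU.v_mem
      z_mem := Submodule.smul_mem _ a hU.z_mem
      ux_mem := by simpa using Submodule.smul_mem _ a hU.ux_mem
      yx_mem := by simpa using Submodule.smul_mem _ a hU.yx_mem
      w_mem := Submodule.smul_mem _ a hU.w_mem
      potential_mem := by
        simp only [EnergySpace.w_smul, EnergySpace.η_smul, potential_smul hσ]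
        rw [weakDeriv_smul a hU.potential_mem.1]
        exact ⟨Submodule.smul_mem _ a hU.potential_mem.1,
          Submodule.smul_mem _ a hU.potential_mem.2⟩
      ηs_mem := by
        obtain ⟨ξ, h⟩ := hU.ηs_mem
        exact ⟨a • ξ, h.smul hσ a⟩
      η_zero := hU.η_zero.smul a
      ux_L := by simpa using hU.ux_L.smul a
      yx_L := by simpa using hU.yx_L.smul a }

/-- The value `𝒜_m U` for `U ∈ D(𝒜_m)`:
`(v, ρ⁻¹ (α u_xx - γ β y_xx - δ w_x), z, μ⁻¹ (β y_xx - γ β u_xx), c Λ^m_xx - δ v_x, -η_s + w)`. -/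
def applyA (P : Params) {σ : ℝ → ℝ} (hσ : MemoryKernel σ) (U : EnergySpace P σ)
    (hU : InDomain U) : EnergySpace P σ :=
  EnergySpace.mk
    (H1L.mk U.v hU.v_mem)
    (((1 / P.ρ : ℝ) : ℂ) • ((P.α : ℂ) • weakDeriv U.u.dx - ((P.γ * P.β : ℝ) : ℂ) • weakDeriv U.y.dx
      - (P.δ : ℂ) • weakDeriv U.w))
    (H1L.mk U.z hU.z_mem)
    (((1 / P.μ : ℝ) : ℂ) • ((P.β : ℂ) • weakDeriv U.y.dx
      - ((P.γ * P.β : ℝ) : ℂ) • weakDeriv U.u.dx))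
    ((P.c : ℂ) • weakDeriv (weakDeriv (potential U.w U.η)) - (P.δ : ℂ) • weakDeriv U.v)
    (-memDeriv U.η + constMem P hσ (H10.mk U.w hU.w_mem))

theorem applyA_add (P : Params) {σ : ℝ → ℝ} (hσ : MemoryKernel σ) {U V : EnergySpace P σ}
    (hU : InDomain U) (hV : InDomain V) (hUV : InDomain (U + V)) :
    applyA P hσ (U + V) hUV = applyA P hσ U hU + applyA P hσ V hV := by
  obtain ⟨ξ, h⟩ := hU.ηs_mem
  obtain ⟨ξ', h'⟩ := hV.ηs_mem
  refine EnergySpace.ext' rfl ?_ rfl ?_ ?_ ?_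
  · simp only [applyA, EnergySpace.v_mk, EnergySpace.v_add, EnergySpace.u_add, EnergySpace.y_add,
      EnergySpace.w_add, map_add, weakDeriv_add hU.ux_mem hV.ux_mem,
      weakDeriv_add hU.yx_mem hV.yx_mem, weakDeriv_add hU.w_mem.1 hV.w_mem.1]
    module
  · simp only [applyA, EnergySpace.z_mk, EnergySpace.z_add, EnergySpace.u_add, EnergySpace.y_add,
      map_add, weakDeriv_add hU.ux_mem hV.ux_mem, weakDeriv_add hU.yx_mem hV.yx_mem]
    module
  · simp only [applyA, EnergySpace.w_mk, EnergySpace.w_add, EnergySpace.η_add, EnergySpace.v_add,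
      potential_add hσ, weakDeriv_add hU.potential_mem.1 hV.potential_mem.1,
      weakDeriv_add hU.potential_mem.2 hV.potential_mem.2, weakDeriv_add hU.v_mem.1 hV.v_mem.1]
    module
  · have e : constMem P hσ (H10.mk (U + V).w hUV.w_mem) =
        constMem P hσ (H10.mk U.w hU.w_mem) + constMem P hσ (H10.mk V.w hV.w_mem) := by
      rw [← map_add]; rfl
    simp only [applyA, EnergySpace.η_mk, EnergySpace.η_add, e, (h.add hσ h').memDeriv_eq hσ,
      h.memDeriv_eq hσ, h'.memDeriv_eq hσ]
    abel

theorem applyA_smul (P : Params) {σ : ℝ → ℝ} (hσ : MemoryKernel σ) (a : ℂ) {U : EnergySpace P σ}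
    (hU : InDomain U) (haU : InDomain (a • U)) :
    applyA P hσ (a • U) haU = a • applyA P hσ U hU := by
  obtain ⟨ξ, h⟩ := hU.ηs_mem
  refine EnergySpace.ext' (H1L.mk_smul a hU.v_mem) ?_ (H1L.mk_smul a hU.z_mem) ?_ ?_ ?_
  · simp only [applyA, EnergySpace.v_mk, EnergySpace.v_smul, EnergySpace.u_smul,
      EnergySpace.y_smul, EnergySpace.w_smul, map_smul, weakDeriv_smul a hU.ux_mem,
      weakDeriv_smul a hU.yx_mem, weakDeriv_smul a hU.w_mem.1]
    module
  · simp only [applyA, EnergySpace.z_mk, EnergySpace.z_smul, EnergySpace.u_smul,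
      EnergySpace.y_smul, map_smul, weakDeriv_smul a hU.ux_mem, weakDeriv_smul a hU.yx_mem]
    module
  · simp only [applyA, EnergySpace.w_mk, EnergySpace.w_smul, EnergySpace.η_smul,
      EnergySpace.v_smul, potential_smul hσ, weakDeriv_smul a hU.potential_mem.1,
      weakDeriv_smul a hU.potential_mem.2, weakDeriv_smul a hU.v_mem.1]
    module
  · have e : constMem P hσ (H10.mk (a • U).w haU.w_mem) =
        a • constMem P hσ (H10.mk U.w hU.w_mem) := by
      rw [← map_smul]; exact congrArg _ (H10.mk_smul a hU.w_mem)
    simp only [applyA, EnergySpace.η_mk, EnergySpace.η_smul, e, (h.smul hσ a).memDeriv_eq hσ,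
      h.memDeriv_eq hσ]
    module

/-- The unbounded operator `𝒜_m : D(𝒜_m) ⊆ ℋ → ℋ`. -/
def operatorA (P : Params) {σ : ℝ → ℝ} (hσ : MemoryKernel σ) :
    EnergySpace P σ →ₗ.[ℂ] EnergySpace P σ where
  domain := domainA P hσ
  toFun :=
    { toFun := fun U => applyA P hσ U U.2
      map_add' := fun U V => applyA_add P hσ U.2 V.2 (U + V).2
      map_smul' := fun a U => applyA_smul P hσ a U.2 (a • U).2 }

/-! ### Dissipative operators, semigroups and solutions of `U' = A U` -/

section Abstract

variable {H : Type*} [NormedAddCommGroup H] [InnerProductSpace ℂ H]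

/-- `A` is dissipative: `Re ⟨A U, U⟩ ≤ 0` on `D(A)`. -/
def IsDissipative (A : H →ₗ.[ℂ] H) : Prop :=
  ∀ U : A.domain, (inner ℂ (A U) (U : H)).re ≤ 0

/-- `A` is m-dissipative: dissipative, and `λ I - A : D(A) → H` is onto for every `λ > 0`. -/
def IsMDissipative (A : H →ₗ.[ℂ] H) : Prop :=
  IsDissipative A ∧ ∀ l : ℝ, 0 < l → ∀ F : H, ∃ U : A.domain, (l : ℂ) • (U : H) - A U = F

/-- A `C₀`-semigroup of contractions on `H`; only the values for `t ≥ 0` matter. -/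
structure ContractionSemigroup (H : Type*) [NormedAddCommGroup H] [InnerProductSpace ℂ H] where
  /-- the operators `T(t)` -/
  T : ℝ → H →L[ℂ] H
  map_zero : T 0 = ContinuousLinearMap.id ℂ H
  map_add : ∀ s t, 0 ≤ s → 0 ≤ t → T (s + t) = (T s).comp (T t)
  contraction : ∀ t, 0 ≤ t → ‖T t‖ ≤ 1
  continuous : ∀ x, Tendsto (fun t => T t x) (𝓝[>] 0) (𝓝 x)

/-- `A` is the infinitesimal generator of the semigroup `S`: `x ∈ D(A)` and `A x = y` if and only
if `(T(h) x - x) / h → y` as `h → 0+`. -/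
def ContractionSemigroup.IsGeneratedBy (S : ContractionSemigroup H) (A : H →ₗ.[ℂ] H) : Prop :=
  ∀ x y : H, (x, y) ∈ A.graph ↔
    Tendsto (fun h : ℝ => ((h⁻¹ : ℝ) : ℂ) • (S.T h x - x)) (𝓝[>] 0) (𝓝 y)

/-- `U ∈ C([0, ∞), H)` is a weak solution of `U' = A U`, `U(0) = U₀`: for all `V ∈ D(A*)`, with
`V' = A* V`, the function `t ↦ ⟨U(t), V⟩` is differentiable on `[0, ∞)` with derivative
`⟨U(t), A* V⟩`. That `V ∈ D(A*)` and `V' = A* V` is spelled out as `⟨A X, V⟩ = ⟨X, V'⟩` for all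
`X ∈ D(A)`. -/
structure IsWeakSolution (A : H →ₗ.[ℂ] H) (U₀ : H) (U : ℝ → H) : Prop where
  initial : U 0 = U₀
  continuousOn : ContinuousOn U (Ici 0)
  weak : ∀ V V' : H, (∀ X : A.domain, inner ℂ (A X) V = inner ℂ (X : H) V') →
    ∀ t, 0 ≤ t → HasDerivWithinAt (fun t => inner ℂ V (U t)) (inner ℂ V' (U t)) (Ici 0) t

/-- `U ∈ C([0, ∞), D(A)) ∩ C¹([0, ∞), H)` (`D(A)` with the graph norm) is a strong solution of
`U' = A U`, `U(0) = U₀`. -/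
structure IsStrongSolution (A : H →ₗ.[ℂ] H) (U₀ : H) (U : ℝ → H) : Prop where
  initial : U 0 = U₀
  continuousOn : ContinuousOn U (Ici 0)
  /-- the values `A U(t)` exist, form a continuous function and are the derivatives `U'(t)` -/
  strong : ∃ AU : ℝ → H, ContinuousOn AU (Ici 0) ∧ ∀ t, 0 ≤ t →
    (U t, AU t) ∈ A.graph ∧ HasDerivWithinAt U (AU t) (Ici 0) t

end Abstract

end Piezo

end

noncomputable section

namespace Piezo

/-! ### Dissipative operators with an everywhere defined inverse -/

section DissipativeInverse

variable {H : Type*} [NormedAddCommGroup H] [InnerProductSpace ℂ H]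

/-! Everything about semigroups and solutions follows from two facts: $\mathcal A_m$ is dissipative
(`isDissipative_operatorA`) and maps its domain onto the energy space (`surjective_operatorA`). Only
the stationary problem $\mathcal A_m U=F$ is solved by hand; the equations with $\lambda>0$ come out
of the abstract argument.

Abstract half (`IsDissipative.generation`). A dissipative operator $A$ that is onto is injective.
Its inverse $B$ is everywhere defined and dissipative, so its graph is closed and $B$ is bounded.
Since $B$ is also injective, its range $D(A)$ is dense. The Hille-Yosida construction can then be
phrased with the bounded operator $B$ alone. The operators $(B-\varepsilon)^{-1}=A(1-\varepsilon
A)^{-1}$ are the Yosida approximations of $A$; they are bounded, dissipative and commute, and their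
exponentials are contractions that converge strongly. The limit satisfies
$T(t)Bz=Bz+\int_0^tT(s)z\,ds$, which yields the generator and the solutions. For uniqueness, the
difference $D$ of two strong solutions satisfies $BD'=D$, so that $\|D\|^2$ has derivative
$2\operatorname{Re}\langle BD',D'\rangle\le0$; for weak solutions the same argument is applied to
$BD$.

Concrete half. Integration by parts gives $\operatorname{Re}\langle\mathcal
A_mU,U\rangle=-c(1-m)\|w_x\|^2-\operatorname{Re}(\eta_s,\eta)_W$, and the memory term has the right
sign because $\sigma'\le0$ and $\eta(0)=0$. For surjectivity the stationary system decouples: $v$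
and $z$ are data, $\Lambda^m$ solves a Dirichlet problem, $\eta$ is a primitive in $s$, $w$ is
recovered from $\Lambda^m$ by dividing by $(1-m)+m\int_0^\infty s\sigma\,ds>0$, and $u,y$ come from
integrating twice. The decisive point is that primitives of elements of $W$ stay in $W$: this is the
weighted Hardy inequality `MemoryKernel.integrableOn_norm_sq_primitive`, which rests on
$\sigma'\le-d_\sigma\sigma$. -/

theorem re_inner_comm (x y : H) : (inner ℂ x y).re = (inner ℂ y x).re :=
  inner_re_symm (𝕜 := ℂ) x y

/-- Divide by $t$ and let $t\to0$. This closes every perturbation argument below: dissipativity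
tested on a vector perturbed by $t$ times a direction leaves a linear term that a quadratic one
would have to dominate. -/
theorem eq_zero_of_mul_le_sq_mul {a K : ℝ} (ha : 0 ≤ a)
    (h : ∀ t : ℝ, 0 < t → t * a ≤ t ^ 2 * K) : a = 0 := by
  by_contra hne
  have ha' : 0 < a := lt_of_le_of_ne ha (Ne.symm hne)
  have h1 := h 1 one_pos
  have hK : 0 < K := by linarith
  have h2 := h (a / (2 * K)) (by positivity)
  have h3 : (a / (2 * K)) * a ≤ (a / (2 * K)) * (a / 2) := by
    refine h2.trans (le_of_eq ?_)
    field_simp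
  have h4 := le_of_mul_le_mul_left h3 (by positivity)
  linarith

/-- An everywhere defined dissipative operator has a closed graph. -/
theorem eq_map_of_tendsto_of_dissipative (T : H →ₗ[ℂ] H)
    (hT : ∀ x, (inner ℂ (T x) x).re ≤ 0) (u : ℕ → H) (x y : H) (hu : Tendsto u atTop (𝓝 x))
    (hy : Tendsto (T ∘ u) atTop (𝓝 y)) : y = T x := by
  set e := y - T x with he
  -- Dissipativity at $u_n-x+z$ survives the limit because $T(u_n-x)\to e$ while $u_n-x\to0$. Taking
  -- $z=te$ then forces $e=0$.
  have key : ∀ z, (inner ℂ (e + T z) z).re ≤ 0 := by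
    intro z
    have h1 : Tendsto (fun n => (inner ℂ (T (u n - x + z)) (u n - x + z)).re) atTop
        (𝓝 (inner ℂ (e + T z) z).re) := by
      have a1 : Tendsto (fun n => T (u n - x + z)) atTop (𝓝 (e + T z)) := by
        simp only [map_add, map_sub]
        exact (hy.sub_const _).add_const _
      have a2 : Tendsto (fun n => u n - x + z) atTop (𝓝 z) := by
        simpa using (hu.sub_const x).add_const z
      exact (Complex.continuous_re.tendsto _).comp (a1.inner a2)
    exact le_of_tendsto' h1 fun n => hT _
  have h0 : ‖e‖ ^ 2 = 0 := by
    refine eq_zero_of_mul_le_sq_mul (K := -(inner ℂ (T e) e).re) (by positivity) fun t ht => ?_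
    have := key ((t : ℂ) • e)
    rw [map_smul, inner_add_left, inner_smul_right, inner_smul_left, inner_smul_right,
      inner_self_eq_norm_sq_to_K] at this
    simp only [Complex.conj_ofReal, Complex.add_re, Complex.re_ofReal_mul, Complex.coe_algebraMap,
      ← Complex.ofReal_pow, Complex.ofReal_re] at this
    nlinarith
  exact sub_eq_zero.1 (norm_eq_zero.1 (by simpa using h0))


theorem re_inner_self (x : H) : (inner ℂ x x).re = ‖x‖ ^ 2 := by
  rw [inner_self_eq_norm_sq_to_K]; norm_cast

/-- Time is real while the operators are complex linear, so the product rule is applied after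
restricting scalars to the reals. -/
theorem hasDerivAt_clm_apply {c : ℝ → H →L[ℂ] H} {c' : H →L[ℂ] H} {u : ℝ → H} {u' : H}
    {s : ℝ} (hc : HasDerivAt c c' s) (hu : HasDerivAt u u' s) :
    HasDerivAt (fun s => c s (u s)) (c' (u s) + c s u') s := by
  have h := ((ContinuousLinearMap.restrictScalarsL ℂ H H ℝ ℝ).hasFDerivAt.comp_hasDerivAt s
    hc).clm_apply hu
  exact h

variable [CompleteSpace H]

/-- A bounded operator with coercive real part is invertible. -/
theorem isUnit_of_coercive (C : H →L[ℂ] H) {a : ℝ} (ha : 0 < a)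
    (h : ∀ x, a * ‖x‖ ^ 2 ≤ (inner ℂ (C x) x).re) : IsUnit C := by
  have hb : ∀ x, a * ‖x‖ ≤ ‖C x‖ := by
    intro x
    rcases (norm_nonneg x).eq_or_lt with hx | hx
    · rw [← hx, mul_zero]; exact norm_nonneg _
    · have h1 : (inner ℂ (C x) x).re ≤ ‖C x‖ * ‖x‖ := re_inner_le_norm (𝕜 := ℂ) (C x) x
      have h2 := (h x).trans h1
      refine le_of_mul_le_mul_right ?_ hx
      nlinarith
  -- The Lax-Milgram argument: the lower bound gives injectivity and a closed range, and a vector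
  -- $y$ orthogonal to the range is killed by pairing it with $Cy$.
  have hal : AntilipschitzWith ⟨a⁻¹, by positivity⟩ C := by
    refine C.antilipschitz_of_bound fun x => ?_
    change ‖x‖ ≤ a⁻¹ * ‖C x‖
    rw [inv_mul_eq_div, le_div_iff₀ ha]
    linarith [hb x]
  have hker : C.ker = ⊥ := LinearMap.ker_eq_bot.2 hal.injective
  have hclosed : IsClosed (C.range : Set H) := by
    have := hal.isClosed_range C.uniformContinuous
    exact this
  have hrange : C.range = ⊤ := by
    have : CompleteSpace C.range := hclosed.completeSpace_coe
    rw [← Submodule.orthogonal_eq_bot_iff, Submodule.eq_bot_iff]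
    intro y hy
    have h1 := (Submodule.mem_orthogonal _ y).1 hy (C y) ⟨y, rfl⟩
    have h2 := h y
    rw [h1] at h2
    simp only [Complex.zero_re] at h2
    have h3 : ‖y‖ ^ 2 ≤ 0 := by
      by_contra h4
      have := mul_pos ha (not_le.1 h4)
      linarith
    exact norm_eq_zero.1 (by nlinarith [norm_nonneg y])
  let Ce := ContinuousLinearEquiv.ofBijective C hker hrange
  refine ⟨⟨C, Ce.symm, ?_, ?_⟩, rfl⟩
  · ext x; exact Ce.apply_symm_apply x
  · ext x; exact Ce.symm_apply_apply x

/-! ### Exponentials of bounded dissipative operators. -/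

/-- The squared norm along the orbit has derivative $2\operatorname{Re}\langle
Ye^{sY}x,e^{sY}x\rangle\le0$. -/
theorem norm_exp_smul_apply_le (Y : H →L[ℂ] H) (hY : ∀ x, (inner ℂ (Y x) x).re ≤ 0) {t : ℝ}
    (ht : 0 ≤ t) (x : H) : ‖NormedSpace.exp (t • Y) x‖ ≤ ‖x‖ := by
  have hd : ∀ s : ℝ, HasDerivAt (fun s : ℝ => NormedSpace.exp (s • Y) x)
      (Y (NormedSpace.exp (s • Y) x)) s := fun s => by
    have := hasDerivAt_clm_apply (hasDerivAt_exp_smul_const' (𝕂 := ℝ) Y s)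
      (hasDerivAt_const s x)
    simpa using this
  have hd2 : ∀ s : ℝ, HasDerivAt (fun s : ℝ => ‖NormedSpace.exp (s • Y) x‖ ^ 2)
      (2 * (inner ℂ (Y (NormedSpace.exp (s • Y) x)) (NormedSpace.exp (s • Y) x)).re) s := fun s => by
    let : InnerProductSpace ℝ H := InnerProductSpace.rclikeToReal ℂ H
    have := (hd s).norm_sq
    rw [real_inner_comm] at this
    exact this
  have hanti : Antitone (fun s : ℝ => ‖NormedSpace.exp (s • Y) x‖ ^ 2) :=
    antitone_of_deriv_nonpos (fun s => (hd2 s).differentiableAt) fun s => by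
      rw [(hd2 s).deriv]
      linarith [hY (NormedSpace.exp (s • Y) x)]
  have := hanti ht
  simp only [zero_smul, NormedSpace.exp_zero] at this
  exact (sq_le_sq₀ (norm_nonneg _) (norm_nonneg _)).1 (by simpa using this)

theorem hasDerivAt_exp_smul_apply (Y : H →L[ℂ] H) (x : H) (s : ℝ) :
    HasDerivAt (fun s : ℝ => NormedSpace.exp (s • Y) x) (NormedSpace.exp (s • Y) (Y x)) s := by
  have := hasDerivAt_clm_apply (hasDerivAt_exp_smul_const (𝕂 := ℝ) Y s)
    (hasDerivAt_const s x)
  simpa using this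

/-- The curve $s\mapsto e^{(t-s)Z}e^{sY}x$ joins $e^{tZ}x$ to $e^{tY}x$. As $Y$ and $Z$ commute, its
derivative is $e^{(t-s)Z}e^{sY}(Yx-Zx)$, and both exponentials are contractions. -/
theorem norm_exp_smul_sub_exp_smul_le (Y Z : H →L[ℂ] H) (hY : ∀ x, (inner ℂ (Y x) x).re ≤ 0)
    (hZ : ∀ x, (inner ℂ (Z x) x).re ≤ 0) (hYZ : Commute Y Z) {t : ℝ} (ht : 0 ≤ t) (x : H) :
    ‖NormedSpace.exp (t • Y) x - NormedSpace.exp (t • Z) x‖ ≤ t * ‖Y x - Z x‖ := by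
  have hd : ∀ s : ℝ, HasDerivAt (fun s : ℝ => NormedSpace.exp ((t - s) • Z)
      (NormedSpace.exp (s • Y) x))
      (NormedSpace.exp ((t - s) • Z) (NormedSpace.exp (s • Y) (Y x - Z x))) s := fun s => by
    have h1 := (hasDerivAt_exp_smul_const (𝕂 := ℝ) Z (t - s)).scomp s
      ((hasDerivAt_id s).const_sub t)
    have h2 := hasDerivAt_clm_apply h1 (hasDerivAt_exp_smul_apply Y x s)
    refine h2.congr_deriv ?_
    have hc : Commute Z (NormedSpace.exp (s • Y)) := (hYZ.symm.smul_right s).exp_right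
    have hc' : Z (NormedSpace.exp (s • Y) x) = NormedSpace.exp (s • Y) (Z x) :=
      congrArg (fun C : H →L[ℂ] H => C x) hc.eq
    simp [hc', sub_eq_add_neg, add_comm]
  have := norm_image_sub_le_of_norm_deriv_le_segment' (a := 0) (b := t) (C := ‖Y x - Z x‖)
    (fun s _ => (hd s).hasDerivWithinAt) (fun s hs => ?_) t (right_mem_Icc.2 ht)
  · simpa [mul_comm] using this
  · exact (norm_exp_smul_apply_le Z hZ (by linarith [hs.2]) _).trans
      (norm_exp_smul_apply_le Y hY hs.1 _)

/-- The Yosida approximation `(B - ε)⁻¹` of the inverse of `B`. -/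
def yosida (B : H →L[ℂ] H) (e : ℝ) : H →L[ℂ] H := Ring.inverse (B - (e : ℂ) • 1)

/-! ### Yosida approximations of the inverse of a bounded dissipative operator. -/

section Yosida

variable {B : H →L[ℂ] H} {e : ℝ}

theorem isUnit_sub_smul_one (hB : ∀ x, (inner ℂ (B x) x).re ≤ 0) (he : 0 < e) :
    IsUnit (B - (e : ℂ) • 1) := by
  rw [← IsUnit.neg_iff]
  refine isUnit_of_coercive _ he fun x => ?_
  have h1 : (-(B - (e : ℂ) • (1 : H →L[ℂ] H))) x = (e : ℂ) • x - B x := by simp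
  rw [h1, inner_sub_left, inner_smul_left, Complex.conj_ofReal, Complex.sub_re,
    Complex.re_ofReal_mul, re_inner_self]
  linarith [hB x]

theorem map_yosida (hB : ∀ x, (inner ℂ (B x) x).re ≤ 0) (he : 0 < e) (x : H) :
    B (yosida B e x) = x + (e : ℂ) • yosida B e x := by
  have := congrArg (fun C : H →L[ℂ] H => C x) (Ring.mul_inverse_cancel _ (isUnit_sub_smul_one hB he))
  simp only [mul_apply_eq_comp, sub_apply, smul_apply, one_apply_eq_self] at this
  exact sub_eq_iff_eq_add.1 this

theorem yosida_map (hB : ∀ x, (inner ℂ (B x) x).re ≤ 0) (he : 0 < e) (x : H) :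
    yosida B e (B x) = x + (e : ℂ) • yosida B e x := by
  have := congrArg (fun C : H →L[ℂ] H => C x) (Ring.inverse_mul_cancel _ (isUnit_sub_smul_one hB he))
  simp only [mul_apply_eq_comp, sub_apply, smul_apply, one_apply_eq_self,
    map_sub, map_smul] at this
  exact sub_eq_iff_eq_add.1 this

/-- At a non-unit `Ring.inverse` takes the value `0`, which commutes with everything, so
invertibility need not be assumed. -/
theorem commute_ringInverse {R : Type*} [Ring R] {a b : R} (h : Commute a b) :
    Commute a (Ring.inverse b) := by
  by_cases hb : IsUnit b
  · obtain ⟨u, rfl⟩ := hb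
    rw [Ring.inverse_unit]
    exact h.units_inv_right
  · rw [Ring.inverse_non_unit _ hb]
    exact Commute.zero_right a

omit [CompleteSpace H] in
theorem commute_yosida (e : ℝ) : Commute B (yosida B e) :=
  commute_ringInverse ((Commute.refl B).sub_right ((Commute.one_right B).smul_right (e : ℂ)))

omit [CompleteSpace H] in
theorem commute_yosida_yosida (e e' : ℝ) : Commute (yosida B e) (yosida B e') :=
  commute_ringInverse ((commute_yosida e).symm.sub_right ((Commute.one_right _).smul_right (e' : ℂ)))

/-- With $u=(B-\varepsilon)^{-1}x$ one has $x=Bu-\varepsilon u$, hence $\operatorname{Re}\langle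
u,x\rangle=\operatorname{Re}\langle u,Bu\rangle-\varepsilon\|u\|^2$. -/
theorem re_inner_yosida_le (hB : ∀ x, (inner ℂ (B x) x).re ≤ 0) (he : 0 < e) (x : H) :
    (inner ℂ (yosida B e x) x).re ≤ 0 := by
  have h1 : x = B (yosida B e x) - (e : ℂ) • yosida B e x := by rw [map_yosida hB he]; abel
  have h2 : inner ℂ (yosida B e x) x =
      inner ℂ (yosida B e x) (B (yosida B e x) - (e : ℂ) • yosida B e x) := by rw [← h1]
  rw [h2, inner_sub_right, inner_smul_right, Complex.sub_re, Complex.re_ofReal_mul, re_inner_self,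
    re_inner_comm]
  have := hB (yosida B e x)
  have : 0 ≤ e * ‖yosida B e x‖ ^ 2 := by positivity
  linarith

/-- In the expansion of $\|Bu-\varepsilon u\|^2$ the cross term
$-2\varepsilon\operatorname{Re}\langle Bu,u\rangle$ is nonnegative, so $\varepsilon^2\|u\|^2$ is a
lower bound. -/
theorem norm_smul_yosida_le (hB : ∀ x, (inner ℂ (B x) x).re ≤ 0) (he : 0 < e) (x : H) :
    e * ‖yosida B e x‖ ≤ ‖x‖ := by
  set u := yosida B e x with hu
  have h1 : x = B u - (e : ℂ) • u := by rw [hu, map_yosida hB he]; abel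
  have h2 : ‖x‖ ^ 2 = ‖B u‖ ^ 2 - 2 * (e * (inner ℂ (B u) u).re) + (e * ‖u‖) ^ 2 := by
    rw [h1, norm_sub_sq (𝕜 := ℂ), inner_smul_right, norm_smul]
    simp [abs_of_pos he]
  have h3 : 0 ≤ e * -(inner ℂ (B u) u).re := mul_nonneg he.le (by linarith [hB u])
  refine (sq_le_sq₀ (by positivity) (norm_nonneg _)).1 ?_
  nlinarith [sq_nonneg ‖B u‖]

/-- The parameters `1 / (n + 1)`. -/
def yosidaStep (n : ℕ) : ℝ := 1 / ((n : ℝ) + 1)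

theorem yosidaStep_pos (n : ℕ) : 0 < yosidaStep n := by unfold yosidaStep; positivity

theorem tendsto_yosidaStep : Tendsto yosidaStep atTop (𝓝 0) := tendsto_one_div_add_atTop_nhds_zero_nat

/-- If $x$ is orthogonal to the range, dissipativity at $x+tBx$ reads
$t\|Bx\|^2+t^2\operatorname{Re}\langle BBx,Bx\rangle\le0$. This forces $Bx=0$, and injectivity gives
$x=0$. -/
theorem denseRange_of_injective_of_dissipative (hB : ∀ x, (inner ℂ (B x) x).re ≤ 0)
    (hi : Function.Injective B) : DenseRange B := by
  have h : B.range.topologicalClosure = ⊤ := by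
    rw [Submodule.topologicalClosure_eq_top_iff, Submodule.eq_bot_iff]
    intro x hx
    have h0 : ∀ z, inner ℂ (B z) x = 0 := fun z => (Submodule.mem_orthogonal _ x).1 hx _ ⟨z, rfl⟩
    have h1 : ‖B x‖ ^ 2 = 0 := by
      refine eq_zero_of_mul_le_sq_mul (K := -(inner ℂ (B (B x)) (B x)).re) (by positivity)
        fun t ht => ?_
      have h2 := hB ((t : ℂ) • B x + x)
      have e : inner ℂ (B ((t : ℂ) • B x + x)) ((t : ℂ) • B x + x) =
          ((t ^ 2 : ℝ) : ℂ) * inner ℂ (B (B x)) (B x) + ((t * ‖B x‖ ^ 2 : ℝ) : ℂ) := by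
        rw [inner_add_right, h0, map_add, map_smul, inner_add_left, inner_smul_right,
          inner_smul_right, inner_smul_left, inner_self_eq_norm_sq_to_K]
        simp
        ring
      rw [e, Complex.add_re, Complex.re_ofReal_mul, Complex.ofReal_re] at h2
      linarith
    exact hi (by simpa using h1)
  exact Submodule.dense_iff_topologicalClosure_eq_top.2 h

omit [CompleteSpace H] in
-- Uniform contractivity reduces strong convergence to vectors $Bz$, where explicit formulas are
-- available; the next lemma does the same for Cauchy sequences.
theorem tendsto_zero_of_denseRange {T : ℕ → H →L[ℂ] H} (hT : ∀ n x, ‖T n x‖ ≤ ‖x‖)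
    (hd : DenseRange B) (h : ∀ z, Tendsto (fun n => T n (B z)) atTop (𝓝 0)) (x : H) :
    Tendsto (fun n => T n x) atTop (𝓝 0) := by
  rw [Metric.tendsto_atTop]
  intro ε hε
  obtain ⟨z, hz⟩ := hd.exists_dist_lt x (half_pos hε)
  obtain ⟨N, hN⟩ := Metric.tendsto_atTop.1 (h z) _ (half_pos hε)
  refine ⟨N, fun n hn => ?_⟩
  have h1 := hN n hn
  rw [dist_zero_right] at h1 ⊢
  have h2 := hT n (x - B z)
  rw [dist_eq_norm] at hz
  calc ‖T n x‖ = ‖T n (x - B z) + T n (B z)‖ := by rw [← map_add, sub_add_cancel]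
    _ ≤ _ := norm_add_le _ _
    _ < ε := by linarith

omit [CompleteSpace H] in
theorem cauchySeq_of_denseRange {T : ℕ → H →L[ℂ] H} (hT : ∀ n x, ‖T n x‖ ≤ ‖x‖)
    (hd : DenseRange B) (h : ∀ z, CauchySeq (fun n => T n (B z))) (x : H) :
    CauchySeq (fun n => T n x) := by
  rw [Metric.cauchySeq_iff']
  intro ε hε
  obtain ⟨z, hz⟩ := hd.exists_dist_lt x (show 0 < ε / 3 by linarith)
  obtain ⟨N, hN⟩ := Metric.cauchySeq_iff'.1 (h z) (ε / 3) (by linarith)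
  refine ⟨N, fun n hn => ?_⟩
  have h1 := hN n hn
  rw [dist_eq_norm] at h1 hz ⊢
  have h2 := hT n (x - B z)
  have h3 := hT N (x - B z)
  calc ‖T n x - T N x‖ = ‖T n (x - B z) + (T n (B z) - T N (B z)) - T N (x - B z)‖ := by
        congr 1; simp only [map_sub]; abel
    _ ≤ ‖T n (x - B z)‖ + ‖T n (B z) - T N (B z)‖ + ‖T N (x - B z)‖ :=
        (norm_sub_le _ _).trans (by gcongr; exact norm_add_le _ _)
    _ < ε := by linarith

/-- Since $(B-\varepsilon)^{-1}Bx=x+\varepsilon(B-\varepsilon)^{-1}x$, the claim is that the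
contractions $\varepsilon(B-\varepsilon)^{-1}$ tend strongly to $0$. On a vector $Bz$ the same
formula bounds them by $2\varepsilon\|z\|$, and density does the rest. In terms of $A=B^{-1}$, the
approximations converge to $A$ on $D(A)$. -/
theorem tendsto_yosida_map (hB : ∀ x, (inner ℂ (B x) x).re ≤ 0) (hd : DenseRange B) (x : H) :
    Tendsto (fun n => yosida B (yosidaStep n) (B x)) atTop (𝓝 x) := by
  have hT : ∀ n x, ‖((yosidaStep n : ℂ) • yosida B (yosidaStep n)) x‖ ≤ ‖x‖ := fun n x => by
    have := norm_smul_yosida_le hB (yosidaStep_pos n) x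
    simpa [norm_smul, abs_of_pos (yosidaStep_pos n)] using this
  have h0 : ∀ z, Tendsto (fun n => ((yosidaStep n : ℂ) • yosida B (yosidaStep n)) (B z)) atTop (𝓝 0) := by
    intro z
    refine squeeze_zero_norm (a := fun n => yosidaStep n * (2 * ‖z‖)) (fun n => ?_)
      (by simpa using tendsto_yosidaStep.mul_const (2 * ‖z‖))
    have h1 := hT n z
    simp only [smul_apply] at h1 ⊢
    rw [norm_smul, yosida_map hB (yosidaStep_pos n)]
    simp only [Complex.norm_real, Real.norm_of_nonneg (yosidaStep_pos n).le]
    refine mul_le_mul_of_nonneg_left ?_ (yosidaStep_pos n).le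
    linarith [norm_add_le z ((yosidaStep n : ℂ) • yosida B (yosidaStep n) z)]
  have h1 := (tendsto_zero_of_denseRange hT hd h0 x).const_add x
  rw [add_zero] at h1
  refine h1.congr fun n => ?_
  rw [yosida_map hB (yosidaStep_pos n), smul_apply]

theorem norm_exp_yosida_le (hB : ∀ x, (inner ℂ (B x) x).re ≤ 0) {t : ℝ} (ht : 0 ≤ t) (n : ℕ)
    (x : H) : ‖NormedSpace.exp (t • yosida B (yosidaStep n)) x‖ ≤ ‖x‖ :=
  norm_exp_smul_apply_le _ (re_inner_yosida_le hB (yosidaStep_pos n)) ht x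

/-- On $Bz$ two exponentials differ by at most $t$ times the difference of the approximations
applied to $Bz$, and those converge. -/
theorem cauchySeq_exp_yosida (hB : ∀ x, (inner ℂ (B x) x).re ≤ 0) (hd : DenseRange B) {t : ℝ}
    (ht : 0 ≤ t) (x : H) :
    CauchySeq (fun n => NormedSpace.exp (t • yosida B (yosidaStep n)) x) := by
  refine cauchySeq_of_denseRange (norm_exp_yosida_le hB ht) hd (fun z => ?_) x
  have h1 := (tendsto_yosida_map hB hd z).cauchySeq
  rw [Metric.cauchySeq_iff'] at h1 ⊢
  intro ε hε
  obtain ⟨N, hN⟩ := h1 (ε / (t + 1)) (by positivity)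
  refine ⟨N, fun n hn => ?_⟩
  have h2 := hN n hn
  rw [dist_eq_norm] at h2 ⊢
  refine (norm_exp_smul_sub_exp_smul_le _ _ (re_inner_yosida_le hB (yosidaStep_pos n))
    (re_inner_yosida_le hB (yosidaStep_pos N)) (commute_yosida_yosida _ _) ht _).trans_lt ?_
  rw [lt_div_iff₀ (by positivity)] at h2
  nlinarith [norm_nonneg (yosida B (yosidaStep n) (B z) - yosida B (yosidaStep N) (B z))]

/-- The limit of the semigroups generated by the Yosida approximations. -/
theorem exists_tendsto_exp_yosida (hB : ∀ x, (inner ℂ (B x) x).re ≤ 0) (hd : DenseRange B) :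
    ∃ T : ℝ → H →L[ℂ] H, ∀ t, 0 ≤ t → ∀ x,
      Tendsto (fun n => NormedSpace.exp (t • yosida B (yosidaStep n)) x) atTop (𝓝 (T t x)) := by
  have h : ∀ t : ℝ, ∃ T : H →L[ℂ] H, 0 ≤ t → ∀ x,
      Tendsto (fun n => NormedSpace.exp (t • yosida B (yosidaStep n)) x) atTop (𝓝 (T x)) := by
    intro t
    by_cases ht : 0 ≤ t
    · choose f hf using fun x => cauchySeq_tendsto_of_complete (cauchySeq_exp_yosida hB hd ht x)
      exact ⟨continuousLinearMapOfTendsto _ (tendsto_pi_nhds.2 hf), fun _ x => hf x⟩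
    -- Negative times are irrelevant and receive the operator `0`.
    · exact ⟨0, fun h => absurd h ht⟩
  choose T hT using h
  exact ⟨T, hT⟩

/-! ### The limit semigroup. -/

section Limit

variable {T : ℝ → H →L[ℂ] H} (hB : ∀ x, (inner ℂ (B x) x).re ≤ 0) (hd : DenseRange B)
  (hT : ∀ t, 0 ≤ t → ∀ x,
      Tendsto (fun n => NormedSpace.exp (t • yosida B (yosidaStep n)) x) atTop (𝓝 (T t x)))

include hB hT in
theorem norm_limit_le {t : ℝ} (ht : 0 ≤ t) (x : H) : ‖T t x‖ ≤ ‖x‖ :=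
  le_of_tendsto' (hT t ht x).norm fun n => norm_exp_yosida_le hB ht n x

include hT in
theorem limit_zero : T 0 = ContinuousLinearMap.id ℂ H := by
  ext x
  refine tendsto_nhds_unique (hT 0 le_rfl x) ?_
  simp

include hB hT in
theorem limit_add {s t : ℝ} (hs : 0 ≤ s) (ht : 0 ≤ t) : T (s + t) = (T s).comp (T t) := by
  ext x
  refine tendsto_nhds_unique (hT (s + t) (add_nonneg hs ht) x) ?_
  -- The outer exponentials depend on $n$ as well; being contractions, they carry the error of the
  -- inner limit to $0$.
  have h1 : Tendsto (fun n => NormedSpace.exp (s • yosida B (yosidaStep n))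
      (NormedSpace.exp (t • yosida B (yosidaStep n)) x - T t x)) atTop (𝓝 0) := by
    refine squeeze_zero_norm (fun n => norm_exp_yosida_le hB hs n _) ?_
    simpa using ((hT t ht x).sub_const (T t x)).norm
  have h2 := h1.add (hT s hs (T t x))
  rw [zero_add] at h2
  refine h2.congr fun n => ?_
  let : NormedAlgebra ℚ (H →L[ℂ] H) := NormedAlgebra.restrictScalars ℚ ℂ _
  rw [← map_add, sub_add_cancel, add_smul, NormedSpace.exp_add_of_commute]
  · rfl
  · exact ((Commute.refl _).smul_left s).smul_right t

include hT in
theorem map_limit {t : ℝ} (ht : 0 ≤ t) (x : H) : B (T t x) = T t (B x) := by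
  refine tendsto_nhds_unique ((B.continuous.tendsto _).comp (hT t ht x)) ?_
  refine (hT t ht (B x)).congr fun n => ?_
  have hc : Commute B (NormedSpace.exp (t • yosida B (yosidaStep n))) :=
    ((commute_yosida _).smul_right t).exp_right
  exact (congrArg (fun C : H →L[ℂ] H => C x) hc.eq).symm

include hB hd hT in
-- This is the fundamental theorem of calculus for the approximating exponentials, passed to the
-- limit by dominated convergence; the approximations applied to $Bz$ tend to $z$, so $B$ disappears
-- under the integral.
theorem limit_map_eq_add_integral {t : ℝ} (ht : 0 ≤ t) (z : H) :
    T t (B z) = B z + ∫ s in (0 : ℝ)..t, T s z := by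
  have h1 : ∀ n, NormedSpace.exp (t • yosida B (yosidaStep n)) (B z) - B z =
      ∫ s in (0 : ℝ)..t, NormedSpace.exp (s • yosida B (yosidaStep n)) (yosida B (yosidaStep n) (B z)) := by
    intro n
    have := intervalIntegral.integral_eq_sub_of_hasDerivAt (a := 0) (b := t)
      (fun s _ => hasDerivAt_exp_smul_apply (yosida B (yosidaStep n)) (B z) s) ?_
    · rw [this]; simp
    · apply Continuous.intervalIntegrable
      exact continuous_iff_continuousAt.2 fun s =>
        (hasDerivAt_exp_smul_apply (yosida B (yosidaStep n)) (yosida B (yosidaStep n) (B z)) s).continuousAt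
  have hY := tendsto_yosida_map hB hd z
  have h2 : Tendsto (fun n => ∫ s in (0 : ℝ)..t,
      NormedSpace.exp (s • yosida B (yosidaStep n)) (yosida B (yosidaStep n) (B z))) atTop
      (𝓝 (∫ s in (0 : ℝ)..t, T s z)) := by
    obtain ⟨C, hC⟩ := hY.norm.bddAbove_range
    refine intervalIntegral.tendsto_integral_filter_of_dominated_convergence (fun _ => C)
      (Eventually.of_forall fun n => ?_) (Eventually.of_forall fun n => ?_) (by simp) ?_
    · exact (continuous_iff_continuousAt.2 fun s => (hasDerivAt_exp_smul_apply (yosida B (yosidaStep n))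
        (yosida B (yosidaStep n) (B z)) s).continuousAt).aestronglyMeasurable
    · refine Eventually.of_forall fun s hs => ?_
      rw [uIoc_of_le ht] at hs
      exact (norm_exp_yosida_le hB hs.1.le n _).trans (hC ⟨n, rfl⟩)
    · refine Eventually.of_forall fun s hs => ?_
      rw [uIoc_of_le ht] at hs
      have a1 : Tendsto (fun n => NormedSpace.exp (s • yosida B (yosidaStep n))
          (yosida B (yosidaStep n) (B z) - z)) atTop (𝓝 0) := by
        refine squeeze_zero_norm (fun n => norm_exp_yosida_le hB hs.1.le n _) ?_
        simpa using (hY.sub_const z).norm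
      have a2 := a1.add (hT s hs.1.le z)
      rw [zero_add] at a2
      refine a2.congr fun n => ?_
      rw [← map_add, sub_add_cancel]
  have h3 := tendsto_nhds_unique ((hT t ht (B z)).sub_const (B z)) (h2.congr fun n => (h1 n).symm)
  rw [← h3]; abel

include hB hd hT in
-- Replacing $t$ by $\max(t,0)$ makes the orbit a continuous function on the whole line, which
-- simplifies the interval integrals below. On $Bz$ the orbit is Lipschitz with constant $\|z\|$ by
-- the integral formula; contractivity and density extend continuity to every $x$.
theorem continuous_limit (x : H) : Continuous fun t : ℝ => T (max t 0) x := by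
  rw [Metric.continuous_iff]
  intro t ε hε
  obtain ⟨z, hz⟩ := hd.exists_dist_lt x (show 0 < ε / 3 by linarith)
  have hlip : ∀ a b : ℝ, 0 ≤ a → a ≤ b → ‖T b (B z) - T a (B z)‖ ≤ (b - a) * ‖z‖ := by
    intro a b ha hab
    have e1 : T b (B z) - T a (B z) = T a (T (b - a) (B z) - B z) := by
      have e2 := limit_add hB hT ha (sub_nonneg.2 hab)
      rw [add_sub_cancel] at e2
      rw [map_sub, e2, ContinuousLinearMap.comp_apply]
    rw [e1, limit_map_eq_add_integral hB hd hT (sub_nonneg.2 hab), add_sub_cancel_left]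
    refine (norm_limit_le hB hT ha _).trans ?_
    have := intervalIntegral.norm_integral_le_of_norm_le_const (a := 0) (b := b - a) (C := ‖z‖)
      (f := fun s => T s z) (fun s hs => ?_)
    · rwa [sub_zero, abs_of_nonneg (sub_nonneg.2 hab), mul_comm] at this
    · rw [uIoc_of_le (sub_nonneg.2 hab)] at hs
      exact norm_limit_le hB hT hs.1.le z
  have hlip' : ∀ a b : ℝ, 0 ≤ a → 0 ≤ b → ‖T b (B z) - T a (B z)‖ ≤ |b - a| * ‖z‖ := by
    intro a b ha hb
    rcases le_total a b with h | h
    · rw [abs_of_nonneg (sub_nonneg.2 h)]; exact hlip a b ha h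
    · rw [norm_sub_rev, abs_sub_comm, abs_of_nonneg (sub_nonneg.2 h)]; exact hlip b a hb h
  refine ⟨ε / 3 / (‖z‖ + 1), by positivity, fun s hs => ?_⟩
  rw [Real.dist_eq, lt_div_iff₀ (by positivity)] at hs
  rw [dist_eq_norm] at hz ⊢
  have h0 := hlip' (max t 0) (max s 0) (le_max_right _ _) (le_max_right _ _)
  have h1 : |max s 0 - max t 0| ≤ |s - t| := abs_max_sub_max_le_abs s t 0
  have h2 := norm_limit_le hB hT (le_max_right t 0) (x - B z)
  have h3 := norm_limit_le hB hT (le_max_right s 0) (x - B z)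
  have h4 : |max s 0 - max t 0| * ‖z‖ ≤ |s - t| * ‖z‖ := by gcongr
  calc ‖T (max s 0) x - T (max t 0) x‖ = ‖T (max s 0) (x - B z) +
        (T (max s 0) (B z) - T (max t 0) (B z)) - T (max t 0) (x - B z)‖ := by
        congr 1; simp only [map_sub]; abel
    _ ≤ ‖T (max s 0) (x - B z)‖ + ‖T (max s 0) (B z) - T (max t 0) (B z)‖
        + ‖T (max t 0) (x - B z)‖ :=
        (norm_sub_le _ _).trans (by gcongr; exact norm_add_le _ _)
    _ < ε := by nlinarith [abs_nonneg (s - t)]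

include hB hd hT in
-- With $A=B^{-1}$ and $x=Bz\in D(A)$ this is $\frac{d}{dt}T(t)x=T(t)Ax$, up to the endpoint $t=0$.
theorem hasDerivWithinAt_limit_map {t : ℝ} (ht : 0 ≤ t) (z : H) :
    HasDerivWithinAt (fun t => T t (B z)) (T t z) (Ici 0) t := by
  have hc := continuous_limit hB hd hT z
  have h1 := (intervalIntegral.integral_hasDerivAt_right (hc.intervalIntegrable 0 t)
    (hc.stronglyMeasurableAtFilter _ _) hc.continuousAt).const_add (B z)
  rw [max_eq_left ht] at h1
  have e : ∀ r ∈ Ici (0 : ℝ), T r (B z) = B z + ∫ s in (0 : ℝ)..r, T (max s 0) z := by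
    intro r hr
    rw [limit_map_eq_add_integral hB hd hT hr]
    congr 1
    refine intervalIntegral.integral_congr fun s hs => ?_
    rw [uIcc_of_le hr] at hs
    simp only [max_eq_left hs.1]
  exact h1.hasDerivWithinAt.congr e (e t ht)

end Limit

omit [CompleteSpace H] in
/-- A differentiable `D` with `B D' = D` and `D(0) = 0` vanishes, if `B` is dissipative. -/
theorem eq_zero_of_map_deriv_eq (hB : ∀ x, (inner ℂ (B x) x).re ≤ 0) {D D' : ℝ → H} (h0 : D 0 = 0)
    (hD : ∀ t, 0 ≤ t → HasDerivWithinAt D (D' t) (Ici 0) t) (hBD : ∀ t, 0 ≤ t → B (D' t) = D t)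
    {t : ℝ} (ht : 0 ≤ t) : D t = 0 := by
  have hd2 : ∀ s, 0 ≤ s → HasDerivWithinAt (fun s => ‖D s‖ ^ 2) (2 * (inner ℂ (D s) (D' s)).re)
      (Ici 0) s := fun s hs => by
    let : InnerProductSpace ℝ H := InnerProductSpace.rclikeToReal ℂ H
    exact (hD s hs).norm_sq
  -- The derivative of $\|D\|^2$ is $2\operatorname{Re}\langle D,D'\rangle=2\operatorname{Re}\langle
  -- BD',D'\rangle\le0$.
  have hanti : AntitoneOn (fun s => ‖D s‖ ^ 2) (Ici 0) := by
    refine antitoneOn_of_hasDerivWithinAt_nonpos (convex_Ici 0)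
      (fun s hs => (hd2 s hs).continuousWithinAt)
      (fun s hs => (hd2 s (interior_subset hs)).mono interior_subset) fun s hs => ?_
    have := hB (D' s)
    rw [hBD s (interior_subset hs)] at this
    linarith
  have := hanti (mem_Ici.2 le_rfl) (mem_Ici.2 ht) ht
  simp only [h0, norm_zero] at this
  exact norm_eq_zero.1 (by nlinarith [norm_nonneg (D t)])

/-- A continuous function whose weak derivatives form a continuous function is differentiable. -/
theorem hasDerivWithinAt_of_inner {Y Z : ℝ → H} (hZ : ContinuousOn Z (Ici 0))
    (hYZ : ∀ g, ∀ t, 0 ≤ t → HasDerivWithinAt (fun t => inner ℂ g (Y t)) (inner ℂ g (Z t)) (Ici 0) t)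
    {t : ℝ} (ht : 0 ≤ t) : HasDerivWithinAt Y (Z t) (Ici 0) t := by
  have hc : Continuous fun s : ℝ => Z (max s 0) :=
    hZ.comp_continuous (continuous_id.max continuous_const) fun s => le_max_right s 0
  have hF : ∀ s : ℝ, HasDerivAt (fun s => ∫ r in (0 : ℝ)..s, Z (max r 0)) (Z (max s 0)) s := fun s =>
    intervalIntegral.integral_hasDerivAt_right (hc.intervalIntegrable 0 s)
      (hc.stronglyMeasurableAtFilter _ _) hc.continuousAt
  -- Paired with any $g$, the difference between $Y$ and the primitive of $Z$ has zero derivative on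
  -- $[0,\infty)$, hence is constant. The primitive is strongly differentiable because $Z$ is
  -- continuous.
  have e : ∀ s ∈ Ici (0 : ℝ), Y s = Y 0 + ∫ r in (0 : ℝ)..s, Z (max r 0) := by
    intro s hs
    refine ext_inner_left ℂ fun g => ?_
    have h1 : ∀ r ∈ Ici (0 : ℝ), HasDerivWithinAt
        (fun r => inner ℂ g (Y r) - inner ℂ g (∫ q in (0 : ℝ)..r, Z (max q 0))) 0 (Ici 0) r := by
      intro r hr
      have h2 : HasDerivAt (fun r => inner ℂ g (∫ q in (0 : ℝ)..r, Z (max q 0)))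
          (inner ℂ g (Z r)) r := by
        have := (hF r)
        rw [max_eq_left hr] at this
        have h3 := ((innerSL ℂ g).restrictScalars ℝ).hasFDerivAt.comp_hasDerivAt r this
        exact h3
      have h3 := (hYZ g r hr).sub h2.hasDerivWithinAt
      rw [sub_self] at h3
      exact h3
    have h4 := (convex_Ici (0 : ℝ)).is_const_of_fderivWithin_eq_zero (𝕜 := ℝ)
      (f := fun r => inner ℂ g (Y r) - inner ℂ g (∫ q in (0 : ℝ)..r, Z (max q 0)))
      (fun r hr => (h1 r hr).differentiableWithinAt) (fun r hr => by
        rw [(h1 r hr).hasFDerivWithinAt.fderivWithin (uniqueDiffOn_Ici 0 r hr)]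
        simp) hs (mem_Ici.2 le_rfl)
    simp only [intervalIntegral.integral_same, inner_zero_right, sub_zero] at h4
    rw [inner_add_right, ← h4]; ring
  have h5 := (hF t).hasDerivWithinAt (s := Ici 0) |>.const_add (Y 0)
  rw [max_eq_left ht] at h5
  exact h5.congr e (e t ht)

end Yosida

/-! ### From dissipativity and surjectivity to generation and well-posedness. -/

section Operator

variable {A : H →ₗ.[ℂ] H}

omit [CompleteSpace H] in
/-- A dissipative operator that is onto is injective. -/
theorem IsDissipative.eq_zero (hd : IsDissipative A) (hs : ∀ F, ∃ U : A.domain, A U = F)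
    {U : A.domain} (hU : A U = 0) : U = 0 := by
  -- With $AV=U$ and $AU=0$, dissipativity at $tV+U$ becomes $t^2\operatorname{Re}\langle
  -- AV,V\rangle+t\|U\|^2\le0$.
  obtain ⟨V, hV⟩ := hs U
  have h0 : ‖(U : H)‖ ^ 2 = 0 := by
    refine eq_zero_of_mul_le_sq_mul (K := -(inner ℂ (A V) (V : H)).re) (by positivity) fun t ht => ?_
    have h1 := hd ((t : ℂ) • V + U)
    have e : inner ℂ (A ((t : ℂ) • V + U)) (((t : ℂ) • V + U : A.domain) : H) =
        ((t ^ 2 : ℝ) : ℂ) * inner ℂ (A V) (V : H) + ((t * ‖(U : H)‖ ^ 2 : ℝ) : ℂ) := by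
      rw [LinearPMap.map_add, LinearPMap.map_smul, hU, add_zero, Submodule.coe_add,
        Submodule.coe_smul, inner_add_right, inner_smul_right, inner_smul_left, inner_smul_left, hV,
        inner_self_eq_norm_sq_to_K]
      simp
      ring
    rw [e, Complex.add_re, Complex.re_ofReal_mul, Complex.ofReal_re] at h1
    linarith
  exact Subtype.ext (norm_eq_zero.1 (by simpa using h0))

/-- Injectivity makes the chosen preimages unique, hence linear in the datum. The inverse inherits
dissipativity through the symmetry of the real part, so its graph is closed and the closed graph
theorem makes it bounded. -/
theorem IsDissipative.exists_inverse (hd : IsDissipative A) (hs : ∀ F, ∃ U : A.domain, A U = F) :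
    ∃ B : H →L[ℂ] H, (∀ x, (inner ℂ (B x) x).re ≤ 0) ∧ ∀ x y, (x, y) ∈ A.graph ↔ B y = x := by
  choose f hf using hs
  have hinj : ∀ U V : A.domain, A U = A V → U = V := fun U V h =>
    sub_eq_zero.1 (hd.eq_zero (fun F => ⟨f F, hf F⟩) (by rw [LinearPMap.map_sub, h, sub_self]))
  let B₀ : H →ₗ[ℂ] H :=
    { toFun := fun x => f x
      map_add' := fun x y => by
        have : f (x + y) = f x + f y := hinj _ _ (by rw [LinearPMap.map_add, hf, hf, hf])
        rw [this]; rfl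
      map_smul' := fun a x => by
        have : f (a • x) = a • f x := hinj _ _ (by rw [LinearPMap.map_smul, hf, hf])
        rw [this]; rfl }
  have hB₀ : ∀ x, (inner ℂ (B₀ x) x).re ≤ 0 := fun x => by
    have := hd (f x)
    rw [hf, re_inner_comm] at this
    exact this
  refine ⟨ContinuousLinearMap.ofSeqClosedGraph (g := B₀)
    (eq_map_of_tendsto_of_dissipative B₀ hB₀), hB₀, fun x y => ?_⟩
  rw [LinearPMap.mem_graph_iff]
  constructor
  · rintro ⟨U, hU, hAU⟩
    change _ = (x, y).1
    rw [← hU]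
    exact congrArg Subtype.val (hinj (f y) U (by rw [hf]; exact hAU.symm))
  · intro h
    exact ⟨f y, h, hf y⟩

/-- The consequences of dissipativity and surjectivity: m-dissipativity, density of the domain,
generation of a semigroup, and existence and uniqueness of weak and strong solutions. -/
theorem IsDissipative.generation (hd : IsDissipative A) (hs : ∀ F, ∃ U : A.domain, A U = F) :
    IsMDissipative A ∧ Dense (A.domain : Set H) ∧ (∀ F : H, ∃! U : A.domain, -(A U) = F) ∧
    ∃ S : ContractionSemigroup H, S.IsGeneratedBy A ∧
      (∀ U₀ : H, IsWeakSolution A U₀ (fun t => S.T t U₀) ∧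
        ∀ U : ℝ → H, IsWeakSolution A U₀ U → ∀ t, 0 ≤ t → U t = S.T t U₀) ∧
      (∀ U₀ ∈ A.domain, IsStrongSolution A U₀ (fun t => S.T t U₀) ∧
        ∀ U : ℝ → H, IsStrongSolution A U₀ U → ∀ t, 0 ≤ t → U t = S.T t U₀) := by
  obtain ⟨B, hB, hA⟩ := hd.exists_inverse hs
  have hi : Function.Injective B := by
    intro x y h
    have h1 := (hA (B x) x).2 rfl
    have h2 := (hA (B x) y).2 h.symm
    exact A.mem_graph_snd_inj h1 h2 rfl
  have hdense := denseRange_of_injective_of_dissipative hB hi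
  have hdom : ∀ x, x ∈ A.domain ↔ ∃ y, B y = x := fun x => by
    rw [LinearPMap.mem_domain_iff]
    simp only [hA]
  have hAB : ∀ y (h : B y ∈ A.domain), A ⟨B y, h⟩ = y := fun y h =>
    A.mem_graph_snd_inj (A.mem_graph ⟨B y, h⟩) ((hA _ _).2 rfl) rfl
  obtain ⟨T, hT⟩ := exists_tendsto_exp_yosida hB hdense
  have hTc : ∀ x, ContinuousOn (fun t => T t x) (Ici 0) := fun x =>
    (continuous_limit hB hdense hT x).continuousOn.congr fun t ht => by
      simp only [max_eq_left (mem_Ici.1 ht)]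
  have hT0 : ∀ x, T 0 x = x := fun x => by rw [limit_zero hT]; rfl
  let S : ContractionSemigroup H :=
    { T := T
      map_zero := limit_zero hT
      map_add := fun s t hs ht => limit_add hB hT hs ht
      contraction := fun t ht => ContinuousLinearMap.opNorm_le_bound _ zero_le_one fun x => by
        rw [one_mul]; exact norm_limit_le hB hT ht x
      continuous := fun x => by
        have := (hTc x 0 (mem_Ici.2 le_rfl)).tendsto
        rw [hT0] at this
        exact this.mono_left (nhdsWithin_mono _ Ioi_subset_Ici_self) }
  have hgen : ∀ y, Tendsto (fun h : ℝ => ((h⁻¹ : ℝ) : ℂ) • (T h (B y) - B y)) (𝓝[>] 0) (𝓝 y) := by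
    intro y
    have h1 := (hasDerivWithinAt_limit_map hB hdense hT le_rfl y).mono Ioi_subset_Ici_self
    rw [hasDerivWithinAt_iff_tendsto_slope' (by simp), hT0] at h1
    refine h1.congr fun h => ?_
    rw [slope_def_module, sub_zero, hT0]
    exact (Complex.coe_smul _ _).symm
  refine ⟨⟨hd, fun l hl F => ?_⟩, ?_, fun F => ?_, S, ?_, fun U₀ => ⟨?_, ?_⟩, fun U₀ hU₀ => ⟨?_, ?_⟩⟩
  -- With $U=Bg$ the equation $\lambda U-AU=F$ becomes $(1-\lambda B)g=-F$, and $1-\lambda B$ is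
  -- coercive with constant $1$.
  · obtain ⟨u, hu⟩ := isUnit_of_coercive (1 - (l : ℂ) • B) one_pos fun x => by
      have h1 : (1 - (l : ℂ) • B) x = x - (l : ℂ) • B x := rfl
      rw [h1, inner_sub_left, inner_smul_left, Complex.conj_ofReal, Complex.sub_re,
        Complex.re_ofReal_mul, re_inner_self]
      nlinarith [hB x]
    obtain ⟨g, hg⟩ : ∃ g, g - (l : ℂ) • B g = -F := by
      refine ⟨(↑u⁻¹ : H →L[ℂ] H) (-F), ?_⟩
      have := congrArg (fun C : H →L[ℂ] H => C (-F)) u.mul_inv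
      rw [hu] at this
      exact this
    have hmem : B g ∈ A.domain := (hdom _).2 ⟨g, rfl⟩
    refine ⟨⟨B g, hmem⟩, ?_⟩
    rw [hAB, ← neg_neg F, ← hg, neg_sub]
  · refine hdense.mono ?_
    rintro _ ⟨y, rfl⟩
    exact (hdom _).2 ⟨y, rfl⟩
  · obtain ⟨U, hU⟩ := hs (-F)
    refine ⟨U, neg_eq_iff_eq_neg.2 hU, fun V hV => ?_⟩
    have h1 : A (V - U) = 0 := by
      rw [LinearPMap.map_sub, hU, show A V = -F from neg_eq_iff_eq_neg.1 hV, sub_self]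
    exact sub_eq_zero.1 (hd.eq_zero hs h1)
  · intro x y
    rw [hA]
    constructor
    · rintro rfl
      exact hgen y
    · intro h
      -- Applying $B$ to the difference quotients at $x$ gives limit $By$. Since $B$ commutes with
      -- $T(h)$, these are the quotients at $Bx$, whose limit is $x$; so $By=x$.
      refine tendsto_nhds_unique ((B.continuous.tendsto _).comp h) (Tendsto.congr' ?_ (hgen x))
      filter_upwards [self_mem_nhdsWithin] with r hr
      have hr' : (0 : ℝ) ≤ r := le_of_lt hr
      change _ = B _
      rw [map_smul, map_sub]
      change _ = _ • (B (T r x) - B x)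
      rw [map_limit hT hr']
  · refine ⟨hT0 U₀, hTc U₀, fun V V' hV t ht => ?_⟩
    -- That $V'=A^*V$ amounts to $V=B^*V'$, hence $\langle V,T(t)U_0\rangle=\langle
    -- V',T(t)BU_0\rangle$, and the orbit of $BU_0$ is differentiable.
    have hVV : V = ContinuousLinearMap.adjoint B V' := by
      refine ext_inner_left ℂ fun z => ?_
      have hmem : B z ∈ A.domain := (hdom _).2 ⟨z, rfl⟩
      rw [ContinuousLinearMap.adjoint_inner_right, ← hV ⟨B z, hmem⟩, hAB]
    have h1 := hasDerivWithinAt_limit_map hB hdense hT ht U₀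
    have h2 := ((innerSL ℂ V').restrictScalars ℝ).hasFDerivAt.comp_hasDerivWithinAt t h1
    refine HasDerivWithinAt.congr (f := fun t => inner ℂ V' (T t (B U₀))) h2 (fun s hs => ?_) ?_
    · change inner ℂ V (T s U₀) = _
      rw [hVV, ContinuousLinearMap.adjoint_inner_left, map_limit hT hs]
    · change inner ℂ V (T t U₀) = _
      rw [hVV, ContinuousLinearMap.adjoint_inner_left, map_limit hT ht]
  · intro U hU t ht
    -- Each $B^*g$ is an admissible test vector with $A^*B^*g=g$. Testing with all of them says that
    -- $BD$ has weak derivative $D$; continuity of $D$ makes this a strong derivative.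
    have hadj : ∀ g, ∀ X : A.domain,
        inner ℂ (A X) (ContinuousLinearMap.adjoint B g) = inner ℂ (X : H) g := by
      intro g X
      rw [ContinuousLinearMap.adjoint_inner_right, (hA X (A X)).1 (A.mem_graph X)]
    set D : ℝ → H := fun t => U t - T t U₀ with hD
    have hDc : ContinuousOn D (Ici 0) := hU.continuousOn.sub (hTc U₀)
    have hw : ∀ s, 0 ≤ s → HasDerivWithinAt (fun s => B (D s)) (D s) (Ici 0) s := by
      intro s hs
      refine hasDerivWithinAt_of_inner hDc (fun g r hr => ?_) hs
      have h1 := hU.weak _ _ (hadj g) r hr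
      have h2 := hasDerivWithinAt_limit_map hB hdense hT hr U₀
      have h3 := ((innerSL ℂ g).restrictScalars ℝ).hasFDerivAt.comp_hasDerivWithinAt r h2
      have h4 := h1.sub h3
      simp only [hD, inner_sub_right]
      refine h4.congr_of_mem (fun q hq => ?_) hr
      simp only [Pi.sub_apply, map_sub, inner_sub_right, ContinuousLinearMap.adjoint_inner_left,
        map_limit hT hq]
      rfl
    have h0 : B (D t) = 0 := eq_zero_of_map_deriv_eq hB (D := fun s => B (D s)) (D' := D)
      (by simp [hD, hU.initial, hT0]) hw (fun _ _ => rfl) ht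
    have h5 : D t = 0 := hi (by rw [h0, map_zero])
    exact sub_eq_zero.1 h5
  · obtain ⟨y, rfl⟩ := (hdom _).1 hU₀
    refine ⟨hT0 _, hTc _, fun t => T t y, hTc y, fun t ht => ⟨?_, ?_⟩⟩
    · rw [hA]; exact map_limit hT ht y
    · exact hasDerivWithinAt_limit_map hB hdense hT ht y
  · intro U hU t ht
    obtain ⟨y, rfl⟩ := (hdom _).1 hU₀
    obtain ⟨AU, -, hAU⟩ := hU.strong
    have h5 := eq_zero_of_map_deriv_eq hB (D := fun s => U s - T s (B y))
      (D' := fun s => AU s - T s y) (by simp [hU.initial, hT0])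
      (fun s hs => (hAU s hs).2.sub (hasDerivWithinAt_limit_map hB hdense hT hs y))
      (fun s hs => by rw [map_sub, (hA _ _).1 (hAU s hs).1, map_limit hT hs]) ht
    exact sub_eq_zero.1 h5

end Operator

end DissipativeInverse

/-! ### Integration by parts for primitives of vector-valued functions -/

section Bilinear

variable {E F G : Type*} [NormedAddCommGroup E] [NormedSpace ℝ E] [NormedAddCommGroup F]
  [NormedSpace ℝ F] [NormedAddCommGroup G] [NormedSpace ℝ G] [CompleteSpace E] [CompleteSpace F]
  [CompleteSpace G]

omit [CompleteSpace E] in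
theorem integral_indicator_Iic_restrict {f : ℝ → E} {a c x : ℝ} (hx : x ∈ Ioc a c) :
    ∫ t, (Iic x).indicator f t ∂(volume.restrict (Ioc a c)) = ∫ t in a..x, f t := by
  rw [integral_indicator measurableSet_Iic, Measure.restrict_restrict measurableSet_Iic,
    intervalIntegral.integral_of_le hx.1.le]
  congr 2
  ext t
  simp only [mem_inter_iff, mem_Iic, mem_Ioc]
  exact ⟨fun h => ⟨h.2.1, h.1⟩, fun h => ⟨h.2, h.1, h.2.trans hx.2⟩⟩

omit [CompleteSpace E] in
theorem integral_indicator_Iio_restrict {f : ℝ → E} {a c x : ℝ} (hx : x ∈ Ioc a c) :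
    ∫ t, (Iio x).indicator f t ∂(volume.restrict (Ioc a c)) = ∫ t in a..x, f t := by
  rw [← integral_indicator_Iic_restrict hx]
  refine integral_congr_ae (ae_restrict_of_ae ?_)
  exact indicator_ae_eq_of_ae_eq_set Iio_ae_eq_Iic

/-- Integration by parts for the primitives of two integrable functions. -/
theorem integral_bilin_primitive (b : E →L[ℝ] F →L[ℝ] G) {a c : ℝ} (hac : a ≤ c) {f : ℝ → E}
    {g : ℝ → F} (hf : IntegrableOn f (Ioc a c)) (hg : IntegrableOn g (Ioc a c)) :
    IntegrableOn (fun x => b (f x) (∫ t in a..x, g t)) (Ioc a c) ∧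
    IntegrableOn (fun x => b (∫ t in a..x, f t) (g x)) (Ioc a c) ∧
    (∫ x in a..c, b (f x) (∫ t in a..x, g t)) + ∫ x in a..c, b (∫ t in a..x, f t) (g x) =
      b (∫ x in a..c, f x) (∫ x in a..c, g x) := by
  set μ := volume.restrict (Ioc a c) with hμ
  -- By Fubini, $b(f(x),g(t))$ is integrated over the square, which is cut along the diagonal; each
  -- triangle produces one term of the formula. No differentiability of the primitives is needed.
  have hK : Integrable (fun p : ℝ × ℝ => b (f p.1) (g p.2)) (μ.prod μ) :=
    hf.op_fst_snd (op := fun x y => b x y) (by fun_prop) ⟨‖b‖, fun x y => b.le_opNorm₂ x y⟩ hg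
  have hs : MeasurableSet {p : ℝ × ℝ | p.2 ≤ p.1} := measurableSet_le measurable_snd measurable_fst
  have h1 : Integrable ({p : ℝ × ℝ | p.2 ≤ p.1}.indicator fun p => b (f p.1) (g p.2)) (μ.prod μ) :=
    hK.indicator hs
  have h2 : Integrable ({p : ℝ × ℝ | p.2 ≤ p.1}ᶜ.indicator fun p => b (f p.1) (g p.2)) (μ.prod μ) :=
    hK.indicator hs.compl
  have hgi : ∀ x, Integrable ((Iic x).indicator g) μ := fun x => hg.indicator measurableSet_Iic
  have hfi : ∀ x, Integrable ((Iio x).indicator f) μ := fun x => hf.indicator measurableSet_Iio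
  have e1 : ∀ᵐ x ∂μ, ∫ t, {p : ℝ × ℝ | p.2 ≤ p.1}.indicator (fun p => b (f p.1) (g p.2)) (x, t) ∂μ
      = b (f x) (∫ t in a..x, g t) := by
    filter_upwards [ae_restrict_mem measurableSet_Ioc] with x hx
    rw [← integral_indicator_Iic_restrict hx, ← ContinuousLinearMap.integral_comp_comm _ (hgi x)]
    refine integral_congr_ae (Eventually.of_forall fun t => ?_)
    by_cases h : t ≤ x <;> simp [indicator, h]
  have e2 : ∀ᵐ t ∂μ, ∫ x, {p : ℝ × ℝ | p.2 ≤ p.1}ᶜ.indicator (fun p => b (f p.1) (g p.2)) (x, t) ∂μ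
      = b (∫ x in a..t, f x) (g t) := by
    filter_upwards [ae_restrict_mem measurableSet_Ioc] with t ht
    rw [← integral_indicator_Iio_restrict ht, ← ContinuousLinearMap.flip_apply,
      ← ContinuousLinearMap.integral_comp_comm _ (hfi t)]
    refine integral_congr_ae (Eventually.of_forall fun x => ?_)
    by_cases h : x < t
    · simp [indicator, h, not_le.2 h]
    · simp [indicator, h, not_lt.1 h]
  refine ⟨h1.integral_prod_left.congr e1, h2.integral_prod_right.congr e2, ?_⟩
  rw [intervalIntegral.integral_of_le hac, intervalIntegral.integral_of_le hac,
    intervalIntegral.integral_of_le hac, intervalIntegral.integral_of_le hac,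
    ← integral_congr_ae e1, ← integral_congr_ae e2, ← integral_prod _ h1, ← integral_prod_symm _ h2,
    ← integral_add h1 h2]
  have e3 : ∀ p : ℝ × ℝ, {p : ℝ × ℝ | p.2 ≤ p.1}.indicator (fun p => b (f p.1) (g p.2)) p +
      {p : ℝ × ℝ | p.2 ≤ p.1}ᶜ.indicator (fun p => b (f p.1) (g p.2)) p = b (f p.1) (g p.2) :=
    fun p => indicator_self_add_compl_apply _ _ p
  simp only [e3]
  rw [integral_prod _ hK]
  simp only
  have e4 : ∀ x, ∫ y, b (f x) (g y) ∂μ = b.flip (∫ y, g y ∂μ) (f x) := fun x =>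
    ContinuousLinearMap.integral_comp_comm _ hg
  simp only [e4]
  exact ContinuousLinearMap.integral_comp_comm _ hf

/-- A vector-valued function on an interval whose weak derivative vanishes is almost everywhere
constant. -/
theorem ae_const_of_hasWeakDerivOn_zero' {a b : ℝ} (hab : a < b) {f : ℝ → E}
    (hf : HasWeakDerivOn (Ioo a b) f 0) : ∃ k : E, f =ᵐ[volume.restrict (Ioo a b)] fun _ => k := by
  obtain ⟨θ₀, hθs, hθc, hθd, hθr, hθ1⟩ := exists_contDiff_tsupport_subset (n := ⊤)
    (Ioo_mem_nhds (show a < (a + b) / 2 by linarith) (show (a + b) / 2 < b by linarith))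
  have hI : 0 < ∫ x, θ₀ x := by
    refine (hθd.continuous.integral_pos_of_hasCompactSupport_nonneg_nonzero hθc
      (fun x => (hθr ⟨x, rfl⟩).1) (x := (a + b) / 2) ?_)
    rw [hθ1]; exact one_ne_zero
  set J : ℝ := ∫ x, θ₀ x with hJ
  set θ : ℝ → ℝ := fun x => J⁻¹ * θ₀ x with hθ
  have hθint : ∫ x, θ x = 1 := by
    rw [hθ, integral_const_mul, ← hJ, inv_mul_cancel₀ hI.ne']
  have hθd' : ContDiff ℝ ∞ θ := contDiff_const.mul hθd
  have hsub : tsupport θ ⊆ tsupport θ₀ := tsupport_mul_subset_right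
  have hθc' : HasCompactSupport θ := hθc.mul_left
  have hθs' : tsupport θ ⊆ Ioo a b := hsub.trans hθs
  set k : E := ∫ x in Ioo a b, θ x • f x with hk
  refine ⟨k, ?_⟩
  have hconst : LocallyIntegrableOn (fun _ : ℝ => k) (Ioo a b) := locallyIntegrableOn_const k
  have full : ∀ (φ : ℝ → ℝ) (h : ℝ → E),
      tsupport φ ⊆ Ioo a b → ∫ x, φ x • h x = ∫ x in Ioo a b, φ x • h x := by
    intro φ h hs
    rw [setIntegral_eq_integral_of_forall_compl_eq_zero]
    intro x hx
    have : φ x = 0 := image_eq_zero_of_notMem_tsupport fun h => hx (hs h)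
    simp [this]
  have key := isOpen_Ioo.ae_eq_zero_of_integral_contDiff_smul_eq_zero (μ := volume)
    (f := fun x => f x - k) (hf.1.sub hconst) (fun φ hφ hc hs => by
      set I : ℝ := ∫ x, φ x with hIφ
      -- the mean-free function `χ` and its compactly supported primitive `ψ`
      set χ : ℝ → ℝ := fun x => φ x - I * θ x with hχ
      have hχd : ContDiff ℝ ∞ χ := hφ.sub (contDiff_const.mul hθd')
      have hφint : Integrable φ := hφ.continuous.integrable_of_hasCompactSupport hc
      have hθi : Integrable θ := hθd'.continuous.integrable_of_hasCompactSupport hθc'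
      have hχi : Integrable χ := hφint.sub (hθi.const_mul I)
      have hχint : ∫ x, χ x = 0 := by
        rw [hχ, integral_sub hφint (hθi.const_mul I), integral_const_mul, hθint]
        simp [hIφ]
      obtain ⟨p, q, hap, hpq, hqb, hsupp⟩ : ∃ p q, a < p ∧ p ≤ q ∧ q < b ∧
          ∀ x, x ∉ Icc p q → χ x = 0 := by
        have hKc : IsCompact (tsupport φ ∪ tsupport θ₀) := hc.isCompact.union hθc.isCompact
        have hKne : (tsupport φ ∪ tsupport θ₀).Nonempty :=
          ⟨(a + b) / 2, Or.inr (subset_tsupport _ (by simp [hθ1]))⟩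
        have hKs : tsupport φ ∪ tsupport θ₀ ⊆ Ioo a b := union_subset hs hθs
        refine ⟨sInf (tsupport φ ∪ tsupport θ₀), sSup (tsupport φ ∪ tsupport θ₀),
          (hKs (hKc.sInf_mem hKne)).1, ?_, (hKs (hKc.sSup_mem hKne)).2, ?_⟩
        · exact csInf_le_csSup hKne hKc.bddBelow hKc.bddAbove
        · intro x hx
          have hx' : x ∉ tsupport φ ∪ tsupport θ₀ := fun h =>
            hx ⟨csInf_le hKc.bddBelow h, le_csSup hKc.bddAbove h⟩
          have h1 : φ x = 0 := image_eq_zero_of_notMem_tsupport fun h => hx' (Or.inl h)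
          have h2 : θ₀ x = 0 := image_eq_zero_of_notMem_tsupport fun h => hx' (Or.inr h)
          simp [hχ, hθ, h1, h2]
      set ψ : ℝ → ℝ := fun x => ∫ t in a..x, χ t with hψ
      have hψ' : ∀ x, HasDerivAt ψ (χ x) x := fun x =>
        intervalIntegral.integral_hasDerivAt_right (hχi.intervalIntegrable)
          (hχd.continuous.stronglyMeasurableAtFilter _ _) hχd.continuous.continuousAt
      have hψd' : deriv ψ = χ := funext fun x => (hψ' x).deriv
      have hψd : ContDiff ℝ ∞ ψ := by
        rw [contDiff_infty_iff_deriv, hψd']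
        exact ⟨fun x => (hψ' x).differentiableAt, hχd⟩
      have hψz : ∀ x, x ∉ Icc p q → ψ x = 0 := by
        intro x hx
        rcases lt_or_ge x p with hxp | hxp
        · apply intervalIntegral.integral_zero_ae
          refine Eventually.of_forall fun t ht => hsupp t fun h => ?_
          have : t ≤ max a x := ht.2
          rcases le_max_iff.1 this with h' | h' <;> linarith [h.1]
        · have hqx : q < x := by
            by_contra h
            exact hx ⟨hxp, not_lt.1 h⟩
          have hax : a ≤ x := by linarith
          have : ψ x = ∫ t, χ t := by
            rw [hψ]
            simp only
            rw [intervalIntegral.integral_of_le hax]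
            apply setIntegral_eq_integral_of_forall_compl_eq_zero
            intro t ht
            refine hsupp t fun h => ht ⟨by linarith [h.1], by linarith [h.2]⟩
          rw [this, hχint]
      have hψts : tsupport ψ ⊆ Icc p q := by
        refine closure_minimal (fun x hx => ?_) isClosed_Icc
        by_contra h
        exact hx (hψz x h)
      have hψc : HasCompactSupport ψ := isCompact_Icc.of_isClosed_subset (isClosed_tsupport _) hψts
      have hψΩ : tsupport ψ ⊆ Ioo a b := fun x hx =>
        ⟨by linarith [(hψts hx).1], by linarith [(hψts hx).2]⟩
      -- Testing the vanishing weak derivative with $\psi$ gives $\int\chi f=0$, that is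
      -- $\int\varphi f=I\,k=\int\varphi\,k$ for the $\theta$-weighted mean $k$ of $f$.
      have e := hf.3 ψ hψd hψc hψΩ
      rw [hψd'] at e
      simp only [Pi.zero_apply, smul_zero, integral_zero, neg_zero] at e
      have i1 := integrableOn_smul_of_tsupport hφ.continuous hc hs hf.1
      have i2 := integrableOn_smul_of_tsupport hθd'.continuous hθc' hθs' hf.1
      have i3 := integrableOn_smul_of_tsupport hφ.continuous hc hs hconst
      have e2 : ∫ x in Ioo a b, χ x • f x = (∫ x in Ioo a b, φ x • f x) - I • k := by
        have i2' : IntegrableOn (fun x => I • θ x • f x) (Ioo a b) := i2.smul I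
        rw [hk, ← integral_smul, ← integral_sub i1 i2']
        congr 1
        ext x
        simp only [hχ, sub_smul, mul_smul]
      have e3 : ∫ x in Ioo a b, φ x • k = I • k := by
        rw [← full φ (fun _ => k) hs, integral_smul_const]
      rw [full φ _ hs]
      simp only [smul_sub]
      rw [integral_sub i1 i3, e3, ← e2, e])
  rw [EventuallyEq, ae_restrict_iff' measurableSet_Ioo]
  filter_upwards [key] with x hx hxΩ
  exact sub_eq_zero.1 (hx hxΩ)

/-- The primitive of an integrable function has that function as its weak derivative. -/
theorem hasWeakDerivOn_primitive' {a b : ℝ} (hab : a ≤ b) {g : ℝ → E}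
    (hg : IntegrableOn g (Ioc a b)) :
    HasWeakDerivOn (Ioo a b) (fun x => ∫ t in a..x, g t) g := by
  have hgi : IntervalIntegrable g volume a b :=
    (intervalIntegrable_iff_integrableOn_Ioc_of_le hab).2 hg
  have hcont : ContinuousOn (fun x => ∫ t in a..x, g t) (Icc a b) := by
    have := intervalIntegral.continuousOn_primitive_interval' hgi left_mem_uIcc
    rwa [uIcc_of_le hab] at this
  refine ⟨(hcont.mono Ioo_subset_Icc_self).locallyIntegrableOn measurableSet_Ioo,
    (hg.mono_set Ioo_subset_Ioc_self).locallyIntegrableOn, fun φ hφ hc hs => ?_⟩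
  have ha : φ a = 0 := image_eq_zero_of_notMem_tsupport fun h => lt_irrefl _ (hs h).1
  have hb : φ b = 0 := image_eq_zero_of_notMem_tsupport fun h => lt_irrefl _ (hs h).2
  have hφ' : Continuous (deriv φ) := hφ.continuous_deriv (by simp)
  have hint : ∀ x, ∫ t in a..x, deriv φ t = φ x := fun x => by
    rw [intervalIntegral.integral_deriv_eq_sub (fun t _ => (hφ.differentiable (by simp)) t)
      (hφ'.intervalIntegrable _ _), ha, sub_zero]
  -- The test function is the primitive of its derivative and vanishes at $b$, so the boundary term
  -- disappears.
  have key := (integral_bilin_primitive (ContinuousLinearMap.lsmul ℝ ℝ : ℝ →L[ℝ] E →L[ℝ] E) hab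
    (hφ'.integrableOn_Ioc) hg).2.2
  simp only [ContinuousLinearMap.lsmul_apply, hint, hb, zero_smul] at key
  rw [← integral_Ioc_eq_integral_Ioo, ← integral_Ioc_eq_integral_Ioo,
    ← intervalIntegral.integral_of_le hab, ← intervalIntegral.integral_of_le hab]
  exact eq_neg_of_add_eq_zero_left key

omit [CompleteSpace E] in
theorem HasWeakDerivOn.mono {Ω Ω' : Set ℝ} {f g : ℝ → E} (h : HasWeakDerivOn Ω f g) (hs : Ω' ⊆ Ω) :
    HasWeakDerivOn Ω' f g := by
  refine ⟨h.1.mono_set hs, h.2.mono_set hs, fun φ hφ hc hsupp => ?_⟩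
  have full : ∀ (Ω'' : Set ℝ) (ψ : ℝ → ℝ) (k : ℝ → E), tsupport ψ ⊆ Ω'' →
      ∫ x in Ω'', ψ x • k x = ∫ x, ψ x • k x := by
    intro Ω'' ψ k hψ
    refine setIntegral_eq_integral_of_forall_compl_eq_zero fun x hx => ?_
    have : ψ x = 0 := image_eq_zero_of_notMem_tsupport fun h => hx (hψ h)
    simp [this]
  have := h.3 φ hφ hc (hsupp.trans hs)
  rw [full _ _ _ (tsupport_deriv_subset'.trans (hsupp.trans hs)), full _ _ _ (hsupp.trans hs)]
    at this
  rw [full _ _ _ (tsupport_deriv_subset'.trans hsupp), full _ _ _ hsupp, this]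

/-- A function with an integrable weak derivative is, up to a constant, the primitive of it. -/
theorem HasWeakDerivOn.ae_eq_primitive_add {a b : ℝ} (hab : a < b) {f g : ℝ → E}
    (h : HasWeakDerivOn (Ioo a b) f g) (hg : IntegrableOn g (Ioc a b)) :
    ∃ k : E, f =ᵐ[volume.restrict (Ioo a b)] fun x => (∫ t in a..x, g t) + k := by
  have hp := hasWeakDerivOn_primitive' hab.le hg
  have hp' : HasWeakDerivOn (Ioo a b) (fun x => - ∫ t in a..x, g t) (fun x => - g x) := by
    refine ⟨hp.1.neg, hp.2.neg, fun φ hφ hc hs => ?_⟩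
    have := hp.3 φ hφ hc hs
    simp only [smul_neg, integral_neg, this]
  have hd : HasWeakDerivOn (Ioo a b) (fun x => f x - ∫ t in a..x, g t) 0 := by
    refine (HasWeakDerivOn.add h hp').congr (Eventually.of_forall fun x => ?_)
      (Eventually.of_forall fun x => ?_)
    · simp [sub_eq_add_neg]
    · simp
  obtain ⟨k, hk⟩ := ae_const_of_hasWeakDerivOn_zero' hab hd
  refine ⟨k, hk.mono fun x hx => ?_⟩
  simp only at hx
  simp only [← hx, add_sub_cancel]

end Bilinear

/-! ### Integration by parts in `L²(0, L)` -/

section L2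

variable {L : ℝ}

theorem L2.intervalIntegral_eq (hL : 0 ≤ L) (f : ℝ → ℂ) :
    ∫ t in (0 : ℝ)..L, f t = ∫ t in Ioo 0 L, f t := by
  rw [intervalIntegral.integral_of_le hL, integral_Ioc_eq_integral_Ioo]

theorem exists_primitive_add_of_mem_H1 (hL : 0 < L) {f : L2 L} (hf : f ∈ H1 L) :
    ∃ k : ℂ, f =ᵐ[volume.restrict (Ioo 0 L)]
      fun x => (∫ t in (0 : ℝ)..x, (weakDeriv f : L2 L) t) + k :=
  HasWeakDerivOn.ae_eq_primitive_add hL (isWeakDeriv_weakDeriv hf)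
    ((integrableOn_Ioc_iff_integrableOn_Ioo).2 (L2.integrableOn _))

/-- Two continuous representatives agree on the closed interval, so a trace may be read off any of
them. -/
theorem HasTrace.eq_of_ae_eq (hL : 0 < L) {f : L2 L} {x₀ : ℝ} (hx : x₀ ∈ Icc 0 L) {a : ℂ}
    (h : HasTrace f x₀ a) {f' : ℝ → ℂ} (hc : ContinuousOn f' (Icc 0 L))
    (he : f =ᵐ[volume.restrict (Ioo 0 L)] f') : f' x₀ = a := by
  obtain ⟨f'', hc', he', h0⟩ := h
  rw [← h0]
  exact Measure.eqOn_Icc_of_ae_eq volume hL.ne (ae_Icc_of_ae_Ioo (he.symm.trans he')) hc hc' hx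

/-- Integration by parts: `⟨g, f_x⟩ = -⟨g_x, f⟩` if the boundary terms vanish. -/
theorem inner_weakDeriv_of_trace (hL : 0 < L) {f g : L2 L} (hf : f ∈ H1 L) (hg : g ∈ H1 L)
    (h0 : HasTrace f 0 0 ∨ HasTrace g 0 0) (h1 : HasTrace f L 0 ∨ HasTrace g L 0) :
    inner ℂ g (weakDeriv f) = - inner ℂ (weakDeriv g) f := by
  obtain ⟨k, hk⟩ := exists_primitive_add_of_mem_H1 hL hf
  obtain ⟨l, hl⟩ := exists_primitive_add_of_mem_H1 hL hg
  set f' : L2 L := weakDeriv f with hf'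
  set g' : L2 L := weakDeriv g with hg'
  have hfi : IntegrableOn f' (Ioc 0 L) :=
    (integrableOn_Ioc_iff_integrableOn_Ioo).2 (L2.integrableOn _)
  have hgi : IntegrableOn g' (Ioc 0 L) :=
    (integrableOn_Ioc_iff_integrableOn_Ioo).2 (L2.integrableOn _)
  have hci : IntegrableOn (fun x => conj (g' x)) (Ioc 0 L) :=
    (Complex.conjCLE : ℂ →L[ℝ] ℂ).integrable_comp hgi
  have hconj : ∀ x, ∫ t in (0 : ℝ)..x, conj (g' t) = conj (∫ t in (0 : ℝ)..x, g' t) := fun x => by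
    simp only [intervalIntegral, integral_conj, map_sub]
  obtain ⟨i1, i2, key⟩ := integral_bilin_primitive (ContinuousLinearMap.mul ℝ ℂ) hL.le hfi hci
  simp only [ContinuousLinearMap.mul_apply', hconj] at i1 i2 key
  have tf : ∀ x ∈ Icc 0 L, ∀ a, HasTrace f x a → (∫ t in (0 : ℝ)..x, f' t) + k = a :=
    fun x hx a h => h.eq_of_ae_eq hL hx ((continuousOn_primitive_L2 hL.le _).add continuousOn_const) hk
  have tg : ∀ x ∈ Icc 0 L, ∀ a, HasTrace g x a → (∫ t in (0 : ℝ)..x, g' t) + l = a :=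
    fun x hx a h => h.eq_of_ae_eq hL hx ((continuousOn_primitive_L2 hL.le _).add continuousOn_const) hl
  set If : ℂ := ∫ t in (0 : ℝ)..L, f' t with hIf
  set Ig : ℂ := ∫ t in (0 : ℝ)..L, g' t with hIg
  -- The representatives are primitives plus the constants $k=f(0)$ and $l=g(0)$. In each boundary
  -- product $f\bar g$ only one factor has to vanish.
  have c0 : k * conj l = 0 := by
    rcases h0 with h | h
    · have := tf 0 (left_mem_Icc.2 hL.le) _ h
      rw [intervalIntegral.integral_same, zero_add] at this
      simp [this]
    · have := tg 0 (left_mem_Icc.2 hL.le) _ h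
      rw [intervalIntegral.integral_same, zero_add] at this
      simp [this]
  have c1 : (If + k) * conj (Ig + l) = 0 := by
    rcases h1 with h | h
    · rw [show If + k = 0 from tf L (right_mem_Icc.2 hL.le) _ h, zero_mul]
    · rw [show Ig + l = 0 from tg L (right_mem_Icc.2 hL.le) _ h, map_zero, mul_zero]
  have e1 : inner ℂ g f' = (∫ x in (0 : ℝ)..L, f' x * conj (∫ t in (0 : ℝ)..x, g' t)) +
      If * conj l := by
    rw [L2.inner_def, hIf, ← intervalIntegral.integral_mul_const, ← intervalIntegral.integral_add
      ((intervalIntegrable_iff_integrableOn_Ioc_of_le hL.le).2 i1)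
      (((intervalIntegrable_iff_integrableOn_Ioc_of_le hL.le).2 hfi).mul_const _),
      L2.intervalIntegral_eq hL.le]
    refine integral_congr_ae (hl.mono fun x hx => ?_)
    simp only [hx, RCLike.inner_apply, map_add]
    ring
  have e2 : inner ℂ g' f = (∫ x in (0 : ℝ)..L, (∫ t in (0 : ℝ)..x, f' t) * conj (g' x)) +
      k * conj Ig := by
    rw [L2.inner_def, hIg, ← hconj, ← intervalIntegral.integral_const_mul,
      ← intervalIntegral.integral_add
      ((intervalIntegrable_iff_integrableOn_Ioc_of_le hL.le).2 i2)
      (((intervalIntegrable_iff_integrableOn_Ioc_of_le hL.le).2 hci).const_mul _),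
      L2.intervalIntegral_eq hL.le]
    refine integral_congr_ae (hk.mono fun x hx => ?_)
    simp only [hx, RCLike.inner_apply]
    ring
  rw [map_add] at c1
  rw [e1, e2]
  linear_combination key + c1 - c0

end L2

/-! ### Weighted inequalities for the memory kernel -/

/-- The set of all `s > 0` with `σ(s) > 0`. -/
def kernelSupport (σ : ℝ → ℝ) : Set ℝ := {s | 0 < s ∧ 0 < σ s}

namespace MemoryKernel

variable {σ : ℝ → ℝ}

theorem hasDerivAt (hσ : MemoryKernel σ) {s : ℝ} (hs : 0 < s) : HasDerivAt σ (deriv σ s) s :=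
  ((hσ.contDiffOn.differentiableOn one_ne_zero).differentiableAt (Ioi_mem_nhds hs)).hasDerivAt

/-- From $\sigma'\le-d\sigma\le0$. -/
theorem antitoneOn (hσ : MemoryKernel σ) : AntitoneOn σ (Ioi 0) := by
  obtain ⟨d, hd, h⟩ := hσ.dafermos
  refine antitoneOn_of_deriv_nonpos (convex_Ioi 0) hσ.contDiffOn.continuousOn
    ((hσ.contDiffOn.differentiableOn one_ne_zero).mono interior_subset) fun s hs => ?_
  rw [interior_Ioi] at hs
  have := h s hs
  have := mul_nonneg hd.le (hσ.nonneg s hs)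
  linarith

/-- By monotonicity the positivity set of $\sigma$ is an interval starting at $0$, possibly bounded:
a kernel that reaches $0$ stays there. -/
theorem mem_support_of_le (hσ : MemoryKernel σ) {s t : ℝ} (hs : s ∈ kernelSupport σ) (ht : 0 < t)
    (hts : t ≤ s) : t ∈ kernelSupport σ :=
  ⟨ht, hs.2.trans_le (hσ.antitoneOn ht hs.1 hts)⟩

theorem Ioc_subset_support (hσ : MemoryKernel σ) {T : ℝ} (hT : T ∈ kernelSupport σ) :
    Ioc 0 T ⊆ kernelSupport σ := fun _ ht => hσ.mem_support_of_le hT ht.1 ht.2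

theorem isOpen_support (hσ : MemoryKernel σ) : IsOpen (kernelSupport σ) :=
  hσ.contDiffOn.continuousOn.isOpen_inter_preimage isOpen_Ioi isOpen_Ioi

theorem support_nonempty (hσ : MemoryKernel σ) : (kernelSupport σ).Nonempty := by
  by_contra h
  rw [not_nonempty_iff_eq_empty] at h
  have h0 : ∫ s in Ioi 0, σ s = 0 := by
    refine setIntegral_eq_zero_of_forall_eq_zero fun s hs => ?_
    refine le_antisymm (not_lt.1 fun hlt => ?_) (hσ.nonneg s hs)
    have : s ∈ kernelSupport σ := ⟨hs, hlt⟩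
    rw [h] at this
    exact this
  exact hσ.integral_pos.ne' h0

theorem exists_bound (hσ : MemoryKernel σ) : ∃ C, ∀ s, 0 < s → σ s ≤ C := by
  obtain ⟨σ₀, h⟩ := hσ.limit_zero
  refine ⟨σ₀, fun s hs => ge_of_tendsto h ?_⟩
  filter_upwards [Ioo_mem_nhdsGT hs] with t ht
  exact hσ.antitoneOn ht.1 hs ht.2.le

/-- The support is exhausted by intervals $(0,T_n]$ with $\sigma(T_n)>0$. Taking running maxima of
an enumeration of its rational points treats bounded and unbounded supports alike. -/
theorem exists_seq (hσ : MemoryKernel σ) : ∃ T : ℕ → ℝ, (∀ n, T n ∈ kernelSupport σ) ∧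
    AECover (volume.restrict (kernelSupport σ)) atTop fun n => Ioc 0 (T n) := by
  have hrat : ∀ s ∈ kernelSupport σ, ∃ q : ℚ, (q : ℝ) ∈ kernelSupport σ ∧ s < q := by
    intro s hs
    have h1 : kernelSupport σ ∈ 𝓝[>] s := mem_nhdsWithin_of_mem_nhds (hσ.isOpen_support.mem_nhds hs)
    obtain ⟨u, hu, hsub⟩ := (mem_nhdsGT_iff_exists_Ioo_subset).1 h1
    obtain ⟨q, hq1, hq2⟩ := exists_rat_btwn (mem_Ioi.1 hu)
    exact ⟨q, hsub ⟨hq1, hq2⟩, hq1⟩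
  obtain ⟨s₀, hs₀⟩ := hσ.support_nonempty
  obtain ⟨q₀, hq₀, -⟩ := hrat s₀ hs₀
  obtain ⟨f, hf⟩ := (to_countable {q : ℚ | (q : ℝ) ∈ kernelSupport σ}).exists_eq_range ⟨q₀, hq₀⟩
  have hfm : ∀ n, (f n : ℝ) ∈ kernelSupport σ := fun n => by
    have : f n ∈ {q : ℚ | (q : ℝ) ∈ kernelSupport σ} := by rw [hf]; exact ⟨n, rfl⟩
    exact this
  refine ⟨partialSups fun n => (f n : ℝ), fun n => ?_, ?_, fun n => measurableSet_Ioc⟩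
  · induction n with
    | zero => simpa using hfm 0
    | succ n ih =>
      rw [partialSups_add_one]
      rcases max_choice (partialSups (fun n => (f n : ℝ)) n) (f (n + 1) : ℝ) with h | h
      · exact h.symm ▸ ih
      · exact h.symm ▸ hfm (n + 1)
  · filter_upwards [ae_restrict_mem hσ.isOpen_support.measurableSet] with s hs
    obtain ⟨q, hq, hsq⟩ := hrat s hs
    have : q ∈ range f := by rw [← hf]; exact hq
    obtain ⟨n, rfl⟩ := this
    filter_upwards [eventually_ge_atTop n] with k hk
    exact ⟨hs.1, hsq.le.trans (le_partialSups_of_le (fun n => (f n : ℝ)) hk)⟩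

theorem integrableOn_mul (hσ : MemoryKernel σ) {T : ℝ} {ψ : ℝ → ℝ} (hψ : IntegrableOn ψ (Ioc 0 T)) :
    IntegrableOn (fun s => σ s * ψ s) (Ioc 0 T) := by
  obtain ⟨C, hC⟩ := hσ.exists_bound
  refine Integrable.bdd_mul (c := C) hψ ?_ ?_
  · exact (hσ.contDiffOn.continuousOn.mono fun s hs => hs.1).aestronglyMeasurable measurableSet_Ioc
  · filter_upwards [ae_restrict_mem measurableSet_Ioc] with s hs
    rw [Real.norm_of_nonneg (hσ.nonneg s hs.1)]
    exact hC s hs.1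

/-- Integration by parts against the kernel: if the primitive `Φ` of `ψ` is nonnegative, then
`d ∫ σ Φ ≤ ∫ σ ψ`. -/
theorem mul_integral_primitive_le (hσ : MemoryKernel σ) {d : ℝ}
    (hd : ∀ s, 0 < s → deriv σ s ≤ -d * σ s) {T : ℝ} (hT : 0 < T) {ψ : ℝ → ℝ}
    (hψ : IntegrableOn ψ (Ioc 0 T)) (hpos : ∀ s ∈ Icc 0 T, 0 ≤ ∫ t in (0 : ℝ)..s, ψ t) :
    d * ∫ s in (0 : ℝ)..T, σ s * ∫ t in (0 : ℝ)..s, ψ t ≤ ∫ s in (0 : ℝ)..T, σ s * ψ s := by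
  set Φ : ℝ → ℝ := fun s => ∫ t in (0 : ℝ)..s, ψ t with hΦ
  have hψi : IntervalIntegrable ψ volume 0 T :=
    (intervalIntegrable_iff_integrableOn_Ioc_of_le hT.le).2 hψ
  have hΦac : AbsolutelyContinuousOnInterval Φ 0 T :=
    hψi.absolutelyContinuousOnInterval_intervalIntegral left_mem_uIcc
  have hΦc : ContinuousOn Φ (Icc 0 T) := by
    have := hΦac.continuousOn
    rwa [uIcc_of_le hT.le] at this
  have hσψ : IntervalIntegrable (fun s => σ s * ψ s) volume 0 T :=
    (intervalIntegrable_iff_integrableOn_Ioc_of_le hT.le).2 (hσ.integrableOn_mul hψ)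
  have hσΦ : IntervalIntegrable (fun s => σ s * Φ s) volume 0 T :=
    (intervalIntegrable_iff_integrableOn_Ioc_of_le hT.le).2 (hσ.integrableOn_mul
      (hΦc.integrableOn_Icc.mono_set Ioc_subset_Icc_self))
  -- Smoothness of $\sigma$ is known only on $(0,\infty)$, so the integration by parts is done on
  -- $[\varepsilon,T]$. The boundary term at $T$ is nonnegative and is dropped; the one at
  -- $\varepsilon$ tends to $0$ since $\sigma$ has a finite limit at $0$ and $\Phi(0)=0$.
  have key : ∀ ε, 0 < ε → ε ≤ T → d * (∫ s in ε..T, σ s * Φ s) - σ ε * Φ ε ≤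
      ∫ s in ε..T, σ s * ψ s := by
    intro ε hε hεT
    have hsub : uIcc ε T ⊆ uIcc 0 T := by
      rw [uIcc_of_le hεT, uIcc_of_le hT.le]; exact Icc_subset_Icc_left hε.le
    have hpos' : ∀ s ∈ uIcc ε T, 0 < s := fun s hs => by
      rw [uIcc_of_le hεT] at hs; exact hε.trans_le hs.1
    have hσac : AbsolutelyContinuousOnInterval σ ε T :=
      (hσ.contDiffOn.mono hpos').absolutelyContinuousOnInterval
    have ibp := hσac.integral_mul_deriv_eq_deriv_mul (hΦac.mono hsub)
    have e1 : ∫ s in ε..T, σ s * deriv Φ s = ∫ s in ε..T, σ s * ψ s := by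
      apply intervalIntegral.integral_congr_ae
      filter_upwards [hψi.ae_hasDerivAt_integral] with s hs hs'
      rw [(hs (hsub (uIoc_subset_uIcc hs')) 0 left_mem_uIcc).deriv]
    have hdc : ContinuousOn (deriv σ) (uIcc ε T) :=
      (hσ.contDiffOn.continuousOn_deriv_of_isOpen isOpen_Ioi le_rfl).mono hpos'
    have h1 : ∫ s in ε..T, deriv σ s * Φ s ≤ ∫ s in ε..T, -d * (σ s * Φ s) := by
      refine intervalIntegral.integral_mono_on hεT ?_ ?_ fun s hs => ?_
      · exact (hdc.mul ((hΦac.mono hsub).continuousOn)).intervalIntegrable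
      · exact (hσΦ.mono_set hsub).const_mul _
      · have hs0 : 0 < s := hε.trans_le hs.1
        have := mul_le_mul_of_nonneg_right (hd s hs0) (hpos s ⟨hs0.le, hs.2⟩)
        linarith
    rw [intervalIntegral.integral_const_mul] at h1
    have h2 : 0 ≤ σ T * Φ T := mul_nonneg (hσ.nonneg T hT) (hpos T (right_mem_Icc.2 hT.le))
    rw [e1] at ibp
    rw [ibp]
    linarith
  have lim : ∀ f : ℝ → ℝ, IntervalIntegrable f volume 0 T →
      Tendsto (fun ε => ∫ s in ε..T, f s) (𝓝[>] 0) (𝓝 (∫ s in (0 : ℝ)..T, f s)) := by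
    intro f hf
    have hc := intervalIntegral.continuousOn_primitive_interval' hf left_mem_uIcc
    have h1 : Tendsto (fun ε => ∫ s in (0 : ℝ)..ε, f s) (𝓝[>] 0) (𝓝 0) := by
      have := hc 0 left_mem_uIcc
      rw [uIcc_of_le hT.le] at this
      have h2 := this.tendsto.mono_left
        (nhdsWithin_le_of_mem (s := Icc 0 T) (t := Ioi 0) (Icc_mem_nhdsGT hT))
      simpa using h2
    have h3 := h1.const_sub (∫ s in (0 : ℝ)..T, f s)
    rw [sub_zero] at h3
    refine h3.congr' ?_
    filter_upwards [Ioo_mem_nhdsGT hT] with ε hε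
    have hsub : uIcc 0 ε ⊆ uIcc 0 T := by
      rw [uIcc_of_le hε.1.le, uIcc_of_le hT.le]; exact Icc_subset_Icc_right hε.2.le
    rw [← intervalIntegral.integral_interval_sub_left hf (hf.mono_set hsub)]
  obtain ⟨σ₀, hσ₀⟩ := hσ.limit_zero
  have hΦ0 : Tendsto Φ (𝓝[>] 0) (𝓝 0) := by
    have h2 := (hΦc 0 (left_mem_Icc.2 hT.le)).tendsto.mono_left
      (nhdsWithin_le_of_mem (s := Icc 0 T) (t := Ioi 0) (Icc_mem_nhdsGT hT))
    simpa [hΦ] using h2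
  have l1 := ((lim _ hσΦ).const_mul d).sub (hσ₀.mul hΦ0)
  rw [mul_zero, sub_zero] at l1
  refine le_of_tendsto_of_tendsto l1 (lim _ hσψ) ?_
  filter_upwards [Ioo_mem_nhdsGT hT] with ε hε
  exact key ε hε.1 hε.2.le

/-! ### Hardy-type estimates for primitives of Hilbert-space valued functions. -/

section Hilbert

variable {E : Type*} [NormedAddCommGroup E] [InnerProductSpace ℝ E] [CompleteSpace E] {g : ℝ → E}

/-- With $G$ the primitive of $g$, this is $\frac{d}{ds}\|G\|^2=2\langle G,g\rangle$ in integrated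
form. Integration by parts with the inner product as bilinear map avoids differentiating $G$. -/
theorem integral_inner_primitive {T : ℝ} (hT : 0 ≤ T) (hg : IntegrableOn g (Ioc 0 T)) :
    IntegrableOn (fun s => 2 * inner ℝ (∫ t in (0 : ℝ)..s, g t) (g s)) (Ioc 0 T) ∧
    ∫ s in (0 : ℝ)..T, 2 * inner ℝ (∫ t in (0 : ℝ)..s, g t) (g s) =
      ‖∫ t in (0 : ℝ)..T, g t‖ ^ 2 := by
  obtain ⟨h1, h2, h3⟩ := integral_bilin_primitive (innerSL ℝ : E →L[ℝ] E →L[ℝ] ℝ) hT hg hg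
  change IntegrableOn (fun s => inner ℝ (g s) (∫ t in (0 : ℝ)..s, g t)) (Ioc 0 T) at h1
  change IntegrableOn (fun s => inner ℝ (∫ t in (0 : ℝ)..s, g t) (g s)) (Ioc 0 T) at h2
  change (∫ s in (0 : ℝ)..T, inner ℝ (g s) (∫ t in (0 : ℝ)..s, g t)) +
    ∫ s in (0 : ℝ)..T, inner ℝ (∫ t in (0 : ℝ)..s, g t) (g s) =
      inner ℝ (∫ t in (0 : ℝ)..T, g t) (∫ t in (0 : ℝ)..T, g t) at h3
  have e : ∀ s, 2 * inner ℝ (∫ t in (0 : ℝ)..s, g t) (g s) = inner ℝ (g s) (∫ t in (0 : ℝ)..s, g t)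
      + inner ℝ (∫ t in (0 : ℝ)..s, g t) (g s) := fun s => by
    rw [real_inner_comm]; ring
  simp only [e]
  refine ⟨h1.add h2, ?_⟩
  rw [intervalIntegral.integral_add ((intervalIntegrable_iff_integrableOn_Ioc_of_le hT).2 h1)
    ((intervalIntegrable_iff_integrableOn_Ioc_of_le hT).2 h2), h3, real_inner_self_eq_norm_sq]

theorem mul_integral_norm_sq_le (hσ : MemoryKernel σ) {d : ℝ}
    (hd : ∀ s, 0 < s → deriv σ s ≤ -d * σ s) {T : ℝ} (hT : 0 < T) (hg : IntegrableOn g (Ioc 0 T)) :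
    d * ∫ s in (0 : ℝ)..T, σ s * ‖∫ t in (0 : ℝ)..s, g t‖ ^ 2 ≤
      ∫ s in (0 : ℝ)..T, σ s * (2 * inner ℝ (∫ t in (0 : ℝ)..s, g t) (g s)) := by
  have hsub : ∀ s ∈ Icc 0 T, ∫ r in (0 : ℝ)..s, 2 * inner ℝ (∫ t in (0 : ℝ)..r, g t) (g r) =
      ‖∫ t in (0 : ℝ)..s, g t‖ ^ 2 := fun s hs =>
    (integral_inner_primitive hs.1 (hg.mono_set (Ioc_subset_Ioc_right hs.2))).2
  have := hσ.mul_integral_primitive_le hd hT (integral_inner_primitive hT.le hg).1 fun s hs => by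
    rw [hsub s hs]; positivity
  refine le_of_eq_of_le ?_ this
  congr 1
  refine intervalIntegral.integral_congr fun s hs => ?_
  rw [uIcc_of_le hT.le] at hs
  simp only [hsub s hs]

/-- On each $(0,T_n]$ the integral is bounded below by $\frac d2\int\sigma\|G\|^2\ge0$, and
integrability allows passing to the whole support. This is the dissipativity of $-\partial_s$ in
$W$. -/
theorem integral_inner_primitive_nonneg (hσ : MemoryKernel σ)
    (hg : ∀ T ∈ kernelSupport σ, IntegrableOn g (Ioc 0 T))
    (hi : IntegrableOn (fun s => σ s * inner ℝ (∫ t in (0 : ℝ)..s, g t) (g s)) (kernelSupport σ)) :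
    0 ≤ ∫ s in kernelSupport σ, σ s * inner ℝ (∫ t in (0 : ℝ)..s, g t) (g s) := by
  obtain ⟨T, hT, hcov⟩ := hσ.exists_seq
  obtain ⟨d, hd0, hd⟩ := hσ.dafermos
  refine ge_of_tendsto' (hcov.integral_tendsto_of_countably_generated hi) fun n => ?_
  have hTn := hT n
  rw [Measure.restrict_restrict measurableSet_Ioc,
    inter_eq_self_of_subset_left (hσ.Ioc_subset_support hTn),
    ← intervalIntegral.integral_of_le hTn.1.le]
  have h1 := hσ.mul_integral_norm_sq_le hd hTn.1 (hg _ hTn)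
  have h2 : 0 ≤ ∫ s in (0 : ℝ)..T n, σ s * ‖∫ t in (0 : ℝ)..s, g t‖ ^ 2 := by
    refine intervalIntegral.integral_nonneg_of_ae_restrict hTn.1.le ?_
    -- The endpoint $s=0$ is discarded, as nothing is assumed about the value `σ 0`.
    filter_upwards [ae_restrict_of_ae_restrict_of_subset Subset.rfl
      (ae_restrict_mem measurableSet_Icc), (Measure.ae_ne (volume.restrict _) 0)] with s hs hs0
    exact mul_nonneg (hσ.nonneg s (lt_of_le_of_ne hs.1 (Ne.symm hs0))) (by positivity)
  have h3 := mul_nonneg hd0.le h2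
  have e : ∀ s, σ s * (2 * inner ℝ (∫ t in (0 : ℝ)..s, g t) (g s)) =
      2 * (σ s * inner ℝ (∫ t in (0 : ℝ)..s, g t) (g s)) := fun s => by ring
  simp only [e, intervalIntegral.integral_const_mul] at h1
  linarith

omit [InnerProductSpace ℝ E] [CompleteSpace E] in
-- Monotonicity gives $\sigma\ge\sigma(T)>0$ on $(0,T]$, so the weight can be removed there; on a
-- bounded interval square integrability implies integrability.
theorem integrableOn_of_sq (hσ : MemoryKernel σ)
    (hm : AEStronglyMeasurable g (volume.restrict (kernelSupport σ)))
    (hi : IntegrableOn (fun s => σ s * ‖g s‖ ^ 2) (kernelSupport σ)) {T : ℝ}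
    (hT : T ∈ kernelSupport σ) :
    IntegrableOn (fun s => ‖g s‖ ^ 2) (Ioc 0 T) ∧ IntegrableOn g (Ioc 0 T) := by
  have hm' := hm.mono_measure (Measure.restrict_mono_set volume (hσ.Ioc_subset_support hT))
  have h1 : IntegrableOn (fun s => ‖g s‖ ^ 2) (Ioc 0 T) := by
    refine Integrable.mono' ((hi.mono_set (hσ.Ioc_subset_support hT)).const_mul (σ T)⁻¹)
      (hm'.norm.pow 2) ?_
    filter_upwards [ae_restrict_mem measurableSet_Ioc] with s hs
    rw [Real.norm_of_nonneg (by positivity), inv_mul_eq_div, le_div_iff₀ hT.2, mul_comm]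
    exact mul_le_mul_of_nonneg_right (hσ.antitoneOn hs.1 hT.1 hs.2) (by positivity)
  refine ⟨h1, ?_⟩
  have hc : IntegrableOn (fun _ => (1 : ℝ)) (Ioc 0 T) := integrableOn_const (by simp)
  refine Integrable.mono' (hc.add h1) hm' (Eventually.of_forall fun s => ?_)
  simp only [Pi.add_apply]
  nlinarith [sq_nonneg (‖g s‖ - 1), norm_nonneg (g s)]

/-- The weighted Hardy inequality for the kernel `σ`. -/
theorem integrableOn_norm_sq_primitive (hσ : MemoryKernel σ)
    (hm : AEStronglyMeasurable g (volume.restrict (kernelSupport σ)))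
    (hi : IntegrableOn (fun s => σ s * ‖g s‖ ^ 2) (kernelSupport σ)) :
    IntegrableOn (fun s => σ s * ‖∫ t in (0 : ℝ)..s, g t‖ ^ 2) (kernelSupport σ) := by
  obtain ⟨T, hT, hcov⟩ := hσ.exists_seq
  obtain ⟨d, hd0, hd⟩ := hσ.dafermos
  have hIoc : ∀ n, Ioc 0 (T n) ∩ kernelSupport σ = Ioc 0 (T n) := fun n =>
    inter_eq_self_of_subset_left (hσ.Ioc_subset_support (hT n))
  have hg := fun n => hσ.integrableOn_of_sq hm hi (hT n)
  have hGc : ∀ n, ContinuousOn (fun s => ∫ t in (0 : ℝ)..s, g t) (Icc 0 (T n)) := fun n => by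
    have := intervalIntegral.continuousOn_primitive_interval'
      ((intervalIntegrable_iff_integrableOn_Ioc_of_le (hT n).1.le).2 (hg n).2) left_mem_uIcc
    rwa [uIcc_of_le (hT n).1.le] at this
  have hG : ∀ n, IntegrableOn (fun s => σ s * ‖∫ t in (0 : ℝ)..s, g t‖ ^ 2) (Ioc 0 (T n)) :=
    fun n => hσ.integrableOn_mul
      ((((hGc n).norm.pow 2).integrableOn_Icc).mono_set Ioc_subset_Icc_self)
  -- A bound independent of $n$ suffices. With $I=\int\sigma\|G\|^2$ and $J=\int\sigma\|g\|^2$ on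
  -- $(0,T_n]$, Young's inequality gives $dI\le\frac d2I+\frac2dJ$. Since $I$ is finite there it can
  -- be absorbed, which leaves $I\le\frac4{d^2}J$.
  refine hcov.integrable_of_integral_norm_bounded
    (4 / d ^ 2 * ∫ s in kernelSupport σ, σ s * ‖g s‖ ^ 2) (fun n => ?_)
    (Eventually.of_forall fun n => ?_)
  · rw [IntegrableOn, Measure.restrict_restrict measurableSet_Ioc, hIoc]
    exact hG n
  · rw [Measure.restrict_restrict measurableSet_Ioc, hIoc]
    have hTn := (hT n).1
    have h1 := hσ.mul_integral_norm_sq_le hd hTn (hg n).2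
    have hσg : IntegrableOn (fun s => σ s * ‖g s‖ ^ 2) (Ioc 0 (T n)) :=
      hi.mono_set (hσ.Ioc_subset_support (hT n))
    have h2 : ∫ s in (0 : ℝ)..T n, σ s * (2 * inner ℝ (∫ t in (0 : ℝ)..s, g t) (g s)) ≤
        ∫ s in (0 : ℝ)..T n, (d / 2 * (σ s * ‖∫ t in (0 : ℝ)..s, g t‖ ^ 2) +
          2 / d * (σ s * ‖g s‖ ^ 2)) := by
      rw [intervalIntegral.integral_of_le hTn.le, intervalIntegral.integral_of_le hTn.le]
      refine setIntegral_mono_on (hσ.integrableOn_mul (integral_inner_primitive hTn.le (hg n).2).1)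
        (((hG n).const_mul _).add (hσg.const_mul _)) measurableSet_Ioc fun s hs => ?_
      set a := ‖∫ t in (0 : ℝ)..s, g t‖
      have h3 : 2 * inner ℝ (∫ t in (0 : ℝ)..s, g t) (g s) ≤ d / 2 * a ^ 2 + 2 / d * ‖g s‖ ^ 2 := by
        have h4 := real_inner_le_norm (∫ t in (0 : ℝ)..s, g t) (g s)
        have h5 : d / 2 * a ^ 2 + 2 / d * ‖g s‖ ^ 2 - 2 * (a * ‖g s‖) =
            (d * a - 2 * ‖g s‖) ^ 2 / (2 * d) := by field_simp; ring
        have h6 : 0 ≤ (d * a - 2 * ‖g s‖) ^ 2 / (2 * d) := by positivity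
        linarith
      have := mul_le_mul_of_nonneg_left h3 (hσ.nonneg s hs.1)
      linarith
    rw [intervalIntegral.integral_add
      (((intervalIntegrable_iff_integrableOn_Ioc_of_le hTn.le).2 (hG n)).const_mul _)
      (((intervalIntegrable_iff_integrableOn_Ioc_of_le hTn.le).2 hσg).const_mul _),
      intervalIntegral.integral_const_mul, intervalIntegral.integral_const_mul] at h2
    have h7 : ∫ s in (0 : ℝ)..T n, σ s * ‖g s‖ ^ 2 ≤ ∫ s in kernelSupport σ, σ s * ‖g s‖ ^ 2 := by
      rw [intervalIntegral.integral_of_le hTn.le]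
      refine setIntegral_mono_set hi ?_ (hσ.Ioc_subset_support (hT n)).eventuallyLE
      filter_upwards [ae_restrict_mem hσ.isOpen_support.measurableSet] with s hs
      exact mul_nonneg hs.2.le (by positivity)
    have h8 : ∫ s in Ioc 0 (T n), ‖σ s * ‖∫ t in (0 : ℝ)..s, g t‖ ^ 2‖ =
        ∫ s in (0 : ℝ)..T n, σ s * ‖∫ t in (0 : ℝ)..s, g t‖ ^ 2 := by
      rw [intervalIntegral.integral_of_le hTn.le]
      refine setIntegral_congr_fun measurableSet_Ioc fun s hs => ?_
      exact Real.norm_of_nonneg (mul_nonneg (hσ.nonneg s hs.1) (by positivity))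
    rw [h8]
    set I := ∫ s in (0 : ℝ)..T n, σ s * ‖∫ t in (0 : ℝ)..s, g t‖ ^ 2
    set J := ∫ s in (0 : ℝ)..T n, σ s * ‖g s‖ ^ 2
    have h9 : d / 2 * I ≤ 2 / d * J := by linarith
    have h10 : I ≤ 4 / d ^ 2 * J := by
      have : 4 / d ^ 2 * J = (2 / d * J) / (d / 2) := by field_simp; ring
      rw [this, le_div_iff₀ (by positivity)]
      linarith
    exact h10.trans (mul_le_mul_of_nonneg_left h7 (by positivity))

end Hilbert

end MemoryKernel

/-! ### The memory space -/

section MemorySpace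

instance (L : ℝ) : InnerProductSpace ℝ (H10 L) := InnerProductSpace.complexToReal

variable {P : Params} {σ : ℝ → ℝ}

theorem memSupport_eq (hm : 0 < P.m) : memSupport P σ = kernelSupport σ := by
  ext s
  simp only [memSupport, kernelSupport, mem_ofPred_eq]
  exact and_congr_right fun _ => mul_pos_iff_of_pos_left (mul_pos P.c_pos hm)

theorem memSupport_eq_empty (hm : P.m = 0) : memSupport P σ = ∅ := by
  ext s
  simp [memSupport, hm]

/-- For $m=0$ the weight vanishes and $W=\{0\}$; this disposes of the Fourier case in the lemmas
below. -/
theorem eq_of_m_eq_zero (hσ : MemoryKernel σ) (hm : P.m = 0) (η ξ : W P σ) : η = ξ := by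
  apply Lp.ext
  refine (ae_memMeasure_iff P hσ).2 ?_
  rw [memSupport_eq_empty hm]
  simp

theorem memMeasure_absolutelyContinuous (hσ : MemoryKernel σ) :
    memMeasure P σ ≪ volume.restrict (memSupport P σ) :=
  Measure.ae_le_iff_absolutelyContinuous.1 fun _ h => (ae_memMeasure_iff P hσ).2 h

theorem restrict_absolutelyContinuous (hσ : MemoryKernel σ) :
    volume.restrict (memSupport P σ) ≪ memMeasure P σ :=
  Measure.ae_le_iff_absolutelyContinuous.1 fun _ h => (ae_memMeasure_iff P hσ).1 h

section Integral

variable {E : Type*} [NormedAddCommGroup E] [NormedSpace ℝ E]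

theorem smul_eq_zero_of_notMem_support (hσ : MemoryKernel σ) (f : ℝ → E) :
    ∀ s ∈ Ioi (0 : ℝ) \ kernelSupport σ, σ s • f s = 0 := by
  intro s hs
  have : σ s = 0 := le_antisymm (not_lt.1 fun h => hs.2 ⟨hs.1, h⟩) (hσ.nonneg s hs.1)
  rw [this, zero_smul]

theorem kernelSupport_subset : kernelSupport σ ⊆ Ioi 0 := fun _ hs => hs.1

theorem setIntegral_kernelSupport (hσ : MemoryKernel σ) (f : ℝ → E) :
    ∫ s in kernelSupport σ, σ s • f s = ∫ s in Ioi 0, σ s • f s :=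
  (setIntegral_eq_of_subset_of_forall_sdiff_eq_zero measurableSet_Ioi kernelSupport_subset
    (smul_eq_zero_of_notMem_support hσ f)).symm

theorem integral_memMeasure (hσ : MemoryKernel σ) (f : ℝ → E) :
    ∫ s, f s ∂memMeasure P σ = (P.c * P.m) • ∫ s in kernelSupport σ, σ s • f s := by
  rw [setIntegral_kernelSupport hσ, memMeasure,
    integral_withDensity_eq_integral_toReal_smul₀ (hσ.aemeasurable P)
    (Eventually.of_forall fun _ => ENNReal.ofReal_lt_top), ← integral_smul]
  refine setIntegral_congr_fun measurableSet_Ioi fun s hs => ?_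
  rw [ENNReal.toReal_ofReal (mul_nonneg (mul_nonneg P.c_pos.le P.m_mem.1) (hσ.nonneg s hs)),
    smul_smul]

/-- Positivity of $m$ is essential: for $m=0$ the measure is zero and the left side holds for every
$f$. -/
theorem integrable_memMeasure_iff (hσ : MemoryKernel σ) (hm : 0 < P.m) (f : ℝ → E) :
    Integrable f (memMeasure P σ) ↔ IntegrableOn (fun s => σ s • f s) (kernelSupport σ) := by
  have hcm : 0 < P.c * P.m := mul_pos P.c_pos hm
  rw [memMeasure, integrable_withDensity_iff_integrable_smul₀' (hσ.aemeasurable P)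
    (Eventually.of_forall fun _ => ENNReal.ofReal_lt_top)]
  have h1 : Integrable (fun s => (ENNReal.ofReal (P.c * P.m * σ s)).toReal • f s)
      (volume.restrict (Ioi 0)) ↔ IntegrableOn (fun s => (P.c * P.m) • σ s • f s) (Ioi 0) := by
    refine integrable_congr ?_
    filter_upwards [ae_restrict_mem measurableSet_Ioi] with s hs
    rw [ENNReal.toReal_ofReal (mul_nonneg hcm.le (hσ.nonneg s hs)), smul_smul]
  rw [h1, IntegrableOn, integrable_fun_smul_iff hcm.ne']
  exact ⟨fun h => IntegrableOn.mono_set h kernelSupport_subset, fun h =>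
    IntegrableOn.of_forall_sdiff_eq_zero h measurableSet_Ioi (smul_eq_zero_of_notMem_support hσ f)⟩

end Integral

theorem aestronglyMeasurable_mem (hσ : MemoryKernel σ) (hm : 0 < P.m) (η : W P σ) :
    AEStronglyMeasurable η (volume.restrict (kernelSupport σ)) := by
  rw [← memSupport_eq hm]
  exact (Lp.aestronglyMeasurable η).mono_ac (restrict_absolutelyContinuous hσ)

theorem integrableOn_mul_norm_sq_mem (hσ : MemoryKernel σ) (hm : 0 < P.m) (η : W P σ) :
    IntegrableOn (fun s => σ s * ‖η s‖ ^ 2) (kernelSupport σ) :=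
  (integrable_memMeasure_iff hσ hm _).1
    ((memLp_two_iff_integrable_sq_norm (Lp.aestronglyMeasurable η)).1 (Lp.memLp η))

theorem integrableOn_Ioc_mem (hσ : MemoryKernel σ) (hm : 0 < P.m) (η : W P σ) {T : ℝ}
    (hT : T ∈ kernelSupport σ) : IntegrableOn η (Ioc 0 T) :=
  (hσ.integrableOn_of_sq (aestronglyMeasurable_mem hσ hm η)
    (integrableOn_mul_norm_sq_mem hσ hm η) hT).2

/-- A countable exhaustion turns statements on the support into statements on bounded intervals,
where elements of $W$ are integrable. -/
theorem ae_kernelSupport_iff (hσ : MemoryKernel σ) {p : ℝ → Prop} :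
    (∀ᵐ s ∂volume.restrict (kernelSupport σ), p s) ↔
      ∀ T ∈ kernelSupport σ, ∀ᵐ s ∂volume.restrict (Ioo 0 T), p s := by
  constructor
  · intro h T hT
    exact ae_restrict_of_ae_restrict_of_subset
      (Ioo_subset_Ioc_self.trans (hσ.Ioc_subset_support hT)) h
  · intro h
    obtain ⟨T, hT, hcov⟩ := hσ.exists_seq
    have h1 : ∀ n, ∀ᵐ s ∂volume.restrict (kernelSupport σ), s ∈ Ioc 0 (T n) → p s := by
      intro n
      have h2 := h (T n) (hT n)
      rw [Measure.restrict_congr_set Ioo_ae_eq_Ioc, ae_restrict_iff' measurableSet_Ioc] at h2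
      exact ae_restrict_of_ae h2
    filter_upwards [ae_all_iff.2 h1, hcov.ae_eventually_mem] with s hs hs'
    obtain ⟨n, hn⟩ := hs'.exists
    exact hs n hn

theorem tendsto_primitive_zero {E : Type*} [NormedAddCommGroup E] [NormedSpace ℝ E] {T : ℝ}
    (hT : 0 < T) {g : ℝ → E} (hg : IntegrableOn g (Ioc 0 T)) :
    Tendsto (fun s => ∫ t in (0 : ℝ)..s, g t) (𝓝[>] 0) (𝓝 0) := by
  have hc := intervalIntegral.continuousOn_primitive_interval'
    ((intervalIntegrable_iff_integrableOn_Ioc_of_le hT.le).2 hg) left_mem_uIcc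
  rw [uIcc_of_le hT.le] at hc
  have h2 := (hc 0 (left_mem_Icc.2 hT.le)).tendsto.mono_left
    (nhdsWithin_le_of_mem (s := Icc 0 T) (t := Ioi 0) (Icc_mem_nhdsGT hT))
  simpa using h2

/-- A memory with a derivative in `W` that vanishes at `0` is the primitive of its derivative. -/
theorem IsMemDeriv.ae_eq_primitive (hσ : MemoryKernel σ) (hm : 0 < P.m) {η ξ : W P σ}
    (h : IsMemDeriv η ξ) (h0 : VanishesAtZero η) :
    ∀ᵐ s ∂volume.restrict (kernelSupport σ), η s = ∫ t in (0 : ℝ)..s, ξ t := by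
  rw [ae_kernelSupport_iff hσ]
  intro T hT
  have hξ := integrableOn_Ioc_mem hσ hm ξ hT
  have hsub : Ioo 0 T ⊆ kernelSupport σ := Ioo_subset_Ioc_self.trans (hσ.Ioc_subset_support hT)
  have h' : HasWeakDerivOn (Ioo 0 T) η ξ := by
    refine HasWeakDerivOn.mono h ?_
    rwa [memSupport_eq hm]
  obtain ⟨k, hk⟩ := h'.ae_eq_primitive_add hT.1 hξ
  suffices hk0 : k = 0 by
    filter_upwards [hk] with s hs
    rw [hs, hk0, add_zero]
  by_contra hne
  obtain ⟨η', he, hη'⟩ := h0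
  have h1 := (ae_memMeasure_iff P hσ).1 he
  rw [memSupport_eq hm] at h1
  have h2 := hη'.sub (tendsto_primitive_zero hT.1 hξ)
  rw [sub_zero] at h2
  -- The constant $k$ is an almost everywhere value, whereas the vanishing at $0$ is a limit of one
  -- representative. If $k\ne0$, that representative minus the primitive avoids $k$ on some
  -- $(0,\varepsilon)$ and yet equals $k$ almost everywhere there, although the interval has
  -- positive measure.
  have h3 : ∀ᶠ s in 𝓝[>] (0 : ℝ), η' s - (∫ t in (0 : ℝ)..s, ξ t) ≠ k ∧ s < T :=
    (h2.eventually_ne (Ne.symm hne)).and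
      (mem_of_superset (Ioo_mem_nhdsGT hT.1) fun s hs => hs.2)
  obtain ⟨ε, hε, hsub'⟩ := (mem_nhdsGT_iff_exists_Ioo_subset).1 h3
  have hεT : Ioo 0 ε ⊆ Ioo 0 T := fun s hs => ⟨hs.1, (hsub' hs).2⟩
  have h4 : ∀ᵐ s ∂volume.restrict (Ioo 0 ε), False := by
    filter_upwards [ae_restrict_of_ae_restrict_of_subset hεT hk,
      ae_restrict_of_ae_restrict_of_subset (hεT.trans hsub) h1, ae_restrict_mem measurableSet_Ioo]
      with s a1 a2 a3
    refine (hsub' a3).1 ?_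
    rw [← a2, a1, add_sub_cancel_left]
  rw [Filter.eventually_false_iff_eq_bot, ae_eq_bot, Measure.restrict_eq_zero, Real.volume_Ioo,
    sub_zero, ENNReal.ofReal_eq_zero] at h4
  exact absurd h4 (not_le.2 hε)

/-- Formally $2\operatorname{Re}(\eta_s,\eta)_W=cm\int\sigma\,\frac{d}{ds}\|\eta\|^2\,ds$, and
integration by parts gives a nonnegative value because $\sigma'\le0$ and $\eta(0)=0$. -/
theorem IsMemDeriv.re_inner_nonneg (hσ : MemoryKernel σ) {η ξ : W P σ} (h : IsMemDeriv η ξ)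
    (h0 : VanishesAtZero η) : 0 ≤ (inner ℂ ξ η).re := by
  rcases P.m_mem.1.eq_or_lt with hm | hm
  · rw [eq_of_m_eq_zero hσ hm.symm η 0, inner_zero_right, Complex.zero_re]
  have he := h.ae_eq_primitive hσ hm h0
  have hint : Integrable (fun s => inner ℂ (ξ s) (η s)) (memMeasure P σ) := L2.integrable_inner ξ η
  have e1 : (inner ℂ ξ η).re = ∫ s, (inner ℂ (ξ s) (η s)).re ∂memMeasure P σ := by
    rw [L2.inner_def]
    exact (integral_re hint).symm
  have e2 : (fun s => σ s • (inner ℂ (ξ s) (η s)).re) =ᵐ[volume.restrict (kernelSupport σ)]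
      fun s => σ s * inner ℝ (∫ t in (0 : ℝ)..s, ξ t) (ξ s) := by
    filter_upwards [he] with s hs
    rw [← hs, real_inner_comm, real_inner_eq_re_inner ℂ]
    rfl
  rw [e1, integral_memMeasure hσ, integral_congr_ae e2]
  refine smul_nonneg (mul_nonneg P.c_pos.le hm.le) (hσ.integral_inner_primitive_nonneg
    (fun T hT => integrableOn_Ioc_mem hσ hm ξ hT) ?_)
  exact ((integrable_memMeasure_iff hσ hm _).1 hint.re).congr e2

/-- The support is an open interval starting at $0$, so the compact support of a test function
already lies in some $(0,T)$ with $T$ in the support. -/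
theorem hasWeakDerivOn_kernelSupport {E : Type*} [NormedAddCommGroup E] [NormedSpace ℝ E]
    (hσ : MemoryKernel σ) {f g : ℝ → E}
    (h : ∀ T ∈ kernelSupport σ, HasWeakDerivOn (Ioo 0 T) f g) :
    HasWeakDerivOn (kernelSupport σ) f g := by
  have hex : ∀ s ∈ kernelSupport σ, ∃ T ∈ kernelSupport σ, s < T := by
    intro s hs
    have h1 : kernelSupport σ ∈ 𝓝[>] s := mem_nhdsWithin_of_mem_nhds (hσ.isOpen_support.mem_nhds hs)
    obtain ⟨u, hu, hsub⟩ := (mem_nhdsGT_iff_exists_Ioo_subset).1 h1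
    obtain ⟨q, hq1, hq2⟩ := exists_between (mem_Ioi.1 hu)
    exact ⟨q, hsub ⟨hq1, hq2⟩, hq1⟩
  have loc : ∀ k : ℝ → E, (∀ T ∈ kernelSupport σ, LocallyIntegrableOn k (Ioo 0 T)) →
      LocallyIntegrableOn k (kernelSupport σ) := by
    intro k hk s hs
    obtain ⟨T, hT, hsT⟩ := hex s hs
    have h1 := hk T hT s ⟨hs.1, hsT⟩
    rw [isOpen_Ioo.nhdsWithin_eq ⟨hs.1, hsT⟩] at h1
    exact h1.filter_mono nhdsWithin_le_nhds
  refine ⟨loc f fun T hT => (h T hT).1, loc g fun T hT => (h T hT).2, fun φ hφ hc hs => ?_⟩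
  obtain ⟨T, hT, hsT⟩ : ∃ T ∈ kernelSupport σ, tsupport φ ⊆ Ioo 0 T := by
    rcases (tsupport φ).eq_empty_or_nonempty with he | hne
    · obtain ⟨T, hT⟩ := hσ.support_nonempty
      exact ⟨T, hT, he ▸ empty_subset _⟩
    · obtain ⟨s, hs1, hs2⟩ := hc.isCompact.exists_isGreatest hne
      obtain ⟨T, hT, hsT⟩ := hex s (hs hs1)
      exact ⟨T, hT, fun r hr => ⟨(hs hr).1, (hs2 hr).trans_lt hsT⟩⟩
  have full : ∀ (ψ : ℝ → ℝ) (k : ℝ → E), tsupport ψ ⊆ Ioo 0 T →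
      ∫ x in kernelSupport σ, ψ x • k x = ∫ x in Ioo 0 T, ψ x • k x := by
    intro ψ k hψ
    refine setIntegral_eq_of_subset_of_forall_sdiff_eq_zero hσ.isOpen_support.measurableSet
      (Ioo_subset_Ioc_self.trans (hσ.Ioc_subset_support hT)) fun x hx => ?_
    have : ψ x = 0 := image_eq_zero_of_notMem_tsupport fun h => hx.2 (hψ h)
    simp [this]
  rw [full _ _ (tsupport_deriv_subset'.trans hsT), full _ _ hsT]
  exact (h T hT).3 φ hφ hc hsT

/-- Every element of `W` is the derivative of an element of `W` that vanishes at `0`. -/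
theorem exists_isMemDeriv (hσ : MemoryKernel σ) (g : W P σ) :
    ∃ η : W P σ, IsMemDeriv η g ∧ VanishesAtZero η ∧
      ∀ᵐ s ∂volume.restrict (memSupport P σ), η s = ∫ t in (0 : ℝ)..s, g t := by
  rcases P.m_mem.1.eq_or_lt with hm | hm
  · refine ⟨0, ?_, VanishesAtZero.zero, ?_⟩
    · rw [eq_of_m_eq_zero hσ hm.symm g 0]; exact IsMemDeriv.zero hσ
    · rw [memSupport_eq_empty hm.symm]; simp
  have hs := memSupport_eq (σ := σ) hm
  set G : ℝ → H10 P.L := fun s => ∫ t in (0 : ℝ)..s, g t with hG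
  have hgm := aestronglyMeasurable_mem hσ hm g
  have hgi := integrableOn_mul_norm_sq_mem hσ hm g
  have hgT := fun T (hT : T ∈ kernelSupport σ) => integrableOn_Ioc_mem hσ hm g hT
  have hwd : ∀ T ∈ kernelSupport σ, HasWeakDerivOn (Ioo 0 T) G g := fun T hT =>
    hasWeakDerivOn_primitive' hT.1.le (hgT T hT)
  have hwdΩ := hasWeakDerivOn_kernelSupport hσ hwd
  have hGm : AEStronglyMeasurable G (memMeasure P σ) := by
    refine AEStronglyMeasurable.mono_ac (memMeasure_absolutelyContinuous hσ) ?_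
    rw [hs]
    exact hwdΩ.1.aestronglyMeasurable
  -- The weighted Hardy inequality keeps the primitive in $W$.
  have hGL : MemLp G 2 (memMeasure P σ) :=
    (memLp_two_iff_integrable_sq_norm hGm).2 ((integrable_memMeasure_iff hσ hm _).2
      (hσ.integrableOn_norm_sq_primitive hgm hgi))
  have hae := (ae_memMeasure_iff P hσ).1 hGL.coeFn_toLp
  obtain ⟨T, hT⟩ := hσ.support_nonempty
  refine ⟨hGL.toLp G, ?_, ⟨G, hGL.coeFn_toLp, tendsto_primitive_zero hT.1 (hgT T hT)⟩, hae⟩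
  rw [IsMemDeriv]
  refine HasWeakDerivOn.congr (EventuallyEq.symm hae) (EventuallyEq.refl _ _) ?_
  rwa [hs]

/-- The inner product of $W$ thus produces $\int\sigma\eta$, the memory part of $\Lambda^m$, so in
the energy balance the term $w$ of the memory equation cancels the memory part of the heat flux. -/
theorem inner_constMem (hσ : MemoryKernel σ) (w : H10 P.L) (η : W P σ) :
    inner ℂ (constMem P hσ w) η =
      ((P.c * P.m : ℝ) : ℂ) * inner ℂ w (∫ s in Ioi (0 : ℝ), σ s • η s) := by
  have := memMeasure_finite P hσ
  rcases P.m_mem.1.eq_or_lt with hm | hm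
  · rw [eq_of_m_eq_zero hσ hm.symm η 0, inner_zero_right, ← hm]; simp
  rw [L2.inner_def]
  have e1 : ∫ s, inner ℂ (constMem P hσ w s) (η s) ∂memMeasure P σ =
      ∫ s, inner ℂ w (η s) ∂memMeasure P σ := by
    refine integral_congr_ae ?_
    filter_upwards [Lp.coeFn_const (p := 2) (μ := memMeasure P σ) w] with s hs
    have hs' : constMem P hσ w s = w := hs
    rw [hs']
  have hint : Integrable η (memMeasure P σ) := (Lp.memLp η).integrable (by norm_num)
  refine e1.trans ?_
  have e2 := integral_inner (𝕜 := ℂ) hint w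
  refine e2.trans ?_
  rw [integral_memMeasure hσ, setIntegral_kernelSupport hσ,
    ← Complex.coe_smul, inner_smul_right]
  rfl

theorem re_inner_neg_memDeriv_le (hσ : MemoryKernel σ) {η : W P σ}
    (h : ∃ ξ, IsMemDeriv η ξ) (h0 : VanishesAtZero η) : (inner ℂ (-memDeriv η) η).re ≤ 0 := by
  obtain ⟨ξ, hξ⟩ := h
  rw [hξ.memDeriv_eq hσ, inner_neg_left, Complex.neg_re]
  linarith [hξ.re_inner_nonneg hσ h0]

/-- The Hardy inequality for the constant function $1$ gives $\int\sigma s^2\,ds<\infty$, and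
$s\le1+s^2$. -/
theorem integrableOn_mul_self (hσ : MemoryKernel σ) :
    IntegrableOn (fun s => σ s * s) (Ioi 0) := by
  have hσi : IntegrableOn σ (kernelSupport σ) := hσ.integrable.mono_set kernelSupport_subset
  have h1 := hσ.integrableOn_norm_sq_primitive (E := ℝ) (g := fun _ => 1)
    aestronglyMeasurable_const (by simpa using hσi)
  simp only [intervalIntegral.integral_const, sub_zero, smul_eq_mul, mul_one, Real.norm_eq_abs,
    sq_abs] at h1
  have h2 : IntegrableOn (fun s => σ s * s) (kernelSupport σ) := by
    refine Integrable.mono' (hσi.add h1) ?_ ?_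
    · exact hσi.aestronglyMeasurable.mul aestronglyMeasurable_id
    · filter_upwards [ae_restrict_mem hσ.isOpen_support.measurableSet] with s hs
      rw [Real.norm_of_nonneg (mul_nonneg hs.2.le hs.1.le)]
      simp only [Pi.add_apply]
      have : σ s * s ≤ σ s * (1 + s ^ 2) :=
        mul_le_mul_of_nonneg_left (by nlinarith [sq_nonneg (s - 1)]) hs.2.le
      linarith
  refine IntegrableOn.of_forall_sdiff_eq_zero h2 measurableSet_Ioi fun s hs => ?_
  exact smul_eq_zero_of_notMem_support hσ (fun s => s) s hs

end MemorySpace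

/-! ### Second primitives in `L²(0, L)` -/

section SecondPrimitive

variable {L : ℝ}

/-- A constant as an element of `L²(0, L)`. -/
def constL2 (L : ℝ) (k : ℂ) : L2 L := Lp.const 2 (volume.restrict (Ioo 0 L)) k

theorem coeFn_constL2 (k : ℂ) : constL2 L k =ᵐ[volume.restrict (Ioo 0 L)] fun _ => k :=
  Lp.coeFn_const (p := 2) (μ := volume.restrict (Ioo 0 L)) k

theorem hasTrace_constL2 (k : ℂ) (x : ℝ) : HasTrace (constL2 L k) x k :=
  ⟨fun _ => k, continuousOn_const, coeFn_constL2 k, rfl⟩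

theorem isWeakDeriv_constL2 (hL : 0 ≤ L) (k : ℂ) : IsWeakDeriv (constL2 L k) 0 := by
  have h : HasWeakDerivOn (Ioo 0 L) (fun _ : ℝ => k) 0 := by
    refine ⟨locallyIntegrableOn_const k, locallyIntegrableOn_zero, fun φ hφ hc hs => ?_⟩
    have h0 : φ 0 = 0 := image_eq_zero_of_notMem_tsupport fun h => lt_irrefl _ (hs h).1
    have h1 : φ L = 0 := image_eq_zero_of_notMem_tsupport fun h => lt_irrefl _ (hs h).2
    have hφ' : Continuous (deriv φ) := hφ.continuous_deriv (by simp)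
    rw [integral_smul_const, ← integral_Ioc_eq_integral_Ioo, ← intervalIntegral.integral_of_le hL,
      intervalIntegral.integral_deriv_eq_sub (fun t _ => (hφ.differentiable (by simp)) t)
      (hφ'.intervalIntegrable _ _), h0, h1]
    simp
  exact h.congr (coeFn_constL2 k).symm (Lp.coeFn_zero ℂ 2 _).symm

/-- There is `u ∈ H¹_L ∩ H²` with `u_xx = a` and `u_x(L) = 0`. -/
theorem exists_second_primitive_H1L (hL : 0 < L) (a : L2 L) :
    ∃ u : H1L L, u.dx ∈ H1 L ∧ weakDeriv u.dx = a ∧ HasTrace u.dx L 0 := by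
  obtain ⟨p, hp, hpa, hpt⟩ := exists_primitive hL a
  -- This is the value at $L$ of the first primitive of $a$; subtracting it yields $u_x(L)=0$.
  set k : ℂ := ∫ t in (0 : ℝ)..L, a t
  have hw : IsWeakDeriv (p + constL2 L (-k)) a := by
    have := (isWeakDeriv_weakDeriv hp.1).add (isWeakDeriv_constL2 hL.le (-k))
    rwa [hpa, add_zero] at this
  obtain ⟨u, hu, hup, -⟩ := exists_primitive hL (p + constL2 L (-k))
  have e : (H1L.mk u hu).dx = p + constL2 L (-k) := hup
  refine ⟨H1L.mk u hu, ?_, ?_, ?_⟩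
  · rw [e]; exact ⟨a, hw⟩
  · rw [e]; exact hw.weakDeriv_eq
  · rw [e]
    have := hpt.add (hasTrace_constL2 (-k) L)
    rwa [add_neg_cancel] at this

/-- There is `u ∈ H¹₀ ∩ H²` with `u_xx = a`. -/
theorem exists_second_primitive_H10 (hL : 0 < L) (a : L2 L) :
    ∃ u : H10 L, u.dx ∈ H1 L ∧ weakDeriv u.dx = a := by
  obtain ⟨p, hp, hpa, -⟩ := exists_primitive hL a
  -- Subtracting the mean value of $p$ makes the second primitive vanish at $L$.
  set k : ℂ := (∫ t in (0 : ℝ)..L, p t) / L with hk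
  have hw : IsWeakDeriv (p + constL2 L (-k)) a := by
    have := (isWeakDeriv_weakDeriv hp.1).add (isWeakDeriv_constL2 hL.le (-k))
    rwa [hpa, add_zero] at this
  obtain ⟨u, hu, hup, hut⟩ := exists_primitive hL (p + constL2 L (-k))
  have h0 : ∫ t in (0 : ℝ)..L, (p + constL2 L (-k) : L2 L) t = 0 := by
    have e1 : ∫ t in (0 : ℝ)..L, (p + constL2 L (-k) : L2 L) t = ∫ t in (0 : ℝ)..L, (p t + -k) := by
      rw [L2.intervalIntegral_eq hL.le, L2.intervalIntegral_eq hL.le]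
      refine integral_congr_ae ?_
      filter_upwards [Lp.coeFn_add p (constL2 L (-k)), coeFn_constL2 (L := L) (-k)] with t h1 h2
      rw [h1, Pi.add_apply, h2]
    rw [e1, intervalIntegral.integral_add ((intervalIntegrable_iff_integrableOn_Ioo_of_le hL.le).2
      (L2.integrableOn p)) intervalIntegrable_const, intervalIntegral.integral_const, hk]
    have : (L : ℂ) ≠ 0 := Complex.ofReal_ne_zero.2 hL.ne'
    simp only [sub_zero, Complex.real_smul]
    field_simp
    ring
  rw [h0] at hut
  have hu0 : u ∈ H10Sub L := ⟨hu.1, hu.2, hut⟩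
  have e : (H10.mk u hu0).dx = p + constL2 L (-k) := hup
  refine ⟨H10.mk u hu0, ?_, ?_⟩
  · rw [e]; exact ⟨a, hw⟩
  · rw [e]; exact hw.weakDeriv_eq

end SecondPrimitive

section System

variable {P : Params} {σ : ℝ → ℝ}

/-! ### Completeness of the energy space -/

theorem EnergySpace.norm_sq_eq (U : EnergySpace P σ) :
    ‖U‖ ^ 2 = P.ρ * ‖U.v‖ ^ 2 + P.α₁ * ‖U.u‖ ^ 2 + P.μ * ‖U.z‖ ^ 2
      + P.β * ‖(P.γ : ℂ) • U.u.dx - U.y.dx‖ ^ 2 + ‖U.w‖ ^ 2 + ‖U.η‖ ^ 2 := by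
  have h := re_innerE_self U
  rw [LinearIsometry.norm_map] at h
  rw [← h]
  exact InnerProductSpace.norm_sq_eq_re_inner (𝕜 := ℂ) U

theorem le_sqrt_inv_mul {a x N : ℝ} (ha : 0 < a) (hN : 0 ≤ N) (h : a * x ^ 2 ≤ N ^ 2) :
    x ≤ √a⁻¹ * N := by
  refine le_trans (le_abs_self x) (abs_le_of_sq_le_sq ?_ (by positivity))
  rw [mul_pow, Real.sq_sqrt (by positivity), inv_mul_eq_div, le_div_iff₀ ha]
  linarith

/-- The energy norm is equivalent to the product norm of complete spaces. The only component not
controlled directly is $y_x=\gamma u_x-(\gamma u_x-y_x)$, which is bounded through $u_x$ and the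
coupled term. -/
instance : CompleteSpace (EnergySpace P σ) := by
  have hρ := P.ρ_pos; have hα := P.α₁_pos; have hμ := P.μ_pos; have hβ := P.β_pos
  let e : (H1L P.L × L2 P.L × H1L P.L × L2 P.L × L2 P.L × W P σ) ≃ₗ[ℂ] EnergySpace P σ :=
    { toFun := fun x => x
      invFun := fun x => x
      map_add' := fun _ _ => rfl
      map_smul' := fun _ _ => rfl
      left_inv := fun _ => rfl
      right_inv := fun _ => rfl }
  have hγ : ∀ U : EnergySpace P σ,
      ‖(P.γ : ℂ) • U.u.dx - U.y.dx‖ ≤ |P.γ| * ‖U.u‖ + ‖U.y‖ := fun U => by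
    refine (norm_sub_le _ _).trans ?_
    rw [norm_smul, LinearIsometry.norm_map, LinearIsometry.norm_map, Complex.norm_real,
      Real.norm_eq_abs]
  have hγ' : ∀ U : EnergySpace P σ,
      ‖U.y‖ ≤ ‖(P.γ : ℂ) • U.u.dx - U.y.dx‖ + |P.γ| * ‖U.u‖ := fun U => by
    have h1 : U.y.dx = (P.γ : ℂ) • U.u.dx - ((P.γ : ℂ) • U.u.dx - U.y.dx) := by abel
    rw [← LinearIsometry.norm_map H1L.dx U.y, h1]
    refine (norm_sub_le _ _).trans ?_
    rw [← h1, norm_smul, LinearIsometry.norm_map, Complex.norm_real, Real.norm_eq_abs, add_comm]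
  set K : ℝ := P.ρ + P.α₁ + P.μ + P.β * (|P.γ| + 1) ^ 2 + 1 + 1 with hK
  have hK0 : 0 ≤ K := by positivity
  have b1 : ∀ x, ‖e x‖ ≤ √K * ‖x‖ := by
    intro x
    set U : EnergySpace P σ := e x with hU
    have c1 : ‖U.u‖ ≤ ‖x‖ := norm_fst_le x
    have c2 : ‖U.v‖ ≤ ‖x‖ := (norm_fst_le x.2).trans (norm_snd_le x)
    have c3 : ‖U.y‖ ≤ ‖x‖ := (norm_fst_le x.2.2).trans ((norm_snd_le x.2).trans (norm_snd_le x))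
    have c4' : ‖x.2.2.2‖ ≤ ‖x‖ :=
      (norm_snd_le x.2.2).trans ((norm_snd_le x.2).trans (norm_snd_le x))
    have c4 : ‖U.z‖ ≤ ‖x‖ := (norm_fst_le x.2.2.2).trans c4'
    have c5 : ‖U.w‖ ≤ ‖x‖ := (norm_fst_le x.2.2.2.2).trans ((norm_snd_le x.2.2.2).trans c4')
    have c6 : ‖U.η‖ ≤ ‖x‖ := (norm_snd_le x.2.2.2.2).trans ((norm_snd_le x.2.2.2).trans c4')
    have c7 : ‖(P.γ : ℂ) • U.u.dx - U.y.dx‖ ≤ (|P.γ| + 1) * ‖x‖ := by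
      have := mul_le_mul_of_nonneg_left c1 (abs_nonneg P.γ)
      linarith [hγ U]
    have hsq : ‖U‖ ^ 2 ≤ (√K * ‖x‖) ^ 2 := by
      rw [EnergySpace.norm_sq_eq, mul_pow, Real.sq_sqrt hK0]
      have d1 : P.ρ * ‖U.v‖ ^ 2 ≤ P.ρ * ‖x‖ ^ 2 := by gcongr
      have d2 : P.α₁ * ‖U.u‖ ^ 2 ≤ P.α₁ * ‖x‖ ^ 2 := by gcongr
      have d3 : P.μ * ‖U.z‖ ^ 2 ≤ P.μ * ‖x‖ ^ 2 := by gcongr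
      have d4 : P.β * ‖(P.γ : ℂ) • U.u.dx - U.y.dx‖ ^ 2 ≤ P.β * ((|P.γ| + 1) * ‖x‖) ^ 2 := by gcongr
      have d5 : ‖U.w‖ ^ 2 ≤ ‖x‖ ^ 2 := by gcongr
      have d6 : ‖U.η‖ ^ 2 ≤ ‖x‖ ^ 2 := by gcongr
      rw [hK]
      linarith
    exact (sq_le_sq₀ (norm_nonneg _) (by positivity)).1 hsq
  set M : ℝ := √P.α₁⁻¹ + √P.ρ⁻¹ + √P.μ⁻¹ + (√P.β⁻¹ + |P.γ| * √P.α₁⁻¹) + 1 with hM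
  have b2 : ∀ U : EnergySpace P σ, ‖e.symm U‖ ≤ M * ‖U‖ := by
    intro U
    have h := EnergySpace.norm_sq_eq U
    have n1 : 0 ≤ P.ρ * ‖U.v‖ ^ 2 := by positivity
    have n2 : 0 ≤ P.α₁ * ‖U.u‖ ^ 2 := by positivity
    have n3 : 0 ≤ P.μ * ‖U.z‖ ^ 2 := by positivity
    have n4 : 0 ≤ P.β * ‖(P.γ : ℂ) • U.u.dx - U.y.dx‖ ^ 2 := by positivity
    have n5 : 0 ≤ ‖U.w‖ ^ 2 := by positivity
    have n6 : 0 ≤ ‖U.η‖ ^ 2 := by positivity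
    have hN := norm_nonneg U
    have c1 : ‖U.u‖ ≤ √P.α₁⁻¹ * ‖U‖ := le_sqrt_inv_mul hα hN (by linarith)
    have c2 : ‖U.v‖ ≤ √P.ρ⁻¹ * ‖U‖ := le_sqrt_inv_mul hρ hN (by linarith)
    have c4 : ‖U.z‖ ≤ √P.μ⁻¹ * ‖U‖ := le_sqrt_inv_mul hμ hN (by linarith)
    have c3' : ‖(P.γ : ℂ) • U.u.dx - U.y.dx‖ ≤ √P.β⁻¹ * ‖U‖ := le_sqrt_inv_mul hβ hN (by linarith)
    have c3 : ‖U.y‖ ≤ (√P.β⁻¹ + |P.γ| * √P.α₁⁻¹) * ‖U‖ := by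
      have := mul_le_mul_of_nonneg_left c1 (abs_nonneg P.γ)
      linarith [hγ' U]
    have c5 : ‖U.w‖ ≤ 1 * ‖U‖ := by
      rw [one_mul]; exact (sq_le_sq₀ (norm_nonneg _) hN).1 (by linarith)
    have c6 : ‖U.η‖ ≤ 1 * ‖U‖ := by
      rw [one_mul]; exact (sq_le_sq₀ (norm_nonneg _) hN).1 (by linarith)
    have p1 : 0 ≤ √P.α₁⁻¹ := by positivity
    have p2 : 0 ≤ √P.ρ⁻¹ := by positivity
    have p3 : 0 ≤ √P.μ⁻¹ := by positivity
    have p4 : 0 ≤ √P.β⁻¹ + |P.γ| * √P.α₁⁻¹ := by positivity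
    have fin : ∀ {x q : ℝ}, x ≤ q * ‖U‖ → q ≤ M → x ≤ M * ‖U‖ := fun h1 h2 =>
      h1.trans (mul_le_mul_of_nonneg_right h2 hN)
    refine norm_prod_le_iff.2 ⟨fin c1 ?_, norm_prod_le_iff.2 ⟨fin c2 ?_, norm_prod_le_iff.2
      ⟨fin c3 ?_, norm_prod_le_iff.2 ⟨fin c4 ?_, norm_prod_le_iff.2 ⟨fin c5 ?_, fin c6 ?_⟩⟩⟩⟩⟩ <;>
    linarith
  let e' := e.toContinuousLinearEquivOfBounds _ _ b1 b2
  exact (completeSpace_congr (e := e'.toEquiv) e'.isUniformEmbedding).1 inferInstance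

/-! ### Dissipativity -/

theorem potential_eq (w : L2 P.L) (η : W P σ) :
    potential w η = ((1 - P.m : ℝ) : ℂ) • w +
      (P.m : ℂ) • H10.fn (∫ s in Ioi (0 : ℝ), σ s • η s) := by
  rw [Complex.coe_smul, Complex.coe_smul]
  rfl

theorem weakDeriv_potential {w : L2 P.L} (hw : w ∈ H1 P.L) (η : W P σ) :
    weakDeriv (potential w η) = ((1 - P.m : ℝ) : ℂ) • weakDeriv w +
      (P.m : ℂ) • H10.dx (∫ s in Ioi (0 : ℝ), σ s • η s) := by
  set K : H10 P.L := ∫ s in Ioi (0 : ℝ), σ s • η s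
  have hK : H10.fn K ∈ H1 P.L := K.2.1
  rw [potential_eq, weakDeriv_add (Submodule.smul_mem _ _ hw) (Submodule.smul_mem _ _ hK),
    weakDeriv_smul _ hw, weakDeriv_smul _ hK]
  rfl

/-- All mechanical and thermal coupling terms cancel in the real part after integration by parts,
and the memory part of $\Lambda^m_x$ cancels against `constMem`. What remains is
$-c(1-m)\|w_x\|^2-\operatorname{Re}(\eta_s,\eta)_W$. -/
theorem isDissipative_operatorA (hσ : MemoryKernel σ) : IsDissipative (operatorA P hσ) := by
  rintro ⟨U, hU⟩
  have hU' : InDomain U := hU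
  change (EnergySpace.innerE (applyA P hσ U hU') U).re ≤ 0
  have hL := P.L_pos
  have hρ : P.ρ * (1 / P.ρ) = 1 := mul_one_div_cancel P.ρ_pos.ne'
  have hμ : P.μ * (1 / P.μ) = 1 := mul_one_div_cancel P.μ_pos.ne'
  -- The boundary terms vanish at $0$ by the condition on $v$ or $z$ and at $L$ by that on $u_x$ or
  -- $y_x$; in the thermal terms those on $w$ are also used.
  have i1 := inner_weakDeriv_of_trace hL hU'.v_mem.1 hU'.ux_mem (Or.inl hU'.v_mem.2) (Or.inr hU'.ux_L)
  have i2 := inner_weakDeriv_of_trace hL hU'.v_mem.1 hU'.yx_mem (Or.inl hU'.v_mem.2) (Or.inr hU'.yx_L)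
  have i3 := inner_weakDeriv_of_trace hL hU'.z_mem.1 hU'.ux_mem (Or.inl hU'.z_mem.2) (Or.inr hU'.ux_L)
  have i4 := inner_weakDeriv_of_trace hL hU'.z_mem.1 hU'.yx_mem (Or.inl hU'.z_mem.2) (Or.inr hU'.yx_L)
  have i5 := inner_weakDeriv_of_trace hL hU'.v_mem.1 hU'.w_mem.1 (Or.inl hU'.v_mem.2)
    (Or.inr hU'.w_mem.2.2)
  have i6 := inner_weakDeriv_of_trace hL hU'.w_mem.1 hU'.potential_mem.2 (Or.inl hU'.w_mem.2.1)
    (Or.inl hU'.w_mem.2.2)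
  have i7 := inner_constMem (P := P) hσ (H10.mk U.w hU'.w_mem) U.η
  have i8 := re_inner_neg_memDeriv_le hσ hU'.ηs_mem hU'.η_zero
  rw [weakDeriv_potential hU'.w_mem.1] at i6
  obtain ⟨K, hK⟩ : ∃ K : H10 P.L, K = ∫ s in Ioi (0 : ℝ), σ s • U.η s := ⟨_, rfl⟩
  rw [← hK] at i6 i7
  have e0 : inner ℂ (H10.mk U.w hU'.w_mem) K = inner ℂ (weakDeriv U.w) (H10.dx K) := rfl
  have e2 : (H1L.mk U.v hU'.v_mem).dx = weakDeriv U.v := rfl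
  have e3 : (H1L.mk U.z hU'.z_mem).dx = weakDeriv U.z := rfl
  rw [e0] at i7
  simp only [EnergySpace.innerE, applyA, EnergySpace.u_mk, EnergySpace.v_mk, EnergySpace.y_mk,
    EnergySpace.z_mk, EnergySpace.w_mk, EnergySpace.η_mk, e2, e3]
  rw [weakDeriv_potential hU'.w_mem.1, ← hK, inner_add_left (-memDeriv U.η), i7]
  replace i1 := congrArg Complex.re i1
  replace i2 := congrArg Complex.re i2
  replace i3 := congrArg Complex.re i3
  replace i4 := congrArg Complex.re i4
  replace i5 := congrArg Complex.re i5
  replace i6 := congrArg Complex.re i6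
  simp only [inner_add_left, inner_sub_left, inner_sub_right, inner_smul_left, inner_smul_right,
    Complex.conj_ofReal, Complex.add_re, Complex.sub_re, Complex.re_ofReal_mul, Complex.neg_re]
    at i1 i2 i3 i4 i5 i6 ⊢
  have s1 := re_inner_comm (weakDeriv U.v) U.u.dx
  have s2 := re_inner_comm (weakDeriv U.v) U.y.dx
  have s3 := re_inner_comm (weakDeriv U.z) U.u.dx
  have s4 := re_inner_comm (weakDeriv U.z) U.y.dx
  have s5 := re_inner_comm (weakDeriv U.v) U.w
  have s6 := re_inner_comm (H10.dx K) (weakDeriv U.w)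
  have hww := re_inner_self (weakDeriv U.w)
  have hneg : 0 ≤ P.c * (1 - P.m) * ‖weakDeriv U.w‖ ^ 2 :=
    mul_nonneg (mul_nonneg P.c_pos.le (by linarith [P.m_mem.2])) (by positivity)
  rw [← mul_assoc P.ρ, ← mul_assoc P.μ, hρ, hμ, one_mul, one_mul]
  rw [s1, s2, s3, s4, s5] 
  rw [hww, s6] at i6
  rw [i1, i2, i3, i4, i5]
  have i9 := congrArg (P.c * ·) i6
  simp only [mul_neg] at i9
  unfold Params.α
  linarith

/-! ### Surjectivity -/

/-- The coefficient `(1 - m) + m ∫ s σ(s) ds` of `w` in the potential of a stationary state. -/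
def potentialCoeff (P : Params) (σ : ℝ → ℝ) : ℝ := (1 - P.m) + P.m * ∫ s in Ioi 0, σ s * s

theorem potentialCoeff_pos (hσ : MemoryKernel σ) : 0 < potentialCoeff P σ := by
  have h1 : 0 < ∫ s in Ioi 0, σ s * s := by
    rw [setIntegral_pos_iff_support_of_nonneg_ae ?_ (integrableOn_mul_self hσ)]
    · refine (hσ.isOpen_support.measure_pos volume hσ.support_nonempty).trans_le
        (measure_mono fun s hs => ⟨?_, hs.1⟩)
      exact (mul_pos hs.2 hs.1).ne'
    · filter_upwards [ae_restrict_mem measurableSet_Ioi] with s hs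
      exact mul_nonneg (hσ.nonneg s hs) (le_of_lt hs)
  rw [potentialCoeff]
  rcases P.m_mem.1.eq_or_lt with hm | hm
  · rw [← hm]; norm_num
  · have := mul_pos hm h1
    linarith [P.m_mem.2]

/-- Here $\eta(s)=sw$, so $\int\sigma\eta\,ds=\bigl(\int s\sigma\,ds\bigr)w$. -/
theorem potential_primitive_constMem (hσ : MemoryKernel σ) (w : H10 P.L) {η : W P σ}
    (hη : ∀ᵐ s ∂volume.restrict (memSupport P σ), η s = ∫ t in (0 : ℝ)..s, constMem P hσ w t) :
    potential (H10.fn w) η = (potentialCoeff P σ : ℂ) • H10.fn w := by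
  have := memMeasure_finite P hσ
  rcases P.m_mem.1.eq_or_lt with hm | hm
  · simp [potential, potentialCoeff, ← hm]
  rw [memSupport_eq hm] at hη
  have hc : ∀ᵐ s ∂volume.restrict (kernelSupport σ), constMem P hσ w s = w := by
    rw [← memSupport_eq (P := P) hm]
    exact (ae_memMeasure_iff P hσ).1 (Lp.coeFn_const (p := 2) (μ := memMeasure P σ) w)
  have hη' : ∀ᵐ s ∂volume.restrict (kernelSupport σ), η s = s • w := by
    filter_upwards [hη, ae_restrict_mem hσ.isOpen_support.measurableSet] with s hs hmem
    rw [hs, intervalIntegral.integral_of_le hmem.1.le, integral_congr_ae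
      (ae_restrict_of_ae_restrict_of_subset (hσ.Ioc_subset_support hmem) hc),
      ← intervalIntegral.integral_of_le hmem.1.le, intervalIntegral.integral_const, sub_zero]
  have e : ∫ s in Ioi (0 : ℝ), σ s • η s = (∫ s in Ioi 0, σ s * s) • w := by
    rw [← setIntegral_kernelSupport hσ, ← integral_smul_const]
    have e1 : ∫ s in kernelSupport σ, σ s • η s = ∫ s in kernelSupport σ, σ s • (s • w) :=
      integral_congr_ae (hη'.mono fun s hs => by simp only [hs])
    rw [e1, setIntegral_kernelSupport hσ]
    simp only [smul_smul]
  rw [potential_eq, e, ← Complex.coe_smul (∫ s in Ioi 0, σ s * s) w, map_smul, smul_smul,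
    ← add_smul, potentialCoeff]
  push_cast
  rfl

theorem surjective_operatorA (hσ : MemoryKernel σ) (F : EnergySpace P σ) :
    ∃ U : (operatorA P hσ).domain, operatorA P hσ U = F := by
  have hL := P.L_pos
  have hκ := potentialCoeff_pos (P := P) hσ
  -- The first equation gives $v=F_u$, so the heat equation reads $c\Lambda_{xx}=F_w+\delta v_x$ and
  -- determines $\Lambda$ before $w$ and $\eta$ are known.
  obtain ⟨Λ, hΛ1, hΛ2⟩ := exists_second_primitive_H10 hL
    (((1 / P.c : ℝ) : ℂ) • (F.w + (P.δ : ℂ) • weakDeriv (H1L.fn F.u)))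
  obtain ⟨η₁, hη₁, hη₁0, -⟩ := exists_isMemDeriv hσ F.η
  set X : H10 P.L := ∫ s in Ioi (0 : ℝ), σ s • η₁ s with hX
  -- The memory equation gives $\eta=sw-\eta_1$ with $\eta_1$ the primitive of $F_\eta$. Inserting
  -- this in $\Lambda^m$ yields $\Lambda=\kappa w-mX$ with $\kappa$ the `potentialCoeff`, which is
  -- solved for $w$.
  set w : H10 P.L := ((1 / potentialCoeff P σ : ℝ) : ℂ) • (Λ + (P.m : ℂ) • X) with hw
  obtain ⟨η₂, hη₂, hη₂0, hη₂ae⟩ := exists_isMemDeriv hσ (constMem P hσ w)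
  set η : W P σ := η₂ + (-1 : ℂ) • η₁ with hη
  have hmd : IsMemDeriv η (constMem P hσ w + (-1 : ℂ) • F.η) := hη₂.add hσ (hη₁.smul hσ (-1))
  have hpot : potential (H10.fn w) η = H10.fn Λ := by
    have e1 : potential (H10.fn w) η = potential (H10.fn w) η₂ + (-1 : ℂ) • potential 0 η₁ := by
      rw [← potential_smul hσ, ← potential_add hσ, smul_zero, add_zero]
    have e2 : potential (0 : L2 P.L) η₁ = H10.fn ((P.m : ℂ) • X) := by
      rw [potential_eq, smul_zero, zero_add, map_smul]
    rw [e1, e2, potential_primitive_constMem hσ w hη₂ae, ← map_smul, ← map_smul, ← map_add, hw,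
      smul_smul, ← Complex.ofReal_mul, mul_one_div_cancel hκ.ne', Complex.ofReal_one, one_smul]
    congr 1
    module
  -- Adding $\gamma$ times the second mechanical equation to the first eliminates $y_{xx}$ and
  -- leaves the coefficient $\alpha-\gamma^2\beta=\alpha_1$ in front of $u_{xx}$; the second
  -- equation then gives $y_{xx}$.
  obtain ⟨u, hu1, hu2, hu3⟩ := exists_second_primitive_H1L hL (((1 / P.α₁ : ℝ) : ℂ) •
    ((P.ρ : ℂ) • F.v + (P.δ : ℂ) • weakDeriv (H10.fn w) + ((P.γ * P.μ : ℝ) : ℂ) • F.z))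
  obtain ⟨y, hy1, hy2, hy3⟩ := exists_second_primitive_H1L hL
    (((P.μ / P.β : ℝ) : ℂ) • F.z + (P.γ : ℂ) • weakDeriv u.dx)
  have hdom : InDomain (EnergySpace.mk u (H1L.fn F.u) y (H1L.fn F.y) (H10.fn w) η) :=
    { v_mem := F.u.2
      z_mem := F.y.2
      ux_mem := hu1
      yx_mem := hy1
      w_mem := w.2
      potential_mem := by
        simp only [EnergySpace.w_mk, EnergySpace.η_mk, hpot]
        exact ⟨Λ.2.1, hΛ1⟩
      ηs_mem := ⟨_, hmd⟩
      η_zero := hη₂0.add (hη₁0.smul (-1))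
      ux_L := hu3
      yx_L := hy3 }
  refine ⟨⟨_, hdom⟩, ?_⟩
  have hρ : (P.ρ : ℂ) ≠ 0 := Complex.ofReal_ne_zero.2 P.ρ_pos.ne'
  have hμ : (P.μ : ℂ) ≠ 0 := Complex.ofReal_ne_zero.2 P.μ_pos.ne'
  have hα : (P.α₁ : ℂ) ≠ 0 := Complex.ofReal_ne_zero.2 P.α₁_pos.ne'
  have hβ : (P.β : ℂ) ≠ 0 := Complex.ofReal_ne_zero.2 P.β_pos.ne'
  have hc : (P.c : ℂ) ≠ 0 := Complex.ofReal_ne_zero.2 P.c_pos.ne'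
  change applyA P hσ _ hdom = F
  refine EnergySpace.ext' rfl ?_ rfl ?_ ?_ ?_
  · simp only [applyA, EnergySpace.v_mk, EnergySpace.u_mk, EnergySpace.y_mk, EnergySpace.w_mk,
      hy2, hu2, Params.α]
    push_cast
    match_scalars <;> field_simp <;> ring
  · simp only [applyA, EnergySpace.z_mk, EnergySpace.u_mk, EnergySpace.y_mk, hy2]
    push_cast
    match_scalars <;> field_simp
    ring
  · have e : weakDeriv (weakDeriv (H10.fn Λ)) = ((1 / P.c : ℝ) : ℂ) •
        (F.w + (P.δ : ℂ) • weakDeriv (H1L.fn F.u)) := hΛ2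
    simp only [applyA, EnergySpace.w_mk, EnergySpace.η_mk, EnergySpace.v_mk, hpot, e]
    push_cast
    match_scalars <;> field_simp
    ring
  · simp only [applyA, EnergySpace.η_mk, EnergySpace.w_mk, hmd.memDeriv_eq hσ]
    have e : H10.mk (H10.fn w) hdom.w_mem = w := rfl
    rw [e]
    module

end System

end Piezo

end

/-! ### Well-posedness of the piezoelectric beam system. -/

theorem mainTheorem5 (P : Piezo.Params) {σ : ℝ → ℝ} (hσ : Piezo.MemoryKernel σ) :
    CompleteSpace (Piezo.EnergySpace P σ) ∧
    Piezo.IsMDissipative (Piezo.operatorA P hσ) ∧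
    Dense ((Piezo.operatorA P hσ).domain : Set (Piezo.EnergySpace P σ)) ∧
    (∀ F : Piezo.EnergySpace P σ, ∃! U : (Piezo.operatorA P hσ).domain,
      -(Piezo.operatorA P hσ U) = F) ∧
    ∃ S : Piezo.ContractionSemigroup (Piezo.EnergySpace P σ),
      S.IsGeneratedBy (Piezo.operatorA P hσ) ∧
      (∀ U₀ : Piezo.EnergySpace P σ,
        Piezo.IsWeakSolution (Piezo.operatorA P hσ) U₀ (fun t => S.T t U₀) ∧
        ∀ U : ℝ → Piezo.EnergySpace P σ, Piezo.IsWeakSolution (Piezo.operatorA P hσ) U₀ U →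
          ∀ t, 0 ≤ t → U t = S.T t U₀) ∧
      (∀ U₀ ∈ (Piezo.operatorA P hσ).domain,
        Piezo.IsStrongSolution (Piezo.operatorA P hσ) U₀ (fun t => S.T t U₀) ∧
        ∀ U : ℝ → Piezo.EnergySpace P σ, Piezo.IsStrongSolution (Piezo.operatorA P hσ) U₀ U →
          ∀ t, 0 ≤ t → U t = S.T t U₀) :=
  ⟨inferInstance,
    (Piezo.isDissipative_operatorA hσ).generation (Piezo.surjective_operatorA hσ)⟩
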